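/- Let $p$ be a prime and let $G$ be a group whose commutator subgroup $G'$ is isomorphic to $\mathbb{Z}_p$. Let $S$ be a finite generating set of $G$, and let $\mathrm{Cay}(G;S)$ be the (simple, undirected) Cayley graph with vertex set $G$ in which distinct $g,h\in G$ are adjacent if and only if $g^{-1}h\in S\cup S^{-1}$. Suppose that $\mathrm{Cay}(G;S)$ is one-ended, i.e. has exactly one end (in particular, $G$ is infinite). Then $\mathrm{Cay}(G;S)$ has a hamiltonian circle, i.e. a homeomorphic copy of the unit circle $S^1$ in the Freudenthal compactification of $\mathrm{Cay}(G;S)$ (the $1$-complex of the graph together with its ends) that contains every vertex of $\mathrm{Cay}(G;S)$. -/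

import Mathlib

open scoped Classical in
/-- The geometric realization (`1`-complex) of a graph `X`, in barycentric coordinates: a point is
a function `x : V → ℝ` lying on the segment between the unit vectors of two adjacent vertices, or
equal to the unit vector of a vertex (`u = v`). The topology is that of pointwise convergence of the
coordinates; for locally finite graphs it is the usual topology of the `1`-complex. -/
def SimpleGraph.Realization {V : Type*} (X : SimpleGraph V) : Type _ :=
  {x : V → ℝ // ∃ u v : V, (u = v ∨ X.Adj u v) ∧
    x ∈ segment ℝ (Pi.single u 1 : V → ℝ) (Pi.single v 1)}

instance SimpleGraph.Realization.instTopologicalSpace {V : Type*} (X : SimpleGraph V) :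
    TopologicalSpace X.Realization :=
  inferInstanceAs (TopologicalSpace (Subtype _))

open scoped Classical in
/-- A vertex as a point of the geometric realization. -/
noncomputable def SimpleGraph.Realization.ofVertex {V : Type*} (X : SimpleGraph V) (v : V) :
    X.Realization :=
  ⟨Pi.single v 1, v, v, Or.inl rfl, left_mem_segment ℝ _ _⟩

/-- The points of the Freudenthal compactification `|X|` of a locally finite connected graph `X`:
the points of its `1`-complex together with its ends. -/
inductive SimpleGraph.Freudenthal {V : Type*} (X : SimpleGraph V) : Type _
  | point (x : X.Realization) : SimpleGraph.Freudenthal X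
  | atEnd (ω : X.end) : SimpleGraph.Freudenthal X

/-- The basic neighbourhood `Ĉ(K, ω)` of the end `ω`, for a finite vertex set `K`. Let `C` be the
component of `X - K` in which `ω` lives. Then `Ĉ(K, ω)` consists of the subgraph `C`, the inner points
of the edges between `K` and `C` (together: the points having a positive coordinate at a vertex
of `C`), and the ends that live in `C`. -/
def SimpleGraph.Freudenthal.endNhd {V : Type*} (X : SimpleGraph V) (K : Finset V) (ω : X.end) :
    Set X.Freudenthal :=
  {z | match z with
    | .point x => ∃ v ∈ (ω.1 (Opposite.op K)).supp, 0 < x.1 v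
    | .atEnd η => η.1 (Opposite.op K) = ω.1 (Opposite.op K)}

/-- The topology of `|X|`: it is generated by the open sets of the `1`-complex and the basic
neighbourhoods `Ĉ(K, ω)` of the ends. -/
instance SimpleGraph.Freudenthal.instTopologicalSpace {V : Type*} (X : SimpleGraph V) :
    TopologicalSpace X.Freudenthal :=
  TopologicalSpace.generateFrom
    ({U | ∃ O : Set X.Realization, IsOpen O ∧ U = SimpleGraph.Freudenthal.point '' O} ∪
      {U | ∃ (K : Finset V) (ω : X.end), U = SimpleGraph.Freudenthal.endNhd X K ω})

/-- A graph is one-ended if it has exactly one end. -/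
def SimpleGraph.IsOneEnded {V : Type*} (X : SimpleGraph V) : Prop :=
  ∃! ω, ω ∈ X.end

/-- A hamiltonian circle of `X`: a homeomorphic copy of the unit circle `S¹` in the Freudenthal
compactification of `X` that contains every vertex of `X`. -/
def SimpleGraph.IsHamiltonianCircle {V : Type*} (X : SimpleGraph V) (C : Set X.Freudenthal) :
    Prop :=
  Nonempty (Circle ≃ₜ C) ∧
    ∀ v : V, SimpleGraph.Freudenthal.point (SimpleGraph.Realization.ofVertex X v) ∈ C

/-!
# Hamiltonian circles in one-ended Cayley graphs

Let `G` be a group whose commutator subgroup has prime order `p`, let `π : G → A` be the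
abelianization, and let `T = S ∪ S⁻¹` be the symmetrized finite generating set. The proof
constructs a spanning double ray of the Cayley graph and closes it up with the unique end.

*Topology.* Both tails of a spanning double ray eventually stay in an infinite component of the
complement of any finite vertex set. By a compactness argument, every infinite component contains
an end (`SimpleGraph.exists_end_of_infinite`), so both tails converge to the only end.
Parametrizing the double ray by `ℝ` gives a continuous injection of `OnePoint ℝ`, which is a
circle, into the Freudenthal compactification, which is Hausdorff since there is one end only
(`SimpleGraph.IsOneEnded.exists_isHamiltonianCircle`).

*Independent steps.* If any two steps satisfied a non-trivial relation in `A`, then `A` would be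
finite or virtually cyclic, and `G` would have no end or two ends. So there are `c, d ∈ T` that
generate a free abelian group of rank two in `A` (`exists_indep_of_isOneEnded`).

*From cycles to paths.* The tool for lifting paths from `A` to `G` is `SectionPath.liftable`: if a
cycle through `X ⊆ A`, lifted to `G`, does not close up, then it ends at a non-trivial element of
the kernel, which generates the kernel as `p` is prime. So running round the cycle `p` times,
leaving out the very last step, gives a Hamiltonian path of `π ⁻¹' X`.

*Blocks.* Let `F ⊆ A` represent the cosets of `⟨c, d⟩` in a subgroup `M` of `A`. The blocks
`{1, c ^ ±1} × {1, d ^ ±1} × F` and their translates tile `A`, and are arranged like the vertices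
of `ℤ × ℤ × I`, where `I` indexes the cosets of `M`; the Cayley graph on `I` has a Hamiltonian
path or double ray. If the preimage of every block can be traversed from one corner to both of the
neighbouring corners (`FlexibleBlock`), then these traversals can be strung together along a
double ray of `ℤ × ℤ × I`, since at each block one can choose the exit from which the next block
is reached (`hamDoubleRay_of_flexibleBlock`).

*Finding a flexible block.* Let `a, b ∈ T` not commute. Prisms `{1, c} × X` over a path `X` from
`1` to `w` contain a spanning cycle, the lift of which closes up only if `c` commutes with `w`.
This provides a flexible block if there are non-commuting independent steps
(`GridSetup.hamDoubleRay_of_not_commute`) or, in most cases, if a step does not commute with a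
step of infinite order (`GridSetup.hamDoubleRay_of_dependent`). The only other source of cycles
that do not close up in these cases are two steps with the same image in `A`. There remains the
case that `a` and `b` have finite order in `A` and commute with `c` and `d`. Either a cycle
through the powers of some step does not close up (`GridSetup.hamDoubleRay_of_pow_ne_one`), or two
prisms in the direction of `c` over paths in `⟨a, b⟩` are joined along the square with sides `a`
and `b`, which makes the commutator of `a` and `b` appear (`liftable_merge`, `liftable_central`).
-/

/-! ### Hamiltonian paths, rays and double rays of a relation -/

/-- The set `B` has a Hamiltonian path with respect to the adjacency relation `r`, starting at `x`
and ending at `y`: a duplicate-free list with `r`-related consecutive entries whose entries are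
exactly the elements of `B`. -/
def HamPath {V : Type*} (r : V → V → Prop) (B : Set V) (x y : V) : Prop :=
  ∃ l : List V, l.head? = some x ∧ l.getLast? = some y ∧ l.Nodup ∧ l.IsChain r ∧
    ∀ v, v ∈ l ↔ v ∈ B

/-- The set `B` has a one-way infinite Hamiltonian path (a ray) with respect to `r`, starting
at `x`. -/
def HamRay {V : Type*} (r : V → V → Prop) (B : Set V) (x : V) : Prop :=
  ∃ ρ : ℕ → V, Function.Injective ρ ∧ Set.range ρ = B ∧ ρ 0 = x ∧ ∀ n, r (ρ n) (ρ (n + 1))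

/-- The relation `r` has a two-way infinite Hamiltonian path (a double ray) through all of `V`. -/
def HamDoubleRay {V : Type*} (r : V → V → Prop) : Prop :=
  ∃ φ : ℤ → V, Function.Bijective φ ∧ ∀ n, r (φ n) (φ (n + 1))

namespace HamPath

variable {V W : Type*} {r : V → V → Prop}

theorem single (x : V) : HamPath r {x} x x :=
  ⟨[x], by simp⟩

theorem append {B B' : Set V} {x y x' y' : V} (h : HamPath r B x y) (h' : HamPath r B' x' y')
    (hr : r y x') (hd : Disjoint B B') : HamPath r (B ∪ B') x y' := by
  obtain ⟨l, hx, hy, hn, hc, hm⟩ := h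
  obtain ⟨l', hx', hy', hn', hc', hm'⟩ := h'
  refine ⟨l ++ l', ?_, ?_, ?_, ?_, ?_⟩
  · simp [hx]
  · simp [hy']
  · refine List.Nodup.append hn hn' ?_
    intro a ha ha'
    exact Set.disjoint_left.1 hd ((hm a).1 ha) ((hm' a).1 ha')
  · refine List.isChain_append.2 ⟨hc, hc', ?_⟩
    intro a ha b hb
    simp only [hy, hx', Option.mem_def, Option.some.injEq] at ha hb
    subst ha; subst hb; exact hr
  · intro v
    simp [hm, hm']

theorem reverse (hs : ∀ a b, r a b → r b a) {B : Set V} {x y : V} (h : HamPath r B x y) :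
    HamPath r B y x := by
  obtain ⟨l, hx, hy, hn, hc, hm⟩ := h
  refine ⟨l.reverse, by simp [hy], by simp [hx], List.nodup_reverse.2 hn, ?_, by simp [hm]⟩
  rw [List.isChain_reverse]
  exact hc.imp hs

theorem map {r' : W → W → Prop} (f : V → W) (hr : ∀ a b, r a b → r' (f a) (f b)) {B : Set V}
    (hf : Set.InjOn f B) {x y : V} (h : HamPath r B x y) : HamPath r' (f '' B) (f x) (f y) := by
  obtain ⟨l, hx, hy, hn, hc, hm⟩ := h
  refine ⟨l.map f, by simp [hx], by simp [hy], ?_, List.isChain_map_of_isChain f hr hc, ?_⟩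
  · refine List.Nodup.map_on ?_ hn
    intro a ha b hb hab
    exact hf ((hm a).1 ha) ((hm b).1 hb) hab
  · intro v
    simp [hm]

theorem congr {B B' : Set V} {x y : V} (h : HamPath r B x y) (hB : B = B') : HamPath r B' x y :=
  hB ▸ h

theorem end_mem {B : Set V} {x y : V} (h : HamPath r B x y) : y ∈ B := by
  obtain ⟨l, hx, hy, hn, hc, hm⟩ := h
  exact (hm y).1 (List.mem_of_getLast? hy)

/-- A path indexed by an initial segment of `ℕ`. -/
theorem of_seq (f : ℕ → V) (n : ℕ) (hf : Set.InjOn f (Set.Iic n))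
    (hr : ∀ i < n, r (f i) (f (i + 1))) : HamPath r (f '' Set.Iic n) (f 0) (f n) := by
  induction n with
  | zero =>
    refine (single (f 0)).congr ?_
    ext v; simp [eq_comm]
  | succ n ih =>
    have h := ih (hf.mono fun i hi => le_trans hi (Nat.le_succ n)) fun i hi => hr i (by omega)
    refine (h.append (single (f (n + 1))) (hr n (by omega)) ?_).congr ?_
    · rw [Set.disjoint_singleton_right]
      rintro ⟨i, hi, he⟩
      have hi' : i ≤ n := hi
      have := hf (show i ∈ Set.Iic (n + 1) from le_trans hi' (Nat.le_succ n))
        (Set.mem_Iic.2 le_rfl) he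
      omega
    · ext v
      constructor
      · rintro (⟨i, hi, rfl⟩ | rfl)
        · exact ⟨i, le_trans (Set.mem_Iic.1 hi) (Nat.le_succ n), rfl⟩
        · exact ⟨n + 1, Set.mem_Iic.2 le_rfl, rfl⟩
      · rintro ⟨i, hi, rfl⟩
        have hi' : i ≤ n + 1 := hi
        rcases Nat.lt_or_ge n i with h1 | h1
        · right
          rw [show i = n + 1 by omega]; rfl
        · exact Or.inl ⟨i, h1, rfl⟩

end HamPath

section Rays

variable {V : Type*} {r : V → V → Prop}

/-- Concatenating infinitely many finite paths, each of which ends next to the start of the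
following one, gives a ray. -/
theorem HamRay.of_paths (B : ℕ → Set V) (x y : ℕ → V) (h : ∀ n, HamPath r (B n) (x n) (y n))
    (hr : ∀ n, r (y n) (x (n + 1))) (hd : ∀ m n, m < n → Disjoint (B m) (B n)) :
    HamRay r (⋃ n, B n) (x 0) := by
  choose l hx hy hn hc hm using h
  -- `L n` is the concatenation of the first `n + 1` paths; it is a prefix of `L (n + 1)`.
  let L : ℕ → List V := fun n => Nat.rec (l 0) (fun k acc => acc ++ l (k + 1)) n
  have L0 : L 0 = l 0 := rfl
  have Ls : ∀ n, L (n + 1) = L n ++ l (n + 1) := fun n => rfl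
  have hl : ∀ n, l n ≠ [] := by
    intro n h
    have := hx n
    simp [h] at this
  have hlast : ∀ n, (L n).getLast? = some (y n) := by
    intro n
    cases n with
    | zero => rw [L0, hy]
    | succ n => rw [Ls]; simp [hy]
  have hmem : ∀ n v, v ∈ L n ↔ ∃ m ≤ n, v ∈ B m := by
    intro n v
    induction n with
    | zero => simp [L0, hm]
    | succ n ih =>
      rw [Ls, List.mem_append, ih, hm]
      constructor
      · rintro (⟨m, h1, h2⟩ | h)
        · exact ⟨m, by omega, h2⟩
        · exact ⟨n + 1, le_rfl, h⟩
      · rintro ⟨m, h1, h2⟩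
        rcases Nat.lt_or_ge n m with h3 | h3
        · right; rwa [show n + 1 = m by omega]
        · exact Or.inl ⟨m, h3, h2⟩
  have hnodup : ∀ n, (L n).Nodup := by
    intro n
    induction n with
    | zero => exact hn 0
    | succ n ih =>
      rw [Ls]
      refine List.Nodup.append ih (hn _) ?_
      intro a ha ha'
      obtain ⟨m, h1, h2⟩ := (hmem n a).1 ha
      exact Set.disjoint_left.1 (hd m (n + 1) (by omega)) h2 ((hm _ a).1 ha')
  have hchain : ∀ n, (L n).IsChain r := by
    intro n
    induction n with
    | zero => exact hc 0
    | succ n ih =>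
      rw [Ls]
      refine List.isChain_append.2 ⟨ih, hc _, ?_⟩
      intro a ha b hb
      simp only [hlast, hx, Option.mem_def, Option.some.injEq] at ha hb
      subst ha; subst hb; exact hr n
  have hlen : ∀ n, n < (L n).length := by
    intro n
    induction n with
    | zero => exact List.length_pos_iff.2 (hl 0)
    | succ n ih =>
      rw [Ls, List.length_append]
      have := List.length_pos_iff.2 (hl (n + 1))
      omega
  have hpre : ∀ m n, m ≤ n → L m <+: L n := by
    intro m n hmn
    induction n, hmn using Nat.le_induction with
    | base => exact List.prefix_rfl
    | succ n _ ih => exact ih.trans (Ls n ▸ List.prefix_append _ _)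
  have hget : ∀ m n i (h1 : i < (L m).length) (h2 : i < (L n).length), (L m)[i] = (L n)[i] := by
    intro m n i h1 h2
    rcases le_total m n with h | h
    · exact (hpre m n h).getElem h1
    · exact ((hpre n m h).getElem h2).symm
  refine ⟨fun n => (L n)[n]'(hlen n), ?_, ?_, ?_, ?_⟩
  · intro m n hmn
    have hmn : (L m)[m]'(hlen m) = (L n)[n]'(hlen n) := hmn
    have h1 : m < (L (max m n)).length := lt_of_le_of_lt (le_max_left m n) (hlen _)
    have h2 : n < (L (max m n)).length := lt_of_le_of_lt (le_max_right m n) (hlen _)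
    rw [hget m (max m n) m (hlen m) h1, hget n (max m n) n (hlen n) h2] at hmn
    exact (hnodup _).getElem_inj_iff.1 hmn
  · ext v
    simp only [Set.mem_range, Set.mem_iUnion]
    constructor
    · rintro ⟨n, rfl⟩
      obtain ⟨m, -, h⟩ := (hmem n _).1 (List.getElem_mem (hlen n))
      exact ⟨m, h⟩
    · rintro ⟨n, hv⟩
      obtain ⟨i, hi, he⟩ := List.getElem_of_mem ((hmem n v).2 ⟨n, le_rfl, hv⟩)
      exact ⟨i, (hget i n i (hlen i) hi).trans he⟩
  · have := hx 0
    rw [← L0, List.head?_eq_getElem?, List.getElem?_eq_getElem (hlen 0)] at this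
    exact Option.some.inj this
  · intro n
    have h1 : n < (L (n + 1)).length := lt_trans (Nat.lt_succ_self n) (hlen _)
    change r ((L n)[n]'(hlen n)) ((L (n + 1))[n + 1]'(hlen (n + 1)))
    rw [hget n (n + 1) n (hlen n) h1]
    exact (List.isChain_iff_getElem.1 (hchain (n + 1))) n (hlen _)

/-- Two rays with complementary vertex sets and adjacent starting points form a double ray. -/
theorem HamDoubleRay.of_rays (hs : ∀ a b, r a b → r b a) {B B' : Set V} {x x' : V}
    (h : HamRay r B x) (h' : HamRay r B' x') (hr : r x' x) (hB : IsCompl B B') :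
    HamDoubleRay r := by
  obtain ⟨ρ, hi, hR, h0, ha⟩ := h
  obtain ⟨ρ', hi', hR', h0', ha'⟩ := h'
  let φ : ℤ → V := fun n => match n with
    | .ofNat n => ρ n
    | .negSucc n => ρ' n
  have hne : ∀ m n, ρ m ≠ ρ' n := by
    intro m n h
    exact Set.disjoint_left.1 hB.disjoint (hR ▸ Set.mem_range_self m)
      (h ▸ hR' ▸ Set.mem_range_self n)
  refine ⟨φ, ⟨?_, ?_⟩, ?_⟩
  · rintro (m | m) (n | n) h
    · exact congrArg _ (hi h)
    · exact absurd h (hne m n)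
    · exact absurd h.symm (hne n m)
    · exact congrArg _ (hi' h)
  · intro v
    have : v ∈ B ∪ B' := by
      have := hB.sup_eq_top
      change B ∪ B' = Set.univ at this
      rw [this]; trivial
    rcases this with hv | hv
    · rw [← hR] at hv
      obtain ⟨n, rfl⟩ := hv
      exact ⟨.ofNat n, rfl⟩
    · rw [← hR'] at hv
      obtain ⟨n, rfl⟩ := hv
      exact ⟨.negSucc n, rfl⟩
  · rintro (n | n)
    · exact ha n
    · cases n with
      | zero => change r (ρ' 0) (ρ 0); rw [h0, h0']; exact hr
      | succ n =>
        have : Int.negSucc (n + 1) + 1 = Int.negSucc n := by omega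
        rw [this]
        exact hs _ _ (ha' n)

theorem HamDoubleRay.map {W : Type*} {r' : W → W → Prop} (h : HamDoubleRay r) (f : V → W)
    (hf : Function.Bijective f) (hr : ∀ a b, r a b → r' (f a) (f b)) : HamDoubleRay r' := by
  obtain ⟨φ, hφ, ha⟩ := h
  exact ⟨f ∘ φ, hf.comp hφ, fun n => hr _ _ (ha n)⟩

end Rays

/-! ### Grids -/

/-- The adjacency relation of the Cartesian (box) product of two relations. -/
def boxRel {V W : Type*} (r : V → V → Prop) (s : W → W → Prop) (a b : V × W) : Prop :=
  (r a.1 b.1 ∧ a.2 = b.2) ∨ (a.1 = b.1 ∧ s a.2 b.2)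

/-- The adjacency relation of the two-way infinite path on `ℤ`. -/
def intStep (a b : ℤ) : Prop := b = a + 1 ∨ a = b + 1

theorem intStep_symm (a b : ℤ) (h : intStep a b) : intStep b a := h.symm

theorem boxRel_symm {V W : Type*} {r : V → V → Prop} {s : W → W → Prop}
    (hr : ∀ a b, r a b → r b a) (hs : ∀ a b, s a b → s b a) (a b : V × W) (h : boxRel r s a b) :
    boxRel r s b a := by
  rcases h with ⟨h1, h2⟩ | ⟨h1, h2⟩
  · exact Or.inl ⟨hr _ _ h1, h2.symm⟩
  · exact Or.inr ⟨h1.symm, hs _ _ h2⟩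

theorem hamPath_int_up (a : ℤ) (n : ℕ) : HamPath intStep (Set.Icc a (a + n)) a (a + n) := by
  have h := HamPath.of_seq (r := intStep) (fun i : ℕ => a + (i : ℤ)) n
    (fun i _ j _ h => by simpa using h) (fun i _ => Or.inl (by push_cast; ring))
  simp only [Nat.cast_zero, add_zero] at h
  refine h.congr ?_
  ext v
  constructor
  · rintro ⟨i, hi, rfl⟩
    have : i ≤ n := hi
    constructor <;> dsimp only <;> omega
  · rintro ⟨h1, h2⟩
    exact ⟨(v - a).toNat, Set.mem_Iic.2 (by omega), by dsimp only; omega⟩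

/-- The segment between two integers, traversed from `a` to `b`. -/
theorem hamPath_int (a b : ℤ) : HamPath intStep (Set.uIcc a b) a b := by
  rcases le_total a b with h | h
  · have := hamPath_int_up a (b - a).toNat
    rw [show a + ((b - a).toNat : ℤ) = b by omega] at this
    rwa [Set.uIcc_of_le h]
  · have := hamPath_int_up b (a - b).toNat
    rw [show b + ((a - b).toNat : ℤ) = a by omega] at this
    rw [Set.uIcc_of_ge h]
    exact this.reverse intStep_symm

theorem hamPath_horizontal {W : Type*} (s : W → W → Prop) (a b : ℤ) (w : W) :
    HamPath (boxRel intStep s) {q | q.1 ∈ Set.uIcc a b ∧ q.2 = w} (a, w) (b, w) := by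
  refine ((hamPath_int a b).map (fun i => (i, w)) (fun i j h => Or.inl ⟨h, rfl⟩)
    (fun i _ j _ h => (Prod.mk.inj h).1)).congr ?_
  ext ⟨i, j⟩
  simp only [Set.mem_image, Prod.mk.injEq, Set.mem_ofPred_eq]
  constructor
  · rintro ⟨k, h1, rfl, rfl⟩; exact ⟨h1, rfl⟩
  · rintro ⟨h1, rfl⟩; exact ⟨i, h1, rfl, rfl⟩

theorem hamPath_vertical {W : Type*} {r : ℤ → ℤ → Prop} {s : W → W → Prop} {B : Set W} {x y : W}
    (h : HamPath s B x y) (i : ℤ) :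
    HamPath (boxRel r s) {q | q.1 = i ∧ q.2 ∈ B} (i, x) (i, y) := by
  refine (h.map (fun w => (i, w)) (fun i j h => Or.inr ⟨rfl, h⟩)
    (fun i _ j _ h => (Prod.mk.inj h).2)).congr ?_
  ext ⟨k, j⟩
  simp only [Set.mem_image, Prod.mk.injEq, Set.mem_ofPred_eq]
  constructor
  · rintro ⟨k, h1, rfl, rfl⟩; exact ⟨rfl, h1⟩
  · rintro ⟨rfl, h1⟩; exact ⟨j, h1, rfl, rfl⟩

/-- Traversal of the `n`-th layer of the half-plane `ℤ≥0 × ℤ`: the three sides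
`[0, n] × {-n}`, `{n} × [-n, n]`, `[0, n] × {n}`, from bottom to top. -/
theorem hamPath_layer (n : ℕ) :
    HamPath (boxRel intStep intStep)
      {q : ℤ × ℤ | 0 ≤ q.1 ∧ max q.1 (max q.2 (-q.2)) = n} (0, -(n : ℤ)) (0, (n : ℤ)) := by
  rcases Nat.eq_zero_or_pos n with rfl | hn
  · refine (HamPath.single _).congr ?_
    ext ⟨a, b⟩
    simp only [Set.mem_singleton_iff, Prod.mk.injEq, Set.mem_ofPred_eq]
    omega
  · have h1 := hamPath_horizontal intStep 0 ((n : ℤ) - 1) (-(n : ℤ))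
    have h2 := hamPath_vertical (r := intStep) (hamPath_int (-(n : ℤ)) n) n
    have h3 := hamPath_horizontal intStep ((n : ℤ) - 1) 0 (n : ℤ)
    refine ((h1.append h2 (Or.inl ⟨Or.inl (by simp), rfl⟩) ?_).append h3
      (Or.inl ⟨Or.inr (by simp), rfl⟩) ?_).congr ?_
    · rw [Set.disjoint_left]
      rintro ⟨a, b⟩ ⟨h1, h2⟩ ⟨h3, h4⟩
      simp only [Set.mem_uIcc] at *
      omega
    · rw [Set.disjoint_left]
      rintro ⟨a, b⟩ (⟨h1, h2⟩ | ⟨h1, h2⟩) ⟨h3, h4⟩ <;>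
      · simp only [Set.mem_uIcc] at *
        omega
    · ext ⟨a, b⟩
      simp only [Set.mem_union, Set.mem_ofPred_eq, Set.mem_uIcc]
      omega

/-- The half-plane `ℤ≥0 × ℤ` has a Hamiltonian ray, running through the layers alternately upwards
and downwards. -/
theorem hamRay_halfPlane :
    HamRay (boxRel intStep intStep) {q : ℤ × ℤ | 0 ≤ q.1} (0, 0) := by
  have hsymm := boxRel_symm intStep_symm intStep_symm
  have key := HamRay.of_paths (r := boxRel intStep intStep)
    (fun n : ℕ => {q : ℤ × ℤ | 0 ≤ q.1 ∧ max q.1 (max q.2 (-q.2)) = n})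
    (fun n => if Even n then (0, -(n : ℤ)) else (0, (n : ℤ)))
    (fun n => if Even n then (0, (n : ℤ)) else (0, -(n : ℤ)))
    (fun n => by
      split_ifs with h
      · exact hamPath_layer n
      · exact (hamPath_layer n).reverse hsymm)
    (fun n => by
      by_cases h : Even n
      · have h' : ¬ Even (n + 1) := by rw [Nat.even_add_one]; simpa using h
        simp only [h, h', if_true, if_false]
        exact Or.inr ⟨rfl, Or.inl (by push_cast; ring)⟩
      · have h' : Even (n + 1) := by rw [Nat.even_add_one]; exact h
        simp only [h, h', if_true, if_false]
        exact Or.inr ⟨rfl, Or.inr (by push_cast; ring)⟩)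
    (fun m n hmn => by
      rw [Set.disjoint_left]
      rintro q ⟨_, h1⟩ ⟨_, h2⟩
      omega)
  have hU : (⋃ n : ℕ, {q : ℤ × ℤ | 0 ≤ q.1 ∧ max q.1 (max q.2 (-q.2)) = n}) =
      {q : ℤ × ℤ | 0 ≤ q.1} := by
    ext ⟨a, b⟩
    simp only [Set.mem_iUnion, Set.mem_ofPred_eq]
    constructor
    · rintro ⟨n, h, -⟩; exact h
    · intro h
      exact ⟨(max a (max b (-b))).toNat, h, by omega⟩
  rw [hU] at key
  simpa using key

theorem HamRay.map {V W : Type*} {r : V → V → Prop} {r' : W → W → Prop} {B : Set V} {x : V}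
    (h : HamRay r B x) (f : V → W) (hf : Function.Injective f)
    (hr : ∀ a b, r a b → r' (f a) (f b)) : HamRay r' (f '' B) (f x) := by
  obtain ⟨ρ, hi, hR, h0, ha⟩ := h
  exact ⟨f ∘ ρ, hf.comp hi, by rw [Set.range_comp, hR], by simp [h0], fun n => hr _ _ (ha n)⟩

theorem hamDoubleRay_int_int : HamDoubleRay (boxRel intStep intStep) := by
  have hsymm := boxRel_symm intStep_symm intStep_symm
  have h' := hamRay_halfPlane.map (r' := boxRel intStep intStep)
    (fun q : ℤ × ℤ => (-1 - q.1, q.2))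
    (fun p q h => by
      simp only [Prod.mk.injEq] at h
      ext <;> omega)
    (fun p q h => by
      rcases h with ⟨h | h, h2⟩ | ⟨h1, h2⟩
      · exact Or.inl ⟨Or.inr (by simp only; omega), h2⟩
      · exact Or.inl ⟨Or.inl (by simp only; omega), h2⟩
      · exact Or.inr ⟨by simp only; omega, h2⟩)
  refine HamDoubleRay.of_rays hsymm hamRay_halfPlane h' (Or.inl ⟨Or.inl (by simp), rfl⟩) ?_
  have : ((fun q : ℤ × ℤ => (-1 - q.1, q.2)) '' {q : ℤ × ℤ | 0 ≤ q.1}) =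
      {q : ℤ × ℤ | 0 ≤ q.1}ᶜ := by
    ext ⟨a, b⟩
    simp only [Set.mem_image, Set.mem_ofPred_eq, Set.mem_compl_iff, Prod.mk.injEq, Prod.exists]
    constructor
    · rintro ⟨i, j, h, h1, h2⟩; omega
    · intro h; exact ⟨-1 - a, b, by omega, by omega, rfl⟩
  rw [this]
  exact isCompl_compl

/-- A strip `ℤ × W` of finite width: the columns are traversed alternately in the two directions. -/
theorem hamDoubleRay_int_fin {W : Type*} {s : W → W → Prop} (hs : ∀ a b, s a b → s b a) {x y : W}
    (h : HamPath s Set.univ x y) : HamDoubleRay (boxRel intStep s) := by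
  have hsymm := boxRel_symm intStep_symm hs
  have key : ∀ (e : ℕ → ℤ) (_ : ∀ n, intStep (e n) (e (n + 1))) (_ : Function.Injective e)
      (a b : W) (_ : HamPath s Set.univ a b),
      HamRay (boxRel intStep s) {q | ∃ n, q.1 = e n} (e 0, a) := by
    intro e he hei a b hab
    have := HamRay.of_paths (r := boxRel intStep s)
      (fun n : ℕ => {q : ℤ × W | q.1 = e n ∧ q.2 ∈ Set.univ})
      (fun n => if Even n then (e n, a) else (e n, b))
      (fun n => if Even n then (e n, b) else (e n, a))
      (fun n => by
        split_ifs
        · exact hamPath_vertical hab (e n)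
        · exact (hamPath_vertical hab (e n)).reverse hsymm)
      (fun n => by
        by_cases h : Even n
        · have h' : ¬ Even (n + 1) := by rw [Nat.even_add_one]; simpa using h
          simp only [h, h', if_true, if_false]
          exact Or.inl ⟨he n, rfl⟩
        · have h' : Even (n + 1) := by rw [Nat.even_add_one]; exact h
          simp only [h, h', if_true, if_false]
          exact Or.inl ⟨he n, rfl⟩)
      (fun m n hmn => by
        rw [Set.disjoint_left]
        rintro q ⟨h1, _⟩ ⟨h2, _⟩
        have := hei (h1.symm.trans h2)
        omega)
    have hU : (⋃ n : ℕ, {q : ℤ × W | q.1 = e n ∧ q.2 ∈ Set.univ}) = {q | ∃ n, q.1 = e n} := by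
      ext q; simp
    rw [hU] at this
    simpa using this
  have h1 := key (fun n => (n : ℤ)) (fun n => Or.inl (by push_cast; ring))
    (fun a b h => by simpa using h) x y h
  have h2 := key (fun n => -1 - (n : ℤ)) (fun n => Or.inr (by push_cast; ring))
    (fun a b h => by simpa using h) x y h
  refine HamDoubleRay.of_rays hsymm h1 h2 (Or.inl ⟨Or.inl (by simp), rfl⟩) ?_
  have : {q : ℤ × W | ∃ n : ℕ, q.1 = -1 - (n : ℤ)} = {q : ℤ × W | ∃ n : ℕ, q.1 = (n : ℤ)}ᶜ := by
    ext q
    simp only [Set.mem_ofPred_eq, Set.mem_compl_iff, not_exists]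
    constructor
    · rintro ⟨n, h⟩ m; omega
    · intro h
      refine ⟨(-1 - q.1).toNat, ?_⟩
      have := h q.1.toNat
      omega
  rw [this]
  exact isCompl_compl

/-- A relation has a Hamiltonian line if it has a finite Hamiltonian path or a Hamiltonian double
ray. -/
def HamLine {V : Type*} (r : V → V → Prop) : Prop :=
  (∃ x y, HamPath r Set.univ x y) ∨ HamDoubleRay r

theorem HamDoubleRay.box {V W : Type*} {r : V → V → Prop} {s : W → W → Prop}
    (hr : ∀ a b, r a b → r b a) (hs : ∀ a b, s a b → s b a) (h : HamDoubleRay r)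
    (h' : HamLine s) : HamDoubleRay (boxRel r s) := by
  obtain ⟨φ, hφ, ha⟩ := h
  have hφ' : ∀ a b, intStep a b → r (φ a) (φ b) := by
    rintro a b (rfl | rfl)
    · exact ha a
    · exact hr _ _ (ha b)
  rcases h' with ⟨x, y, h'⟩ | ⟨ψ, hψ, hb⟩
  · refine (hamDoubleRay_int_fin hs h').map (fun q => (φ q.1, q.2))
      (hφ.prodMap Function.bijective_id) ?_
    rintro a b (⟨h1, h2⟩ | ⟨h1, h2⟩)
    · exact Or.inl ⟨hφ' _ _ h1, h2⟩
    · exact Or.inr ⟨congrArg φ h1, h2⟩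
  · have hψ' : ∀ a b, intStep a b → s (ψ a) (ψ b) := by
      rintro a b (rfl | rfl)
      · exact hb a
      · exact hs _ _ (hb b)
    refine hamDoubleRay_int_int.map (fun q => (φ q.1, ψ q.2)) (hφ.prodMap hψ) ?_
    rintro a b (⟨h1, h2⟩ | ⟨h1, h2⟩)
    · exact Or.inl ⟨hφ' _ _ h1, congrArg ψ h2⟩
    · exact Or.inr ⟨congrArg φ h1, hψ' _ _ h2⟩

/-- A finite grid is traversed row by row, in alternating directions. -/
theorem HamPath.box {V W : Type*} {r : V → V → Prop} {s : W → W → Prop}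
    (hs : ∀ a b, s a b → s b a) (hr : ∀ a b, r a b → r b a) {x y : V} {a b : W}
    (h : HamPath r Set.univ x y) (h' : HamPath s Set.univ a b) :
    ∃ u v, HamPath (boxRel r s) Set.univ u v := by
  obtain ⟨l, hx, hy, hn, hc, hm⟩ := h
  have hsymm := boxRel_symm hr hs
  have key : ∀ l : List V, l.Nodup → l.IsChain r → ∀ x, l.head? = some x → ∀ a b,
      HamPath s Set.univ a b →
      ∃ v, HamPath (boxRel r s) {q | q.1 ∈ l} (x, a) v := by
    intro l
    induction l with
    | nil => intro _ _ x hx; simp at hx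
    | cons c l ih =>
      intro hn hc x hx a b hab
      simp only [List.head?_cons, Option.some.injEq] at hx
      subst hx
      have hcol : HamPath (boxRel r s) {q : V × W | q.1 = c} (c, a) (c, b) := by
        refine (hab.map (fun w => (c, w)) (fun i j h => Or.inr ⟨rfl, h⟩)
          (fun i _ j _ h => (Prod.mk.inj h).2)).congr ?_
        ext ⟨k, j⟩
        simp [eq_comm]
      cases l with
      | nil => exact ⟨_, hcol.congr (by ext; simp)⟩
      | cons c' l =>
        obtain ⟨v, hv⟩ := ih (List.nodup_cons.1 hn).2 (List.isChain_cons_cons.1 hc).2 c' rfl b a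
          (hab.reverse hs)
        refine ⟨v, (hcol.append hv (Or.inl ⟨(List.isChain_cons_cons.1 hc).1, rfl⟩) ?_).congr ?_⟩
        · rw [Set.disjoint_left]
          intro q h1 h2
          have h1 : q.1 = c := h1
          exact (List.nodup_cons.1 hn).1 (h1 ▸ h2)
        · ext q
          simp only [Set.mem_union, Set.mem_ofPred_eq, List.mem_cons]
  obtain ⟨v, hv⟩ := key l hn hc x hx a b h'
  exact ⟨_, v, hv.congr (by ext q; simp [hm])⟩

theorem HamLine.box {V W : Type*} {r : V → V → Prop} {s : W → W → Prop}
    (hr : ∀ a b, r a b → r b a) (hs : ∀ a b, s a b → s b a) (h : HamLine r)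
    (h' : HamLine s) : HamLine (boxRel r s) := by
  rcases h with ⟨x, y, h⟩ | h
  · rcases h' with ⟨x', y', h'⟩ | h'
    · exact Or.inl (h.box hs hr h')
    · have := h'.box hs hr (Or.inl ⟨x, y, h⟩)
      refine Or.inr (this.map Prod.swap Prod.swap_bijective ?_)
      rintro a b (⟨h1, h2⟩ | ⟨h1, h2⟩)
      · exact Or.inr ⟨h2, h1⟩
      · exact Or.inl ⟨h2, h1⟩
  · exact Or.inr (h.box hr hs h')

/-! ### Hamiltonian lines in quotients of abelian groups -/

theorem zpow_mem_iff_orderOf_dvd {A : Type*} [CommGroup A] (M : Subgroup A) (b : A) (k : ℤ) :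
    b ^ k ∈ M ↔ ((orderOf (b : A ⧸ M) : ℕ) : ℤ) ∣ k := by
  rw [orderOf_dvd_iff_zpow_eq_one, ← QuotientGroup.mk_zpow, QuotientGroup.eq_one_iff]

/-- The integers modulo the period of `s` relative to the subgroup `M` form a line: there are
exponents `e j`, arranged along a finite or two-way infinite path with unit steps, such that the
elements `s ^ e j` represent the cosets of `M` in `M ⟨s⟩` exactly once. -/
theorem exists_exponent_line {A : Type*} [CommGroup A] (M : Subgroup A) (s : A) :
    ∃ (J : Type) (r : J → J → Prop) (e : J → ℤ), (∀ i j, r i j → r j i) ∧ HamLine r ∧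
      (∀ i j, r i j → intStep (e i) (e j)) ∧ ∀ k : ℤ, ∃! j, s ^ (k - e j) ∈ M := by
  have hdvd := zpow_mem_iff_orderOf_dvd M s
  rcases Nat.eq_zero_or_pos (orderOf (s : A ⧸ M)) with h0 | h0
  · refine ⟨ℤ, intStep, id, intStep_symm, Or.inr ⟨id, Function.bijective_id, fun n => Or.inl rfl⟩,
      fun i j h => h, fun k => ⟨k, by simp [M.one_mem], fun j hj => ?_⟩⟩
    simp only [hdvd, h0, Nat.cast_zero, zero_dvd_iff, id] at hj
    omega
  · obtain ⟨m, hm⟩ : ∃ m, orderOf (s : A ⧸ M) = m + 1 := ⟨_, (Nat.succ_pred_eq_of_pos h0).symm⟩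
    rw [hm] at hdvd
    have hpath := HamPath.of_seq
      (r := fun i j : Fin (m + 1) => intStep ((i : ℕ) : ℤ) ((j : ℕ) : ℤ))
      (fun i => Fin.ofNat (m + 1) i) m
      (fun i hi j hj h => by
        have hi : i ≤ m := hi
        have hj : j ≤ m := hj
        have := congrArg Fin.val h
        simp only [Fin.val_ofNat] at this
        rwa [Nat.mod_eq_of_lt (by omega), Nat.mod_eq_of_lt (by omega)] at this)
      (fun i hi => by
        left
        simp only [Fin.val_ofNat]
        rw [Nat.mod_eq_of_lt (by omega), Nat.mod_eq_of_lt (by omega)]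
        push_cast; ring)
    refine ⟨Fin (m + 1), _, fun j => ((j : ℕ) : ℤ), fun i j h => intStep_symm _ _ h,
      Or.inl ⟨_, _, hpath.congr ?_⟩, fun i j h => h, fun k => ?_⟩
    · ext i
      simp only [Set.mem_image, Set.mem_Iic, Set.mem_univ, iff_true]
      exact ⟨i, by omega, by ext; simp⟩
    · have h1 := Int.emod_nonneg k (show ((m + 1 : ℕ) : ℤ) ≠ 0 by omega)
      have h2 := Int.emod_lt_of_pos k (show (0 : ℤ) < ((m + 1 : ℕ) : ℤ) by omega)
      refine ⟨⟨(k % ((m + 1 : ℕ) : ℤ)).toNat, by omega⟩, ?_, ?_⟩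
      · simp only [hdvd]
        rw [Int.toNat_of_nonneg h1]
        exact Int.dvd_self_sub_emod
      · intro j hj
        simp only [hdvd] at hj
        ext
        have h3 : k % ((m + 1 : ℕ) : ℤ) = ((j : ℕ) : ℤ) % ((m + 1 : ℕ) : ℤ) :=
          Int.emod_eq_emod_iff_emod_sub_eq_zero.2 (Int.emod_eq_zero_of_dvd hj)
        have h4 : ((j : ℕ) : ℤ) % ((m + 1 : ℕ) : ℤ) = j := Int.emod_eq_of_lt (by omega) (by omega)
        simp only
        omega

/-- If the finite set `T₀` generates the abelian group `A` modulo `M`, then the Cayley graph of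
`A ⧸ M` has a finite or two-way infinite Hamiltonian path. It is recorded by a family `q` of coset
representatives. -/
theorem exists_coset_line {A : Type*} [CommGroup A] (T : Set A) (hT : ∀ t ∈ T, t⁻¹ ∈ T)
    (T₀ : Finset A) : ∀ M : Subgroup A, (T₀ : Set A) ⊆ T → Subgroup.closure (T₀ : Set A) ⊔ M = ⊤ →
    ∃ (I : Type) (r : I → I → Prop) (q : I → A), (∀ i j, r i j → r j i) ∧ HamLine r ∧
      (∀ i j, r i j → (q i)⁻¹ * q j ∈ T) ∧ ∀ a, ∃! i, (q i)⁻¹ * a ∈ M := by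
  classical
  induction T₀ using Finset.induction_on with
  | empty =>
    intro M _ hM
    simp only [Finset.coe_empty, Subgroup.closure_empty, bot_sup_eq] at hM
    refine ⟨Unit, fun _ _ => False, fun _ => 1, fun _ _ h => h,
      Or.inl ⟨(), (), (HamPath.single ()).congr (by ext; simp)⟩, fun _ _ h => h.elim,
      fun a => ⟨(), by simp [hM], fun _ _ => rfl⟩⟩
  | insert s T₀ hs ih =>
    intro M hsub hM
    simp only [Finset.coe_insert, Set.insert_subset_iff] at hsub
    obtain ⟨I, r, q, hrs, hline, hstep, huniq⟩ := ih (M ⊔ Subgroup.zpowers s) hsub.2 (by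
      rw [Finset.coe_insert, Set.insert_eq, Subgroup.closure_union,
        ← Subgroup.zpowers_eq_closure] at hM
      rw [← hM]
      ac_rfl)
    obtain ⟨J, r', e, hrs', hline', hstep', huniq'⟩ := exists_exponent_line M s
    have hmem : ∀ x, x ∈ M ⊔ Subgroup.zpowers s ↔ ∃ k : ℤ, x * s ^ (-k) ∈ M := by
      intro x
      rw [Subgroup.mem_sup]
      constructor
      · rintro ⟨y, hy, z, hz, rfl⟩
        obtain ⟨k, rfl⟩ := Subgroup.mem_zpowers_iff.1 hz
        exact ⟨k, by simpa using hy⟩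
      · rintro ⟨k, hk⟩
        exact ⟨_, hk, s ^ k, Subgroup.zpow_mem_zpowers s k, by simp⟩
    refine ⟨I × J, boxRel r r', fun z => q z.1 * s ^ e z.2, boxRel_symm hrs hrs',
      hline.box hrs hrs' hline', ?_, ?_⟩
    · rintro ⟨i, j⟩ ⟨i', j'⟩ (⟨h1, h2⟩ | ⟨h1, h2⟩)
      · dsimp only at h1 h2 ⊢
        subst h2
        have : (q i * s ^ e j)⁻¹ * (q i' * s ^ e j) = (q i)⁻¹ * q i' := by
          rw [mul_inv]
          calc _ = ((q i)⁻¹ * q i') * ((s ^ e j)⁻¹ * s ^ e j) := by ac_rfl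
            _ = _ := by simp
        rw [this]
        exact hstep _ _ h1
      · dsimp only at h1 h2 ⊢
        subst h1
        have : (q i * s ^ e j)⁻¹ * (q i * s ^ e j') = s ^ (e j' - e j) := by
          rw [mul_inv, zpow_sub]
          calc _ = ((q i)⁻¹ * q i) * (s ^ e j' * (s ^ e j)⁻¹) := by ac_rfl
            _ = _ := by simp
        rw [this]
        rcases hstep' _ _ h2 with h | h
        · rw [show e j' - e j = 1 by omega, zpow_one]; exact hsub.1
        · rw [show e j' - e j = -1 by omega, zpow_neg, zpow_one]; exact hT _ hsub.1
    · intro a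
      obtain ⟨i, hi, hiu⟩ := huniq a
      obtain ⟨k, hk⟩ := (hmem _).1 hi
      obtain ⟨j, hj, hju⟩ := huniq' k
      have hre : ∀ i' j', (q i' * s ^ e j')⁻¹ * a = (q i')⁻¹ * a * s ^ (-(e j')) := by
        intro i' j'
        rw [mul_inv, zpow_neg]
        ac_rfl
      refine ⟨(i, j), ?_, ?_⟩
      · have := M.mul_mem hk hj
        simp only [hre]
        rwa [mul_assoc, ← zpow_add, show -k + (k - e j) = -e j by ring] at this
      · rintro ⟨i', j'⟩ h
        simp only [hre] at h
        obtain rfl := hiu i' ((hmem _).2 ⟨_, h⟩)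
        have := M.mul_mem (M.inv_mem hk) h
        rw [mul_inv, show ((q i')⁻¹ * a)⁻¹ * (s ^ (-k))⁻¹ * ((q i')⁻¹ * a * s ^ (-e j')) =
          (((q i')⁻¹ * a)⁻¹ * ((q i')⁻¹ * a)) * ((s ^ (-k))⁻¹ * s ^ (-e j')) by ac_rfl,
          inv_mul_cancel, one_mul, ← zpow_neg, ← zpow_add,
          show - -k + -e j' = k - e j' by ring] at this
        rw [hju j' this]

/-! ### Lifting Hamiltonian paths from the abelianization -/

/-- Adjacency in the right Cayley graph with respect to the set `T` of steps. -/
def stepRel {G : Type*} [Group G] (T : Set G) (g h : G) : Prop := g⁻¹ * h ∈ T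

theorem stepRel_symm {G : Type*} [Group G] {T : Set G} (hT : ∀ t ∈ T, t⁻¹ ∈ T) (g h : G)
    (hgh : stepRel T g h) : stepRel T h g := by
  have := hT _ hgh
  rwa [mul_inv_rev, inv_inv] at this

theorem stepRel_mul_left {G : Type*} [Group G] {T : Set G} (x g h : G) (hgh : stepRel T g h) :
    stepRel T (x * g) (x * h) := by
  unfold stepRel at *
  rwa [mul_inv_rev, mul_assoc, inv_mul_cancel_left]

theorem stepRel_mul_right {G : Type*} [Group G] {T : Set G} (g : G) {t : G} (ht : t ∈ T) :
    stepRel T g (g * t) := by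
  unfold stepRel
  rwa [inv_mul_cancel_left]

/-- The homomorphism `π` is surjective and its kernel has prime order `p`. -/
structure PrimeKernel {G A : Type*} [Group G] [CommGroup A] (π : G →* A) (p : ℕ) : Prop where
  prime : p.Prime
  surj : Function.Surjective π
  card : Nat.card π.ker = p

theorem PrimeKernel.orderOf_eq {G A : Type*} [Group G] [CommGroup A] {π : G →* A} {p : ℕ}
    (h : PrimeKernel π p) {z : G} (hz : π z = 1) (hz1 : z ≠ 1) : orderOf z = p := by
  have : Fact p.Prime := ⟨h.prime⟩
  refine orderOf_eq_prime ?_ hz1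
  have h1 : (⟨z, hz⟩ : π.ker) ^ Nat.card π.ker = 1 := pow_card_eq_one'
  rw [h.card] at h1
  exact congrArg Subtype.val h1

theorem PrimeKernel.exists_pow {G A : Type*} [Group G] [CommGroup A] {π : G →* A} {p : ℕ}
    (h : PrimeKernel π p) {z : G} (hz : π z = 1) (hz1 : z ≠ 1) {n : G} (hn : π n = 1) :
    ∃ i < p, z ^ i = n := by
  have : Fact p.Prime := ⟨h.prime⟩
  have hfin : Finite π.ker := Nat.finite_of_card_ne_zero (by rw [h.card]; exact h.prime.ne_zero)
  have h1 : (⟨n, hn⟩ : π.ker) ∈ Subgroup.zpowers (⟨z, hz⟩ : π.ker) :=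
    mem_zpowers_of_prime_card h.card (fun he => hz1 (congrArg Subtype.val he))
  rw [← mem_powers_iff_mem_zpowers, Submonoid.mem_powers_iff] at h1
  obtain ⟨k, hk⟩ := h1
  have hk : z ^ k = n := congrArg Subtype.val hk
  refine ⟨k % p, Nat.mod_lt _ h.prime.pos, ?_⟩
  rw [← hk, ← h.orderOf_eq hz hz1, pow_mod_orderOf]

section Lift

open scoped Pointwise

variable {G A : Type*} [Group G] [CommGroup A] {π : G →* A} {T : Set G} {p : ℕ}

/-- The full preimage of the set `B ⊆ A` has a Hamiltonian path in the Cayley graph of `G`, which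
starts at `1` and ends at some element lying over `y`. -/
def Liftable (π : G →* A) (T : Set G) (B : Set A) (y : A) : Prop :=
  ∃ e, π e = y ∧ HamPath (stepRel T) (π ⁻¹' B) 1 e

/-- A path may be moved by a left translation. -/
theorem HamPath.translate {B : Set G} {x y : G} (h : HamPath (stepRel T) B x y) (g : G) :
    HamPath (stepRel T) (g • B) (g * x) (g * y) :=
  h.map (fun u => g * u) (fun _ _ hab => stepRel_mul_left g _ _ hab)
    (fun _ _ _ _ hab => mul_left_cancel hab)

theorem preimage_smul (g : G) (B : Set A) : g • (π ⁻¹' B) = π ⁻¹' (π g • B) := by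
  ext x
  simp [Set.mem_smul_set_iff_inv_smul_mem]

theorem Liftable.from {B : Set A} {y : A} (h : Liftable π T B y) (g : G) :
    ∃ e, π e = π g * y ∧ HamPath (stepRel T) (π ⁻¹' (π g • B)) g e := by
  obtain ⟨e, he, hp⟩ := h
  refine ⟨g * e, by simp [he], ?_⟩
  have := hp.translate g
  rwa [mul_one, preimage_smul] at this

theorem Liftable.congr {B B' : Set A} {y y' : A} (h : Liftable π T B y) (hB : B = B')
    (hy : y = y') : Liftable π T B' y' := hB ▸ hy ▸ h

/-- Two liftable sets may be traversed one after the other. -/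
theorem Liftable.append {B B' : Set A} {y y' : A} {t : G} (ht : t ∈ T) (h : Liftable π T B y)
    (h' : Liftable π T B' y') (hd : Disjoint B ((y * π t) • B')) :
    Liftable π T (B ∪ (y * π t) • B') (y * π t * y') := by
  obtain ⟨e, he, hp⟩ := h
  obtain ⟨e', he', hp'⟩ := h'.from (e * t)
  rw [map_mul, he] at he' hp'
  exact ⟨e', he', (hp.append hp' (stepRel_mul_right e ht) (hd.preimage π))⟩

/-- A path in `A` in lifted form: `X ⊆ A` is traversed by a path of `G` from `x` to `v` that meets
each fibre of `π` at most once. -/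
def SectionPath (π : G →* A) (T : Set G) (X : Set A) (x v : G) : Prop :=
  ∃ B, HamPath (stepRel T) B x v ∧ Set.InjOn π B ∧ π '' B = X

namespace SectionPath

theorem single (x : G) : SectionPath π T {π x} x x :=
  ⟨{x}, HamPath.single x, Set.injOn_singleton _ _, Set.image_singleton⟩

theorem congr {X X' : Set A} {x v x' v' : G} (h : SectionPath π T X x v) (hX : X = X')
    (hx : x = x') (hv : v = v') : SectionPath π T X' x' v' := hX ▸ hx ▸ hv ▸ h

theorem append {X X' : Set A} {x v x' v' : G} (h : SectionPath π T X x v)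
    (h' : SectionPath π T X' x' v') (hr : stepRel T v x') (hd : Disjoint X X') :
    SectionPath π T (X ∪ X') x v' := by
  obtain ⟨B, hB, hi, rfl⟩ := h
  obtain ⟨B', hB', hi', rfl⟩ := h'
  have hd' : Disjoint B B' :=
    Set.disjoint_of_subset (Set.subset_preimage_image π _) (Set.subset_preimage_image π _)
      (hd.preimage π)
  refine ⟨B ∪ B', hB.append hB' hr hd', (Set.injOn_union hd').2 ⟨hi, hi', ?_⟩,
    Set.image_union _ _ _⟩
  intro a ha b hb he
  exact Set.disjoint_left.1 hd ⟨a, ha, rfl⟩ ⟨b, hb, he.symm⟩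

theorem reverse (hT : ∀ t ∈ T, t⁻¹ ∈ T) {X : Set A} {x v : G} (h : SectionPath π T X x v) :
    SectionPath π T X v x := by
  obtain ⟨B, hB, hi, hX⟩ := h
  exact ⟨B, hB.reverse (stepRel_symm hT), hi, hX⟩

theorem translate {X : Set A} {x v : G} (h : SectionPath π T X x v) (g : G) :
    SectionPath π T (π g • X) (g * x) (g * v) := by
  obtain ⟨B, hB, hi, rfl⟩ := h
  refine ⟨g • B, hB.translate g, ?_, Set.image_smul_distrib _ _ _⟩
  rintro _ ⟨b, hb, rfl⟩ _ ⟨b', hb', rfl⟩ he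
  simp only [smul_eq_mul, map_mul] at he
  rw [hi hb hb' (mul_left_cancel he)]

/-- The path `x, x t, x t², …, x tⁿ`. -/
theorem powers {t : G} (ht : t ∈ T) (n : ℕ) (hinj : ∀ i ≤ n, π t ^ i = 1 → i = 0) (x : G) :
    SectionPath π T {a | ∃ i ≤ n, a = π x * π t ^ i} x (x * t ^ n) := by
  have hinj' : Set.InjOn (fun i : ℕ => π x * π t ^ i) (Set.Iic n) := by
    have aux : ∀ i j : ℕ, i ≤ j → j ≤ n → π t ^ i = π t ^ j → i = j := by
      intro i j hij hj h
      obtain ⟨k, rfl⟩ := Nat.exists_eq_add_of_le hij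
      rw [pow_add, left_eq_mul] at h
      have := hinj k (by omega) h
      omega
    intro i hi j hj h
    have h : π t ^ i = π t ^ j := mul_left_cancel h
    rcases le_total i j with hij | hij
    · exact aux i j hij hj h
    · exact (aux j i hij hi h.symm).symm
  refine ⟨(fun i : ℕ => x * t ^ i) '' Set.Iic n, ?_, ?_, ?_⟩
  · have := HamPath.of_seq (r := stepRel T) (fun i : ℕ => x * t ^ i) n ?_ ?_
    · simpa using this
    · intro i hi j hj h
      refine hinj' hi hj ?_
      have := congrArg π h
      simpa using this
    · intro i _
      rw [pow_succ, ← mul_assoc]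
      exact stepRel_mul_right _ ht
  · rintro _ ⟨i, hi, rfl⟩ _ ⟨j, hj, rfl⟩ h
    dsimp only at h ⊢
    rw [hinj' hi hj (by simpa using h)]
  · ext a
    simp only [Set.mem_image, Set.mem_Iic, Set.mem_ofPred_eq]
    constructor
    · rintro ⟨_, ⟨i, hi, rfl⟩, rfl⟩
      exact ⟨i, hi, by simp⟩
    · rintro ⟨i, hi, rfl⟩
      exact ⟨_, ⟨i, hi, rfl⟩, by simp⟩

end SectionPath

/-- A cycle in the abelianization whose lift does not close up lifts to a Hamiltonian path of the
preimage: going round the cycle `p` times visits every element of each fibre exactly once. The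
cycle is given by a lifted path from `1` to `v` together with a closing step from `v` to a
non-trivial element `z` of the kernel. -/
theorem SectionPath.liftable (hπ : PrimeKernel π p) {X : Set A} {v z : G}
    (h : SectionPath π T X 1 v) (hv : stepRel T v z) (hz : π z = 1)
    (hz1 : z ≠ 1) : Liftable π T X (π v) := by
  obtain ⟨B, h, hinj, rfl⟩ := h
  have hord := hπ.orderOf_eq hz hz1
  have hzp : ∀ i, π (z ^ i) = 1 := fun i => by rw [map_pow, hz, one_pow]
  have key : ∀ k < p, HamPath (stepRel T) {g | ∃ i ≤ k, ∃ b ∈ B, g = z ^ i * b} 1 (z ^ k * v) := by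
    intro k
    induction k with
    | zero =>
      intro _
      rw [pow_zero, one_mul]
      refine h.congr ?_
      ext g; simp
    | succ k ih =>
      intro hk
      have h1 := h.translate (z ^ (k + 1))
      refine ((ih (by omega)).append h1 ?_ ?_).congr ?_
      · rw [mul_one, pow_succ]
        exact stepRel_mul_left _ _ _ hv
      · rw [Set.disjoint_left]
        rintro g ⟨i, hi, b, hb, rfl⟩ hg
        rw [Set.mem_smul_set] at hg
        obtain ⟨b', hb', he⟩ := hg
        have he : z ^ (k + 1) * b' = z ^ i * b := he
        have h2 : π b' = π b := by
          have := congrArg π he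
          rwa [map_mul, map_mul, hzp, hzp, one_mul, one_mul] at this
        rw [hinj hb' hb h2] at he
        have h3 := pow_injOn_Iio_orderOf (x := z) (by rw [hord]; exact hk)
          (by rw [hord]; exact Set.mem_Iio.2 (by omega)) (mul_right_cancel he)
        omega
      · ext g
        rw [Set.mem_union, Set.mem_smul_set]
        constructor
        · rintro (⟨i, hi, b, hb, rfl⟩ | ⟨b, hb, rfl⟩)
          · exact ⟨i, by omega, b, hb, rfl⟩
          · exact ⟨k + 1, le_rfl, b, hb, rfl⟩
        · rintro ⟨i, hi, b, hb, rfl⟩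
          rcases Nat.lt_or_ge k i with h2 | h2
          · right; rw [show i = k + 1 by omega]; exact ⟨b, hb, rfl⟩
          · exact Or.inl ⟨i, h2, b, hb, rfl⟩
  have hp := hπ.prime.pos
  refine ⟨_, ?_, (key (p - 1) (by omega)).congr ?_⟩
  · rw [map_mul, hzp, one_mul]
  · ext g
    constructor
    · rintro ⟨i, hi, b, hb, rfl⟩
      exact ⟨b, hb, by rw [map_mul, hzp, one_mul]⟩
    · rintro ⟨b, hb, he⟩
      obtain ⟨i, hi, he'⟩ := hπ.exists_pow hz hz1 (n := g * b⁻¹) (by simp [he])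
      exact ⟨i, by omega, b, hb, by rw [he', inv_mul_cancel_right]⟩

/-- The cycle of `SectionPath.liftable` traversed backwards. -/
theorem SectionPath.liftable_reverse (hπ : PrimeKernel π p) (hT : ∀ t ∈ T, t⁻¹ ∈ T) {X : Set A}
    {x v z : G} (h : SectionPath π T X x v) (h1 : 1 ∉ X)
    (hx : x ∈ T) (hv : stepRel T v z) (hz : π z = 1) (hz1 : z ≠ 1) :
    Liftable π T ({1} ∪ X) (π x) := by
  have hzi : π z⁻¹ = 1 := by rw [map_inv, hz, inv_one]
  have h2 : SectionPath π T ({1} ∪ X) 1 (z⁻¹ * x) := by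
    refine ((SectionPath.single (π := π) (T := T) 1).append
      ((h.translate z⁻¹).reverse hT) ?_ ?_).congr ?_ rfl rfl
    · have := stepRel_mul_left z⁻¹ _ _ (stepRel_symm hT _ _ hv)
      rwa [inv_mul_cancel] at this
    · rwa [hzi, map_one, one_smul, Set.disjoint_singleton_left]
    · rw [hzi, map_one, one_smul]
  refine (h2.liftable hπ (z := z⁻¹) ?_ hzi (by simpa using hz1)).congr rfl
    (by rw [map_mul, hzi, one_mul])
  have := stepRel_mul_left z⁻¹ _ _ (stepRel_symm hT _ _ (stepRel_mul_right 1 hx))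
  rwa [one_mul, mul_one] at this

theorem map_commutator_eq_one (a b : G) : π (a * b * a⁻¹ * b⁻¹) = 1 := by
  simp only [map_mul, map_inv]
  rw [mul_comm (π a) (π b), mul_inv_cancel_right, mul_inv_cancel]

theorem commutator_ne_one {a b : G} (h : a * b ≠ b * a) : a * b * a⁻¹ * b⁻¹ ≠ 1 := by
  intro h1
  apply h
  rw [mul_inv_eq_one, mul_inv_eq_iff_eq_mul] at h1
  exact h1

theorem map_conj_eq (w c : G) : π (w * c * w⁻¹) = π c := by
  simp only [map_mul, map_inv]
  rw [mul_comm (π w), mul_inv_cancel_right]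

theorem pair_mul (c : A) (B : Set A) : ({1, c} : Set A) * B = B ∪ c • B := by
  rw [Set.insert_eq, Set.union_mul, Set.singleton_mul, Set.singleton_mul]
  simp [← Set.image_smul]

/-- Running along a path, making a step `c` and running back along a parallel path. -/
theorem SectionPath.prism (hT : ∀ t ∈ T, t⁻¹ ∈ T) {X : Set A} {x w c : G} (hc : c ∈ T)
    (h : SectionPath π T X x w) (hd : Disjoint X (π c • X)) :
    SectionPath π T (X ∪ π c • X) x (w * c * w⁻¹ * x) := by
  have h2 := (h.translate (w * c * w⁻¹)).reverse hT
  rw [map_conj_eq, inv_mul_cancel_right] at h2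
  exact h.append h2 (stepRel_mul_right w hc) hd

/-- The prism `{1, c} × X` over a path from `1` to `w` has a cycle around it; if `c` and `w` do not
commute then this cycle does not close up in `G`. Here the path leaves the prism along the
edge `c`. -/
theorem SectionPath.liftable_prism (hπ : PrimeKernel π p) (hT : ∀ t ∈ T, t⁻¹ ∈ T) {X : Set A}
    {w c : G} (hc : c ∈ T) (h : SectionPath π T X 1 w) (hd : Disjoint X (π c • X))
    (hw : w * c ≠ c * w) : Liftable π T ({1, π c} * X) (π c) := by
  have h1 := h.prism hT hc hd
  rw [mul_one] at h1
  refine (h1.liftable hπ (z := w * c * w⁻¹ * c⁻¹) (stepRel_mul_right _ (hT c hc))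
    (map_commutator_eq_one w c) (commutator_ne_one hw)).congr (pair_mul _ _).symm (map_conj_eq w c)

/-- As `SectionPath.liftable_prism`, but the path leaves the prism along the first edge `x` of the
base path. -/
theorem SectionPath.liftable_prism_side (hπ : PrimeKernel π p) (hT : ∀ t ∈ T, t⁻¹ ∈ T)
    {X : Set A} {x w c : G} (hc : c ∈ T) (hx : x ∈ T) (h : SectionPath π T X x w) (h1 : 1 ∉ X)
    (hd : Disjoint ({1} ∪ X) (π c • ({1} ∪ X)))
    (hw : w * c ≠ c * w) : Liftable π T ({1, π c} * ({1} ∪ X)) (π x) := by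
  have h0 : SectionPath π T ({1} ∪ X) 1 w := by
    refine ((SectionPath.single (π := π) (T := T) 1).append h ?_ ?_).congr (by rw [map_one]) rfl rfl
    · have := stepRel_mul_right 1 hx
      rwa [one_mul] at this
    · rwa [map_one, Set.disjoint_singleton_left]
  have h2 := (h0.translate (w * c * w⁻¹)).reverse hT
  rw [map_conj_eq, inv_mul_cancel_right, mul_one] at h2
  have h3 := h.append h2 (stepRel_mul_right w hc) (hd.mono_left Set.subset_union_right)
  refine (h3.liftable_reverse hπ hT ?_ hx (stepRel_mul_right _ (hT c hc))
    (map_commutator_eq_one w c) (commutator_ne_one hw)).congr ?_ rfl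
  · rintro (h4 | h4)
    · exact h1 h4
    · exact Set.disjoint_left.1 hd (Or.inl rfl) h4
  · rw [pair_mul, Set.union_assoc]

/-- A path over `Y` from `1` to a neighbour of `y t`, where `y` is a non-trivial element of the
kernel, is continued around the prism `{1, c} × ({1} ∪ X₀)` over the path `1, t, …` and ends
at `y c`. -/
theorem liftable_of_detour (hπ : PrimeKernel π p) (hT : ∀ t ∈ T, t⁻¹ ∈ T) {Y X₀ : Set A}
    {t c v w₀ y : G} (ht : t ∈ T) (hc : c ∈ T) (hπy : π y = 1) (hy1 : y ≠ 1)
    (hY : SectionPath π T Y 1 v) (hv : stepRel T v (y * t)) (h₀ : SectionPath π T X₀ t w₀)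
    (hc₀ : Commute c w₀) (hd : Disjoint X₀ (π c • X₀))
    (hdY : Disjoint Y (X₀ ∪ π c • X₀)) (hdc : Disjoint (Y ∪ (X₀ ∪ π c • X₀)) {π c}) :
    Liftable π T (Y ∪ (X₀ ∪ π c • X₀) ∪ {π c}) (π c) := by
  have P₀ := ((h₀.prism hT hc hd).congr (v' := c * t) rfl rfl
    (by rw [← hc₀.eq, mul_inv_cancel_right])).translate y
  rw [hπy, one_smul] at P₀
  have hyc : π (y * c) = π c := by rw [map_mul, hπy, one_mul]
  have P := (hY.append P₀ hv hdY).append (SectionPath.single (π := π) (T := T) (y * c)) (by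
    have := stepRel_mul_right (y * c * t) (hT t ht)
    rwa [mul_inv_cancel_right, mul_assoc] at this) (by rwa [hyc])
  refine (P.liftable hπ (z := y) ?_ hπy hy1).congr (by rw [hyc]) hyc
  have := stepRel_mul_right (y * c) (hT c hc)
  rwa [mul_inv_cancel_right] at this

/-- A path over `{1, c} × ({1} ∪ X₀)` obtained from two steps `t ≠ u` lying over the same element
of `A`. -/
theorem liftable_doubleEdge (hπ : PrimeKernel π p) (hT : ∀ t ∈ T, t⁻¹ ∈ T) {X₀ : Set A}
    {t u c w₀ : G} (ht : t ∈ T) (hu : u ∈ T) (hc : c ∈ T) (htu : π u = π t) (hne : u ≠ t)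
    (h₀ : SectionPath π T X₀ t w₀) (hc₀ : Commute c w₀) (hd₀ : 1 ∉ X₀)
    (hd : Disjoint ({1} ∪ X₀) (π c • ({1} ∪ X₀))) :
    Liftable π T ({1, π c} * ({1} ∪ X₀)) (π c) := by
  simp only [Set.smul_set_union, Set.disjoint_union_left, Set.disjoint_union_right,
    Set.smul_set_singleton, smul_eq_mul, mul_one] at hd
  obtain ⟨⟨d00, d10⟩, d01, d11⟩ := hd
  refine (liftable_of_detour hπ hT (y := u * t⁻¹) ht hc (by simp [htu])
    (fun h => hne (mul_inv_eq_one.1 h)) (SectionPath.single (π := π) (T := T) 1) ?_ h₀ hc₀ d11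
    ?_ ?_).congr ?_ rfl
  · have := stepRel_mul_right 1 hu
    rw [inv_mul_cancel_right]
    rwa [one_mul] at this
  · rw [map_one, Set.disjoint_union_right]
    exact ⟨Set.disjoint_singleton_left.2 hd₀, d01⟩
  · have e : ({π c} : Set A) = π c • {1} := by simp
    rw [map_one, Set.disjoint_union_left, Set.disjoint_union_left]
    refine ⟨d00, d10, ?_⟩
    rw [e, Set.disjoint_smul_set]
    exact (Set.disjoint_singleton_left.2 hd₀).symm
  · rw [pair_mul]
    simp only [map_one, Set.smul_set_union, Set.smul_set_singleton, smul_eq_mul, mul_one]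
    ext a
    simp only [Set.mem_union]
    tauto

/-- A path `{1, c} × (X₀ ∪ X₁ ∪ X₂)` that does not close up although `c` commutes with everything.
Two prisms, over the path `1, t, …` on `{1} ∪ X₀` and over the path on `X₁ ∪ X₂` having `b, b t`
as one of its edges, are joined along the square `1, b, b t, t`. -/
theorem liftable_merge (hπ : PrimeKernel π p) (hT : ∀ t ∈ T, t⁻¹ ∈ T) {X₀ X₁ X₂ : Set A}
    {t b c w₀ w₁ w₂ : G} (ht : t ∈ T) (hb : b ∈ T) (hc : c ∈ T) (hbt : b * t ≠ t * b)
    (h₀ : SectionPath π T X₀ t w₀) (h₁ : SectionPath π T X₁ b w₁)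
    (h₂ : SectionPath π T X₂ (b * t) w₂)
    (hc₀ : Commute c w₀) (hc₁ : Commute c w₁)
    (hc₂ : Commute c w₂)
    (hd₀ : 1 ∉ X₀) (hd₁ : 1 ∉ X₁) (hd₂ : 1 ∉ X₂) (hd₀₁ : Disjoint X₀ X₁) (hd₀₂ : Disjoint X₀ X₂)
    (hd₁₂ : Disjoint X₁ X₂)
    (hd : Disjoint ({1} ∪ X₀ ∪ X₁ ∪ X₂) (π c • ({1} ∪ X₀ ∪ X₁ ∪ X₂))) :
    Liftable π T ({1, π c} * ({1} ∪ X₀ ∪ X₁ ∪ X₂)) (π c) := by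
  set y := b * t * b⁻¹ * t⁻¹ with hy
  have hy1 : y ≠ 1 := commutator_ne_one hbt
  have hπy : π y = 1 := map_commutator_eq_one b t
  have hconj : ∀ w, Commute c w → w * c * w⁻¹ = c := fun w hw => by
    rw [← hw.eq, mul_inv_cancel_right]
  have step : ∀ g : G, ∀ s ∈ T, ∀ g', g * s = g' → stepRel T g g' := by
    rintro g s hs g' rfl
    exact stepRel_mul_right g hs
  have s0 : {1} ⊆ ({1} ∪ X₀ ∪ X₁ ∪ X₂ : Set A) := fun a h => Or.inl (Or.inl (Or.inl h))
  have s1 : X₀ ⊆ ({1} ∪ X₀ ∪ X₁ ∪ X₂ : Set A) := fun a h => Or.inl (Or.inl (Or.inr h))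
  have s2 : X₁ ⊆ ({1} ∪ X₀ ∪ X₁ ∪ X₂ : Set A) := fun a h => Or.inl (Or.inr h)
  have s3 : X₂ ⊆ ({1} ∪ X₀ ∪ X₁ ∪ X₂ : Set A) := fun a h => Or.inr h
  have dd : ∀ U V, U ⊆ ({1} ∪ X₀ ∪ X₁ ∪ X₂ : Set A) → V ⊆ ({1} ∪ X₀ ∪ X₁ ∪ X₂ : Set A) →
      Disjoint U (π c • V) := fun U V hU hV => hd.mono hU (Set.smul_set_mono hV)
  have d22 := dd _ _ s2 s2
  have d33 := dd _ _ s3 s3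
  have d11 := dd _ _ s1 s1
  have e1 : Disjoint {1} X₁ := Set.disjoint_singleton_left.2 hd₁
  have e2 : Disjoint {1} X₂ := Set.disjoint_singleton_left.2 hd₂
  have e0 : Disjoint {1} X₀ := Set.disjoint_singleton_left.2 hd₀
  have ec : ({π c} : Set A) = π c • {1} := by simp
  have P₁ := (h₁.prism hT hc d22).congr (v' := c * b) rfl rfl (by rw [hconj _ hc₁])
  have P₂ := ((h₂.prism hT hc d33).congr (v' := c * (b * t)) rfl rfl
    (by rw [hconj _ hc₂])).reverse hT
  have P := ((SectionPath.single (π := π) (T := T) 1).append P₁ (step _ b hb _ (one_mul b))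
    ?_).append P₂ (step _ t ht _ (mul_assoc _ _ _)) ?_
  · refine (liftable_of_detour hπ hT ht hc hπy hy1 P
      (step _ b⁻¹ (hT b hb) _ (by rw [hy, inv_mul_cancel_right])) h₀ hc₀ d11 ?_ ?_).congr ?_ rfl
    · simp only [map_one, Set.disjoint_union_left, Set.disjoint_union_right, Set.disjoint_smul_set]
      exact ⟨⟨⟨e0, hd₀₁.symm, (dd _ _ s1 s2).symm⟩, hd₀₂.symm, (dd _ _ s1 s3).symm⟩,
        ⟨dd _ _ s0 s1, dd _ _ s2 s1, hd₀₁.symm⟩, dd _ _ s3 s1, hd₀₂.symm⟩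
    · rw [ec]
      simp only [map_one, Set.disjoint_union_left, Set.disjoint_smul_set]
      exact ⟨⟨⟨dd _ _ s0 s0, dd _ _ s2 s0, e1.symm⟩, dd _ _ s3 s0, e2.symm⟩, dd _ _ s1 s0, e0.symm⟩
    · rw [pair_mul]
      simp only [map_one, Set.smul_set_union, Set.smul_set_singleton, smul_eq_mul, mul_one]
      ext a
      simp only [Set.mem_union]
      tauto
  · simp only [map_one, Set.disjoint_union_right]
    exact ⟨e1, dd _ _ s0 s2⟩
  · simp only [map_one, Set.disjoint_union_left, Set.disjoint_union_right, Set.disjoint_smul_set]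
    exact ⟨⟨e2, hd₁₂, (dd _ _ s3 s2).symm⟩, dd _ _ s0 s3, dd _ _ s2 s3, hd₁₂⟩

end Lift

/-! ### Tilings by blocks over a `2 × 2` square -/

section Blocks

open scoped Pointwise

variable {G A : Type*} [Group G] [CommGroup A] {π : G →* A} {T : Set G}

/-- The elements `c ^ i * d ^ j * f` with `i, j ∈ ℤ` and `f ∈ F` are pairwise distinct and form the
subgroup `M`. In other words, `c` and `d` generate a free abelian group of rank two, and `F` is a
transversal of it in `M`. -/
structure IsGridTransversal (c d : A) (F : Set A) (M : Subgroup A) : Prop where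
  mem_iff : ∀ x, x ∈ M ↔ ∃ i j : ℤ, ∃ f ∈ F, x = c ^ i * d ^ j * f
  inj : ∀ i j i' j' : ℤ, ∀ f ∈ F, ∀ f' ∈ F,
    c ^ i * d ^ j * f = c ^ i' * d ^ j' * f' → i = i' ∧ j = j' ∧ f = f'

/-- The block `{1, c ^ ε} × {1, d ^ δ} × F` can be traversed from the corner `1` to either of the
two neighbouring corners `c ^ ε` and `d ^ δ`, whatever the signs `ε` and `δ` are. -/
def FlexibleBlock (π : G →* A) (T : Set G) (c d : A) (F : Set A) : Prop :=
  ∀ ε δ : ℤ, (ε = 1 ∨ ε = -1) → (δ = 1 ∨ δ = -1) →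
    Liftable π T ({1, c ^ ε} * ({1, d ^ δ} * F)) (c ^ ε) ∧
    Liftable π T ({1, c ^ ε} * ({1, d ^ δ} * F)) (d ^ δ)

/-- A ray of blocks lifts to a ray: if every admissible start in the `n`-th block can be continued
through this block to an admissible start in the next one, the finite paths add up to a ray. -/
theorem HamRay.of_blocks {V : Type*} {r : V → V → Prop} (B : ℕ → Set V) (E : ℕ → V → Prop)
    (hd : ∀ m n, m < n → Disjoint (B m) (B n))
    (h : ∀ n g, E n g → ∃ e g', HamPath r (B n) g e ∧ r e g' ∧ E (n + 1) g') (g₀ : V)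
    (hg₀ : E 0 g₀) : HamRay r (⋃ n, B n) g₀ := by
  choose! e g' hp hr hE using h
  let g : ℕ → V := fun n => Nat.rec g₀ (fun k x => g' k x) n
  have hg : ∀ n, E n (g n) := by
    intro n
    induction n with
    | zero => exact hg₀
    | succ n ih => exact hE n _ ih
  exact HamRay.of_paths B g (fun n => e n (g n)) (fun n => hp n _ (hg n))
    (fun n => hr n _ (hg n)) hd

/-- If a group contains a flexible block then its Cayley graph has a Hamiltonian double ray. In
the coordinates `q i * c ^ X * d ^ Y * f`, the translates of the block are the sets on which `i`,
`⌊X / 2⌋` and `⌊Y / 2⌋` are constant. They are arranged along a double ray of `ℤ × ℤ × I`. A path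
enters each of them at one of the four corners `f = 1`, and leaves it at an adjacent corner, which
is chosen so that a step in the prescribed direction leads to a corner of the next block. -/
theorem hamDoubleRay_of_flexibleBlock (hπ : Function.Surjective π) (hT : ∀ t ∈ T, t⁻¹ ∈ T)
    (hgen : ∃ T₀ : Finset A, (T₀ : Set A) ⊆ π '' T ∧ Subgroup.closure (T₀ : Set A) = ⊤)
    {c d : G} (hc : c ∈ T) (hd : d ∈ T) {F : Set A} {M : Subgroup A}
    (hF : IsGridTransversal (π c) (π d) F M) (hflex : FlexibleBlock π T (π c) (π d) F) :
    HamDoubleRay (stepRel T) := by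
  obtain ⟨T₀, hT₀, hclos⟩ := hgen
  have hTA : ∀ t ∈ π '' T, t⁻¹ ∈ π '' T := by
    rintro _ ⟨t, ht, rfl⟩
    exact ⟨t⁻¹, hT t ht, map_inv π t⟩
  obtain ⟨I, r, q, hrs, hline, hstep, huniq⟩ := exists_coset_line (π '' T) hTA T₀ M hT₀
    (by rw [hclos, top_sup_eq])
  -- the blocks are arranged along a double ray of the grid `ℤ × ℤ × I`
  have hint : HamDoubleRay intStep := ⟨id, Function.bijective_id, fun n => Or.inl rfl⟩
  obtain ⟨ψ, hψ, hadj⟩ := hint.box intStep_symm (boxRel_symm intStep_symm hrs)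
    (Or.inr (hint.box intStep_symm hrs hline))
  have hsymm := boxRel_symm intStep_symm (boxRel_symm intStep_symm hrs)
  let BA : ℤ × ℤ × I → Set A := fun β =>
    {a | ∃ X Y : ℤ, ∃ f ∈ F, X / 2 = β.1 ∧ Y / 2 = β.2.1 ∧
      a = q β.2.2 * (π c ^ X * π d ^ Y * f)}
  let B : ℤ × ℤ × I → Set G := fun β => π ⁻¹' BA β
  let E : ℤ × ℤ × I → G → Prop := fun β g =>
    ∃ X Y : ℤ, X / 2 = β.1 ∧ Y / 2 = β.2.1 ∧ π g = q β.2.2 * (π c ^ X * π d ^ Y)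
  have hcover : ∀ g, ∃ β, g ∈ B β := by
    intro g
    obtain ⟨i, hi, -⟩ := huniq (π g)
    obtain ⟨X, Y, f, hf, he⟩ := (hF.mem_iff _).1 hi
    exact ⟨(X / 2, Y / 2, i), X, Y, f, hf, rfl, rfl, by rw [← he, mul_inv_cancel_left]⟩
  have hdisj : ∀ β β', β ≠ β' → Disjoint (B β) (B β') := by
    rintro ⟨u, v, i⟩ ⟨u', v', i'⟩ hne
    rw [Set.disjoint_left]
    rintro g ⟨X, Y, f, hf, hX, hY, h⟩ ⟨X', Y', f', hf', hX', hY', h'⟩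
    dsimp only at *
    obtain ⟨j, -, hj⟩ := huniq (π g)
    have e1 : i = j := hj i (by
      simp only; rw [h, inv_mul_cancel_left]; exact (hF.mem_iff _).2 ⟨X, Y, f, hf, rfl⟩)
    have e2 : i' = j := hj i' (by
      simp only; rw [h', inv_mul_cancel_left]; exact (hF.mem_iff _).2 ⟨X', Y', f', hf', rfl⟩)
    subst e1 e2
    rw [h] at h'
    obtain ⟨h1, h2, -⟩ := hF.inj _ _ _ _ f hf f' hf' (mul_left_cancel h')
    exact hne (by rw [← hX, ← hX', ← hY, ← hY', h1, h2])
  -- the two ways to traverse a block from an admissible start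
  have hexit : ∀ β g, ∀ X Y : ℤ, X / 2 = β.1 → Y / 2 = β.2.1 →
      π g = q β.2.2 * (π c ^ X * π d ^ Y) → ∀ ε δ : ℤ, (ε = 1 ∨ ε = -1) → (δ = 1 ∨ δ = -1) →
      (X + ε) / 2 = β.1 → (Y + δ) / 2 = β.2.1 →
      (∃ e, HamPath (stepRel T) (B β) g e ∧ π e = q β.2.2 * (π c ^ (X + ε) * π d ^ Y)) ∧
      (∃ e, HamPath (stepRel T) (B β) g e ∧ π e = q β.2.2 * (π c ^ X * π d ^ (Y + δ))) := by
    intro β g X Y hX hY hg ε δ hε hδ hXε hYδ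
    obtain ⟨h1, h2⟩ := hflex ε δ hε hδ
    have hset : π g • (({1, π c ^ ε} : Set A) * (({1, π d ^ δ} : Set A) * F)) = BA β := by
      ext a
      simp only [Set.mem_smul_set, Set.mem_mul, Set.mem_insert_iff, Set.mem_singleton_iff,
        smul_eq_mul, hg]
      constructor
      · rintro ⟨_, ⟨x, hx, _, ⟨y, hy, f, hf, rfl⟩, rfl⟩, rfl⟩
        have hx' : ∃ X' : ℤ, X' / 2 = β.1 ∧ π c ^ X * x = π c ^ X' := by
          rcases hx with rfl | rfl
          · exact ⟨X, hX, mul_one _⟩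
          · exact ⟨X + ε, hXε, (zpow_add _ _ _).symm⟩
        have hy' : ∃ Y' : ℤ, Y' / 2 = β.2.1 ∧ π d ^ Y * y = π d ^ Y' := by
          rcases hy with rfl | rfl
          · exact ⟨Y, hY, mul_one _⟩
          · exact ⟨Y + δ, hYδ, (zpow_add _ _ _).symm⟩
        obtain ⟨X', hX', ex⟩ := hx'
        obtain ⟨Y', hY', ey⟩ := hy'
        refine ⟨X', Y', f, hf, hX', hY', ?_⟩
        rw [← ex, ← ey]
        ac_rfl
      · rintro ⟨X', Y', f, hf, hX', hY', rfl⟩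
        refine ⟨π c ^ (X' - X) * (π d ^ (Y' - Y) * f), ⟨_, ?_, _, ⟨_, ?_, f, hf, rfl⟩, rfl⟩, ?_⟩
        · rcases (by omega : X' = X ∨ X' = X + ε) with rfl | rfl
          · simp
          · simp
        · rcases (by omega : Y' = Y ∨ Y' = Y + δ) with rfl | rfl
          · simp
          · simp
        · rw [zpow_sub, zpow_sub]
          calc _ = q β.2.2 * (π c ^ X' * π d ^ Y' * f) * (π c ^ X * (π c ^ X)⁻¹) *
                (π d ^ Y * (π d ^ Y)⁻¹) := by ac_rfl
            _ = _ := by simp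
    obtain ⟨e, he, hp⟩ := h1.from g
    obtain ⟨e', he', hp'⟩ := h2.from g
    rw [hset] at hp hp'
    refine ⟨⟨e, hp, ?_⟩, ⟨e', hp', ?_⟩⟩
    · rw [he, hg, zpow_add]; ac_rfl
    · rw [he', hg, zpow_add]; ac_rfl
  -- every admissible start can be continued to an admissible start of any neighbouring block; the
  -- last vertex `e` in the block is itself an admissible start
  have hnext : ∀ β β', boxRel intStep (boxRel intStep r) β β' → ∀ g, E β g →
      ∃ e g', HamPath (stepRel T) (B β) g e ∧ E β e ∧ stepRel T e g' ∧ E β' g' := by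
    rintro ⟨u, v, i⟩ ⟨u', v', i'⟩ hββ' g ⟨X, Y, hX, hY, hg⟩
    have hex := hexit ⟨u, v, i⟩ g X Y hX hY hg
    dsimp only at hX hY hg hex
    have hmoveX : ∀ e, ∀ X' Y' s : ℤ, (s = 1 ∨ s = -1) →
        π e = q i * (π c ^ X' * π d ^ Y') →
        ∃ g', stepRel T e g' ∧ π g' = q i * (π c ^ (X' + s) * π d ^ Y') := by
      intro e X' Y' s hs he
      refine ⟨e * c ^ s, stepRel_mul_right e ?_, ?_⟩
      · rcases hs with rfl | rfl
        · rwa [zpow_one]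
        · rw [zpow_neg, zpow_one]; exact hT c hc
      · have hcs : π (c ^ s) = π c ^ s := map_zpow π c s
        rw [map_mul, he, hcs, zpow_add]; ac_rfl
    have hmoveY : ∀ e, ∀ X' Y' s : ℤ, (s = 1 ∨ s = -1) →
        π e = q i * (π c ^ X' * π d ^ Y') →
        ∃ g', stepRel T e g' ∧ π g' = q i * (π c ^ X' * π d ^ (Y' + s)) := by
      intro e X' Y' s hs he
      refine ⟨e * d ^ s, stepRel_mul_right e ?_, ?_⟩
      · rcases hs with rfl | rfl
        · rwa [zpow_one]
        · rw [zpow_neg, zpow_one]; exact hT d hd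
      · have hds : π (d ^ s) = π d ^ s := map_zpow π d s
        rw [map_mul, he, hds, zpow_add]; ac_rfl
    obtain ⟨ε, hε, hXε⟩ : ∃ ε : ℤ, (ε = 1 ∨ ε = -1) ∧ (X + ε) / 2 = u := by
      rcases Int.emod_two_eq_zero_or_one X with h | h
      · exact ⟨1, Or.inl rfl, by omega⟩
      · exact ⟨-1, Or.inr rfl, by omega⟩
    obtain ⟨δ, hδ, hYδ⟩ : ∃ δ : ℤ, (δ = 1 ∨ δ = -1) ∧ (Y + δ) / 2 = v := by
      rcases Int.emod_two_eq_zero_or_one Y with h | h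
      · exact ⟨1, Or.inl rfl, by omega⟩
      · exact ⟨-1, Or.inr rfl, by omega⟩
    obtain ⟨⟨e, hp, he⟩, ⟨e', hp', he'⟩⟩ := hex ε δ hε hδ hXε hYδ
    rcases hββ' with ⟨h1, h2⟩ | ⟨h1, ⟨h2, h3⟩ | ⟨h2, h3⟩⟩
    · simp only [Prod.mk.injEq] at h1 h2
      obtain ⟨rfl, rfl⟩ := h2
      obtain ⟨s, hs, rfl⟩ : ∃ s : ℤ, (s = 1 ∨ s = -1) ∧ u' = u + s := by
        rcases h1 with h1 | h1
        · exact ⟨1, Or.inl rfl, h1⟩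
        · exact ⟨-1, Or.inr rfl, by omega⟩
      by_cases hεs : ε = s
      · obtain ⟨g', hg', hπg'⟩ := hmoveX e _ _ s hs he
        exact ⟨e, g', hp, ⟨_, _, hXε, hY, he⟩, hg', _, _, by dsimp only; omega, hY, hπg'⟩
      · obtain ⟨g', hg', hπg'⟩ := hmoveX e' _ _ s hs he'
        exact ⟨e', g', hp', ⟨_, _, hX, hYδ, he'⟩, hg', _, _, by dsimp only; omega, hYδ, hπg'⟩
    · simp only at h1 h2 h3
      subst h1 h3
      obtain ⟨s, hs, rfl⟩ : ∃ s : ℤ, (s = 1 ∨ s = -1) ∧ v' = v + s := by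
        rcases h2 with h1 | h1
        · exact ⟨1, Or.inl rfl, h1⟩
        · exact ⟨-1, Or.inr rfl, by omega⟩
      by_cases hδs : δ = s
      · obtain ⟨g', hg', hπg'⟩ := hmoveY e' _ _ s hs he'
        exact ⟨e', g', hp', ⟨_, _, hX, hYδ, he'⟩, hg', _, _, hX, by dsimp only; omega, hπg'⟩
      · obtain ⟨g', hg', hπg'⟩ := hmoveY e _ _ s hs he
        exact ⟨e, g', hp, ⟨_, _, hXε, hY, he⟩, hg', _, _, hXε, by dsimp only; omega, hπg'⟩
    · simp only at h1 h2 h3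
      subst h1 h2
      obtain ⟨t, ht, het⟩ := hstep i i' h3
      refine ⟨e, e * t, hp, ⟨_, _, hXε, hY, he⟩, stepRel_mul_right e ht, _, _, hXε, hY, ?_⟩
      rw [map_mul, he, het]
      calc _ = (q i * (q i)⁻¹) * (q i' * (π c ^ (X + ε) * π d ^ Y)) := by ac_rfl
        _ = _ := by rw [mul_inv_cancel, one_mul]
  -- an admissible start next to an admissible start of the neighbouring block
  obtain ⟨g₁, g₀, hg₁, hg₁₀, hg₀⟩ : ∃ g₁ g₀, E (ψ (-1)) g₁ ∧ stepRel T g₁ g₀ ∧ E (ψ 0) g₀ := by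
    obtain ⟨g, hg⟩ := hπ (q (ψ (-1)).2.2 * (π c ^ (2 * (ψ (-1)).1) * π d ^ (2 * (ψ (-1)).2.1)))
    obtain ⟨e, g', -, he, hr, hE⟩ := hnext (ψ (-1)) (ψ 0) (by simpa using hadj (-1)) g
      ⟨_, _, by omega, by omega, hg⟩
    exact ⟨e, g', he, hr, hE⟩
  have ray : ∀ (e : ℕ → ℤ), Function.Injective e → (∀ n, intStep (e n) (e (n + 1))) →
      ∀ g, E (ψ (e 0)) g → HamRay (stepRel T) (⋃ n, B (ψ (e n))) g := by
    intro e he hes g hg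
    refine HamRay.of_blocks (fun n => B (ψ (e n))) (fun n => E (ψ (e n))) ?_ ?_ g hg
    · intro m n hmn
      exact hdisj _ _ fun h => by have := he (hψ.1 h); omega
    · intro n g hg
      have hnn : boxRel intStep (boxRel intStep r) (ψ (e n)) (ψ (e (n + 1))) := by
        rcases hes n with h | h
        · rw [h]; exact hadj _
        · have := hsymm _ _ (hadj (e (n + 1)))
          rwa [← h] at this
      obtain ⟨x, g', hp, -, hr, hE⟩ := hnext _ _ hnn g hg
      exact ⟨x, g', hp, hr, hE⟩
  refine HamDoubleRay.of_rays (stepRel_symm hT)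
    (ray (fun n => (n : ℤ)) (fun a b h => by simpa using h) (fun n => Or.inl (by push_cast; ring))
      g₀ (by simpa using hg₀))
    (ray (fun n => -1 - (n : ℤ)) (fun a b h => by simpa using h)
      (fun n => Or.inr (by push_cast; ring)) g₁ (by simpa using hg₁)) hg₁₀ ⟨?_, ?_⟩
  · rw [Set.disjoint_iUnion_left]
    intro m
    rw [Set.disjoint_iUnion_right]
    intro n
    exact hdisj _ _ fun h => by have := hψ.1 h; omega
  · rw [codisjoint_iff]
    refine Set.eq_univ_of_forall fun g => ?_
    obtain ⟨β, hβ⟩ := hcover g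
    obtain ⟨n, rfl⟩ := hψ.2 β
    rcases n with n | n
    · exact Or.inl (Set.mem_iUnion.2 ⟨n, hβ⟩)
    · refine Or.inr (Set.mem_iUnion.2 ⟨n, ?_⟩)
      rwa [Int.negSucc_eq, show -((n : ℤ) + 1) = -1 - n by ring] at hβ

end Blocks

/-! ### Flexible blocks -/

section Flexible

open scoped Pointwise

variable {G A : Type*} [Group G] [CommGroup A] {π : G →* A} {T : Set G} {p : ℕ}

theorem pair_mul_one (c : A) : ({1, c} : Set A) * {1} = {1} ∪ {c} := by
  rw [pair_mul, Set.smul_set_singleton, smul_eq_mul, mul_one]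

/-- `c` and `d` generate a free abelian group of rank two. -/
def Indep (c d : A) : Prop := ∀ i j : ℤ, c ^ i * d ^ j = 1 → i = 0 ∧ j = 0

theorem Indep.symm {c d : A} (h : Indep c d) : Indep d c := fun i j hij =>
  (h j i (by rwa [mul_comm])).symm

theorem mem_zpowers_sup {c d x : A} :
    x ∈ Subgroup.zpowers c ⊔ Subgroup.zpowers d ↔ ∃ i j : ℤ, x = c ^ i * d ^ j := by
  rw [Subgroup.mem_sup]
  constructor
  · rintro ⟨y, hy, z, hz, rfl⟩
    obtain ⟨i, rfl⟩ := Subgroup.mem_zpowers_iff.1 hy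
    obtain ⟨j, rfl⟩ := Subgroup.mem_zpowers_iff.1 hz
    exact ⟨i, j, rfl⟩
  · rintro ⟨i, j, rfl⟩
    exact ⟨_, Subgroup.zpow_mem_zpowers c i, _, Subgroup.zpow_mem_zpowers d j, rfl⟩

/-- A finite subgroup meets the free abelian group `⟨c, d⟩` trivially. -/
theorem Indep.isGridTransversal_of_finite {c d : A} (h : Indep c d) (K : Subgroup A) [Finite K] :
    IsGridTransversal c d (K : Set A) ((Subgroup.zpowers c ⊔ Subgroup.zpowers d) ⊔ K) where
  mem_iff x := by
    rw [Subgroup.mem_sup]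
    constructor
    · rintro ⟨y, hy, z, hz, rfl⟩
      obtain ⟨i, j, rfl⟩ := mem_zpowers_sup.1 hy
      exact ⟨i, j, z, hz, rfl⟩
    · rintro ⟨i, j, f, hf, rfl⟩
      exact ⟨_, mem_zpowers_sup.2 ⟨i, j, rfl⟩, f, hf, rfl⟩
  inj i j i' j' f hf f' hf' he := by
    have h1 : c ^ (i - i') * d ^ (j - j') = f' * f⁻¹ := by
      rw [zpow_sub, zpow_sub, eq_mul_inv_iff_mul_eq]
      calc _ = (c ^ i * d ^ j * f) * ((c ^ i')⁻¹ * (d ^ j')⁻¹) := by ac_rfl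
        _ = (c ^ i' * (c ^ i')⁻¹) * (d ^ j' * (d ^ j')⁻¹) * f' := by rw [he]; ac_rfl
        _ = f' := by simp
    have h2 : (f' * f⁻¹) ^ Nat.card K = 1 := by
      have : (⟨f' * f⁻¹, K.mul_mem hf' (K.inv_mem hf)⟩ : K) ^ Nat.card K = 1 := pow_card_eq_one'
      exact congrArg Subtype.val this
    have hpos : (Nat.card K : ℤ) ≠ 0 := by exact_mod_cast Nat.card_pos.ne'
    rw [← h1, mul_pow, ← zpow_natCast, ← zpow_natCast, ← zpow_mul, ← zpow_mul] at h2
    obtain ⟨h3, h4⟩ := h _ _ h2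
    have h5 : i = i' := by
      rcases mul_eq_zero.1 h3 with h | h
      · omega
      · exact absurd h hpos
    have h6 : j = j' := by
      rcases mul_eq_zero.1 h4 with h | h
      · omega
      · exact absurd h hpos
    subst h5 h6
    exact ⟨rfl, rfl, mul_left_cancel he⟩

/-- The powers of `y` below the order of `y` modulo `⟨c, d⟩`. -/
theorem Indep.isGridTransversal_powers {c d : A} (h : Indep c d) (y : A)
    (hn : 0 < orderOf (y : A ⧸ (Subgroup.zpowers c ⊔ Subgroup.zpowers d))) :
    IsGridTransversal c d
      {x | ∃ j < orderOf (y : A ⧸ (Subgroup.zpowers c ⊔ Subgroup.zpowers d)), x = y ^ j}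
      ((Subgroup.zpowers c ⊔ Subgroup.zpowers d) ⊔ Subgroup.zpowers y) := by
  set M := Subgroup.zpowers c ⊔ Subgroup.zpowers d
  have hdvd := zpow_mem_iff_orderOf_dvd M y
  set n := orderOf (y : A ⧸ M)
  constructor
  · intro x
    rw [Subgroup.mem_sup]
    constructor
    · rintro ⟨m, hm, z, hz, rfl⟩
      obtain ⟨k, rfl⟩ := Subgroup.mem_zpowers_iff.1 hz
      have h1 := Int.emod_nonneg k (show (n : ℤ) ≠ 0 by omega)
      have h2 := Int.emod_lt_of_pos k (show (0 : ℤ) < n by omega)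
      have h3 : m * y ^ (k - k % n) ∈ M :=
        M.mul_mem hm ((hdvd _).2 Int.dvd_self_sub_emod)
      obtain ⟨i, j, hij⟩ := mem_zpowers_sup.1 h3
      refine ⟨i, j, y ^ (k % n).toNat, ⟨_, by omega, rfl⟩, ?_⟩
      rw [← hij, ← zpow_natCast y, Int.toNat_of_nonneg h1, mul_assoc, ← zpow_add]
      congr 2
      ring
    · rintro ⟨i, j, f, ⟨k, hk, rfl⟩, rfl⟩
      exact ⟨_, mem_zpowers_sup.2 ⟨i, j, rfl⟩, _, Subgroup.npow_mem_zpowers y k, rfl⟩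
  · rintro i j i' j' _ ⟨k, hk, rfl⟩ _ ⟨k', hk', rfl⟩ he
    have h1 : c ^ (i - i') * d ^ (j - j') = y ^ ((k' : ℤ) - k) := by
      rw [zpow_sub, zpow_sub, zpow_sub, eq_mul_inv_iff_mul_eq, zpow_natCast, zpow_natCast]
      calc _ = (c ^ i * d ^ j * y ^ k) * ((c ^ i')⁻¹ * (d ^ j')⁻¹) := by ac_rfl
        _ = (c ^ i' * (c ^ i')⁻¹) * (d ^ j' * (d ^ j')⁻¹) * y ^ k' := by rw [he]; ac_rfl
        _ = y ^ k' := by simp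
    have h2 := (hdvd _).1 (mem_zpowers_sup.2 ⟨_, _, h1.symm⟩)
    have h3 : k = k' := by
      have := Int.eq_zero_of_abs_lt_dvd h2 (by rw [abs_lt]; omega)
      omega
    subst h3
    rw [sub_self, zpow_zero] at h1
    obtain ⟨h4, h5⟩ := h _ _ h1
    exact ⟨by omega, by omega, rfl⟩

theorem zpow_ne_of_sign {ε : ℤ} (hε : ε = 1 ∨ ε = -1) : ε ≠ 0 := by omega

theorem zpow_mem_of_sign (hT : ∀ t ∈ T, t⁻¹ ∈ T) {c : G} (hc : c ∈ T) {ε : ℤ}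
    (hε : ε = 1 ∨ ε = -1) : c ^ ε ∈ T := by
  rcases hε with rfl | rfl
  · rwa [zpow_one]
  · rw [zpow_neg, zpow_one]; exact hT c hc

theorem not_commute_zpow_of_sign {b c : G} (h : b * c ≠ c * b) {ε : ℤ} (hε : ε = 1 ∨ ε = -1) :
    b * c ^ ε ≠ c ^ ε * b := by
  rcases hε with rfl | rfl
  · rwa [zpow_one]
  · rw [zpow_neg, zpow_one]
    intro h1
    exact h (Commute.inv_right_iff.1 h1)

namespace IsGridTransversal

variable {c d : A} {F : Set A} {M : Subgroup A}

theorem symm (h : IsGridTransversal c d F M) : IsGridTransversal d c F M where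
  mem_iff x := by
    rw [h.mem_iff]
    constructor
    · rintro ⟨i, j, f, hf, rfl⟩; exact ⟨j, i, f, hf, by rw [mul_comm (d ^ j)]⟩
    · rintro ⟨i, j, f, hf, rfl⟩; exact ⟨j, i, f, hf, by rw [mul_comm (d ^ i)]⟩
  inj i j i' j' f hf f' hf' he := by
    obtain ⟨h1, h2, h3⟩ := h.inj j i j' i' f hf f' hf'
      (by rw [mul_comm (c ^ j), mul_comm (c ^ j'), he])
    exact ⟨h2, h1, h3⟩

theorem disjoint_smul (h : IsGridTransversal c d F M) {ε : ℤ} (hε : ε ≠ 0) :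
    Disjoint F (c ^ ε • F) := by
  rw [Set.disjoint_left]
  rintro x hx ⟨y, hy, he⟩
  have he : c ^ ε * y = x := he
  have := (h.inj ε 0 0 0 y hy x hx (by simpa using he)).1
  exact hε this

theorem disjoint_pair_smul (h : IsGridTransversal c d F M) {ε : ℤ} (hε : ε ≠ 0) (δ : ℤ) :
    Disjoint (({1, d ^ δ} : Set A) * F) (c ^ ε • (({1, d ^ δ} : Set A) * F)) := by
  have hmem : ∀ x ∈ ({1, d ^ δ} : Set A) * F, ∃ j : ℤ, ∃ f ∈ F, x = d ^ j * f := by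
    rintro _ ⟨y, hy, f, hf, rfl⟩
    rcases hy with rfl | rfl
    · exact ⟨0, f, hf, by simp⟩
    · exact ⟨δ, f, hf, rfl⟩
  rw [Set.disjoint_left]
  rintro x hx ⟨y, hy, he⟩
  obtain ⟨j, f, hf, rfl⟩ := hmem x hx
  obtain ⟨j', f', hf', rfl⟩ := hmem y hy
  have he : c ^ ε * (d ^ j' * f') = d ^ j * f := he
  have := (h.inj ε j' 0 j f' hf' f hf (by rw [mul_assoc, he, zpow_zero, one_mul])).1
  exact hε this

end IsGridTransversal

/-- The reversed path, translated so that it starts at `1`. -/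
theorem Liftable.reverse (hT : ∀ t ∈ T, t⁻¹ ∈ T) {B : Set A} {y : A} (h : Liftable π T B y) :
    Liftable π T (y⁻¹ • B) y⁻¹ := by
  obtain ⟨e, rfl, hp⟩ := h
  refine ⟨e⁻¹, map_inv π e, ?_⟩
  have := (hp.translate e⁻¹).reverse (stepRel_symm hT)
  rwa [inv_mul_cancel, mul_one, preimage_smul, map_inv] at this

/-- Two traversals of `{1, d ^ ±1} × F` along the direction of `d`, in opposite directions, combine
to a traversal of `{1, c} × {1, d} × F` in the direction of `c`. -/
theorem liftable_pair_of_liftable (hT : ∀ t ∈ T, t⁻¹ ∈ T) {c d : G} (hc : c ∈ T) {F : Set A}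
    {M : Subgroup A} (hF : IsGridTransversal (π c) (π d) F M)
    (h : ∀ δ : ℤ, (δ = 1 ∨ δ = -1) → Liftable π T ({1, π d ^ δ} * F) (π d ^ δ))
    {ε δ : ℤ} (hε : ε = 1 ∨ ε = -1) (hδ : δ = 1 ∨ δ = -1) :
    Liftable π T ({1, π c ^ ε} * ({1, π d ^ δ} * F)) (π c ^ ε) := by
  have hset : (π d ^ δ * π (c ^ ε)) • (({1, π d ^ (-δ)} : Set A) * F) =
      π c ^ ε • (({1, π d ^ δ} : Set A) * F) := by
    rw [map_zpow, pair_mul, pair_mul, Set.smul_set_union, Set.smul_set_union, smul_smul, smul_smul,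
      zpow_neg, mul_assoc, mul_comm (π c ^ ε), mul_inv_cancel_left, mul_comm (π c ^ ε),
      Set.union_comm]
  have := (h δ hδ).append (zpow_mem_of_sign hT hc hε) (h (-δ) (by omega)) (by
    rw [hset]
    exact hF.disjoint_pair_smul (zpow_ne_of_sign hε) δ)
  refine this.congr ?_ ?_
  · rw [hset, pair_mul (π c ^ ε)]
  · rw [map_zpow, mul_comm (π d ^ δ), mul_assoc, ← zpow_add, add_neg_cancel, zpow_zero, mul_one]

theorem flexibleBlock_of_liftable (hT : ∀ t ∈ T, t⁻¹ ∈ T) {c d : G} (hc : c ∈ T) (hd : d ∈ T)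
    {F : Set A} {M : Subgroup A} (hF : IsGridTransversal (π c) (π d) F M)
    (h : ∀ ε : ℤ, (ε = 1 ∨ ε = -1) → Liftable π T ({1, π c ^ ε} * F) (π c ^ ε))
    (h' : ∀ δ : ℤ, (δ = 1 ∨ δ = -1) → Liftable π T ({1, π d ^ δ} * F) (π d ^ δ)) :
    FlexibleBlock π T (π c) (π d) F := by
  intro ε δ hε hδ
  refine ⟨liftable_pair_of_liftable hT hc hF h' hε hδ, ?_⟩
  refine (liftable_pair_of_liftable hT hd hF.symm h hδ hε).congr ?_ rfl
  rw [mul_left_comm]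

open scoped Classical in
theorem setOf_pow_eq_zpowers {a : A} {m : ℕ} (hm : orderOf a = m + 1) :
    {x | ∃ i ≤ m, x = 1 * a ^ i} = (Subgroup.zpowers a : Set A) := by
  have hfin : IsOfFinOrder a := orderOf_pos_iff.1 (by omega)
  ext x
  rw [SetLike.mem_coe, ← hfin.mem_powers_iff_mem_zpowers, hfin.mem_powers_iff_mem_range_orderOf,
    hm]
  simp [eq_comm]

theorem SectionPath.zpowers {a : G} (ha : a ∈ T) {m : ℕ} (hm : orderOf (π a) = m + 1) :
    SectionPath π T (Subgroup.zpowers (π a) : Set A) 1 (a ^ m) := by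
  refine (SectionPath.powers (π := π) ha m ?_ 1).congr ?_ rfl (one_mul _)
  · intro i hi h1
    by_contra h0
    have := Nat.le_of_dvd (Nat.pos_of_ne_zero h0) (orderOf_dvd_of_pow_eq_one h1)
    omega
  · rw [map_one, setOf_pow_eq_zpowers hm]

end Flexible

/-! ### Finding a flexible block -/

section Cases

open scoped Pointwise

variable {G A : Type*} [Group G] [CommGroup A] {π : G →* A} {T : Set G} {p : ℕ}

/-- The data of the problem: the Cayley graph of `G` with respect to the symmetric set `T`, whose
image in `A` is finitely generating, together with two independent elements of `T`. -/
structure GridSetup (π : G →* A) (p : ℕ) (T : Set G) (c d : G) : Prop where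
  kernel : PrimeKernel π p
  inv_mem : ∀ t ∈ T, t⁻¹ ∈ T
  gen : ∃ T₀ : Finset A, (T₀ : Set A) ⊆ π '' T ∧ Subgroup.closure (T₀ : Set A) = ⊤
  mem_left : c ∈ T
  mem_right : d ∈ T
  indep : Indep (π c) (π d)

namespace GridSetup

variable {c d : G}

theorem hamDoubleRay_of_flexible (h : GridSetup π p T c d) {F : Set A} {M : Subgroup A}
    (hF : IsGridTransversal (π c) (π d) F M) (hflex : FlexibleBlock π T (π c) (π d) F) :
    HamDoubleRay (stepRel T) :=
  hamDoubleRay_of_flexibleBlock h.kernel.surj h.inv_mem h.gen h.mem_left h.mem_right hF hflex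

theorem hamDoubleRay_of_liftable (h : GridSetup π p T c d) (K : Subgroup A) [Finite K]
    (h1 : ∀ ε : ℤ, (ε = 1 ∨ ε = -1) → Liftable π T ({1, π c ^ ε} * (K : Set A)) (π c ^ ε))
    (h2 : ∀ δ : ℤ, (δ = 1 ∨ δ = -1) → Liftable π T ({1, π d ^ δ} * (K : Set A)) (π d ^ δ)) :
    HamDoubleRay (stepRel T) :=
  have hF := h.indep.isGridTransversal_of_finite K
  h.hamDoubleRay_of_flexible hF
    (flexibleBlock_of_liftable h.inv_mem h.mem_left h.mem_right hF h1 h2)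

/-- It suffices to traverse the preimage of a finite subgroup. -/
theorem hamDoubleRay_of_subgroup (h : GridSetup π p T c d) (K : Subgroup A) [Finite K] {y : A}
    (hK : Liftable π T (K : Set A) y) : HamDoubleRay (stepRel T) := by
  have hF := h.indep.isGridTransversal_of_finite K
  have hy : y ∈ K := by
    obtain ⟨e, rfl, hp⟩ := hK
    exact hp.end_mem
  have hsmul : ∀ k ∈ K, k • (K : Set A) = K := by
    intro k hk
    ext x
    rw [Set.mem_smul_set_iff_inv_smul_mem, smul_eq_mul, SetLike.mem_coe, SetLike.mem_coe,
      K.mul_mem_cancel_left (K.inv_mem hk)]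
  have hK' : Liftable π T (K : Set A) y⁻¹ :=
    (hK.reverse h.inv_mem).congr (hsmul _ (K.inv_mem hy)) rfl
  have key : ∀ t ∈ T, Disjoint (K : Set A) (π t • (K : Set A)) →
      Liftable π T ({1, π t} * (K : Set A)) (π t) := by
    intro t ht hd
    have hset : (y * π t) • (K : Set A) = π t • (K : Set A) := by
      rw [mul_comm, ← smul_smul, hsmul y hy]
    refine (hK.append ht hK' (by rwa [hset])).congr ?_ ?_
    · rw [hset, pair_mul]
    · rw [mul_comm y, mul_inv_cancel_right]
  refine h.hamDoubleRay_of_liftable K (fun ε hε => ?_) (fun δ hδ => ?_)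
  · have := key (c ^ ε) (zpow_mem_of_sign h.inv_mem h.mem_left hε) (by
      rw [map_zpow]; exact hF.disjoint_smul (zpow_ne_of_sign hε))
    rwa [map_zpow] at this
  · have := key (d ^ δ) (zpow_mem_of_sign h.inv_mem h.mem_right hδ) (by
      rw [map_zpow]; exact hF.symm.disjoint_smul (zpow_ne_of_sign hδ))
    rwa [map_zpow] at this

/-- A step `x` of finite order in `A` whose powers in `G` meet the kernel non-trivially. -/
theorem hamDoubleRay_of_pow_ne_one (h : GridSetup π p T c d) {x : G} (hx : x ∈ T)
    (hfin : IsOfFinOrder (π x)) (hne : x ^ orderOf (π x) ≠ 1) : HamDoubleRay (stepRel T) := by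
  obtain ⟨m, hm⟩ : ∃ m, orderOf (π x) = m + 1 :=
    ⟨_, (Nat.succ_pred_eq_of_pos (orderOf_pos_iff.2 hfin)).symm⟩
  have : Finite (Subgroup.zpowers (π x)) := finite_zpowers.2 hfin
  refine h.hamDoubleRay_of_subgroup (Subgroup.zpowers (π x))
    ((SectionPath.zpowers hx hm).liftable h.kernel (z := x ^ (m + 1)) ?_ ?_ (hm ▸ hne))
  · rw [pow_succ]; exact stepRel_mul_right _ hx
  · rw [map_pow, ← hm, pow_orderOf_eq_one]

end GridSetup

namespace GridSetup

variable {c d : G}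

/-- If the two independent steps do not commute, `2 × 2` squares are flexible blocks. -/
theorem hamDoubleRay_of_not_commute (h : GridSetup π p T c d) (hcd : c * d ≠ d * c) :
    HamDoubleRay (stepRel T) := by
  have : Finite (⊥ : Subgroup A) := inferInstance
  have hF := h.indep.isGridTransversal_of_finite ⊥
  rw [Subgroup.coe_bot] at hF
  refine h.hamDoubleRay_of_flexible hF fun ε δ hε hδ => ?_
  have hcε := zpow_mem_of_sign h.inv_mem h.mem_left hε
  have hdδ := zpow_mem_of_sign h.inv_mem h.mem_right hδ
  have hne : d ^ δ * c ^ ε ≠ c ^ ε * d ^ δ :=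
    not_commute_zpow_of_sign (not_commute_zpow_of_sign hcd hδ).symm hε
  have h1 : π d ^ δ ≠ 1 := fun h1 => zpow_ne_of_sign hδ (h.indep 0 δ (by simp [h1])).2
  have hP := SectionPath.single (π := π) (T := T) (d ^ δ)
  have hset : ({1} ∪ {π d ^ δ} : Set A) = {1, π d ^ δ} * {1} :=
    (pair_mul_one _).symm
  have hdisj := hF.disjoint_pair_smul (zpow_ne_of_sign hε) δ
  rw [← hset] at hdisj ⊢
  rw [map_zpow] at hP
  have h0 : SectionPath π T ({1} ∪ {π d ^ δ}) 1 (d ^ δ) :=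
    ((SectionPath.single (π := π) (T := T) 1).append hP (by
      have := stepRel_mul_right 1 hdδ
      rwa [one_mul] at this) (by
      rw [map_one, Set.disjoint_singleton]; exact h1.symm)).congr (by rw [map_one]) rfl rfl
  constructor
  · have := h0.liftable_prism h.kernel h.inv_mem hcε (by rwa [map_zpow]) hne
    rwa [map_zpow] at this
  · have := hP.liftable_prism_side h.kernel h.inv_mem hcε hdδ (by
      rw [Set.mem_singleton_iff]; exact h1.symm) (by rwa [map_zpow]) hne
    rwa [map_zpow, map_zpow] at this

/-- The flexible block `{1, c} × {1, d} × {1, b, …, bⁿ⁻¹}`, where `b` does not commute with `c`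
but commutes with `d`. The path `1, d, d b, …, d bⁿ⁻¹, bⁿ⁻¹, …, b` ends at `b`, so that the prism
over it in the direction of `c` does not close up. -/
theorem hamDoubleRay_of_commute_right (h : GridSetup π p T c d) {b : G} (hb : b ∈ T)
    (hbc : b * c ≠ c * b) (hdb : Commute d b)
    (hn : 2 ≤ orderOf (π b : A ⧸ (Subgroup.zpowers (π c) ⊔ Subgroup.zpowers (π d)))) :
    HamDoubleRay (stepRel T) := by
  have hF := h.indep.isGridTransversal_powers (π b) (by omega)
  set M := Subgroup.zpowers (π c) ⊔ Subgroup.zpowers (π d)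
  obtain ⟨n, hn'⟩ : ∃ n, orderOf (π b : A ⧸ M) = n + 2 := ⟨_, (Nat.sub_add_cancel hn).symm⟩
  rw [hn'] at hF
  set F : Set A := {x | ∃ j < n + 2, x = π b ^ j}
  refine h.hamDoubleRay_of_flexible hF fun ε δ hε hδ => ?_
  have hcε := zpow_mem_of_sign h.inv_mem h.mem_left hε
  have hdδ := zpow_mem_of_sign h.inv_mem h.mem_right hδ
  have hdδ' : d ^ (-δ) ∈ T := zpow_mem_of_sign h.inv_mem h.mem_right (by omega)
  have hne := not_commute_zpow_of_sign hbc hε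
  have hbpow : ∀ i ≤ n + 1, π b ^ i = 1 → i = 0 := by
    intro i hi h1
    by_contra h0
    have h2 : ((π b : A) : A ⧸ M) ^ i = 1 := by
      rw [← QuotientGroup.mk_pow, h1, QuotientGroup.mk_one]
    have := Nat.le_of_dvd (Nat.pos_of_ne_zero h0) (orderOf_dvd_of_pow_eq_one h2)
    omega
  have hdisj1 : Disjoint F (π d ^ δ • F) := hF.symm.disjoint_smul (zpow_ne_of_sign hδ)
  have hup := SectionPath.powers (π := π) hb (n + 1) hbpow (d ^ δ)
  have hdown := (SectionPath.powers (π := π) hb n (fun i hi => hbpow i (by omega)) b).reverse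
    h.inv_mem
  have e1 : {a | ∃ i ≤ n + 1, a = π (d ^ δ) * π b ^ i} = π d ^ δ • F := by
    ext x
    rw [Set.mem_smul_set]
    constructor
    · rintro ⟨i, hi, rfl⟩
      exact ⟨_, ⟨i, by omega, rfl⟩, by rw [map_zpow]; rfl⟩
    · rintro ⟨_, ⟨i, hi, rfl⟩, rfl⟩
      exact ⟨i, by omega, by rw [map_zpow]; rfl⟩
  have e2 : F = {1} ∪ {a | ∃ i ≤ n, a = π b * π b ^ i} := by
    ext x
    constructor
    · rintro ⟨j, hj, rfl⟩
      rcases j with _ | j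
      · left; simp
      · exact Or.inr ⟨j, by omega, pow_succ' _ _⟩
    · rintro (rfl | ⟨i, hi, rfl⟩)
      · exact ⟨0, by omega, by simp⟩
      · exact ⟨i + 1, by omega, (pow_succ' _ _).symm⟩
  have h1F : (1 : A) ∈ F := ⟨0, by omega, by simp⟩
  have h1d : (1 : A) ∉ {a | ∃ i ≤ n, a = π b * π b ^ i} := by
    rintro ⟨i, hi, h1⟩
    have := hbpow (i + 1) (by omega) (by rw [pow_succ', ← h1])
    omega
  rw [e1] at hup
  have hP := hup.append hdown (by
    have h1 := stepRel_mul_right (d ^ δ * b ^ (n + 1)) hdδ'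
    have h2 : d ^ δ * b ^ (n + 1) * d ^ (-δ) = b * b ^ n := by
      rw [((hdb.zpow_left δ).pow_right (n + 1)).eq, mul_assoc, ← zpow_add, add_neg_cancel,
        zpow_zero, mul_one, pow_succ']
    rwa [h2] at h1) (by
    refine hdisj1.symm.mono_right ?_
    rw [e2]; exact Set.subset_union_right)
  have hset : ({1} ∪ (π d ^ δ • F ∪ {a | ∃ i ≤ n, a = π b * π b ^ i}) : Set A) =
      {1, π d ^ δ} * F := by
    rw [pair_mul, Set.union_left_comm, ← e2, Set.union_comm]
  have h1P : (1 : A) ∉ π d ^ δ • F ∪ {a | ∃ i ≤ n, a = π b * π b ^ i} := by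
    rintro (h1 | h1)
    · exact Set.disjoint_left.1 hdisj1 h1F h1
    · exact h1d h1
  have hdisj := hF.disjoint_pair_smul (zpow_ne_of_sign hε) δ
  rw [← hset] at hdisj ⊢
  have h0 : SectionPath π T ({1} ∪ (π d ^ δ • F ∪ {a | ∃ i ≤ n, a = π b * π b ^ i})) 1 b :=
    ((SectionPath.single (π := π) (T := T) 1).append hP (by
      have := stepRel_mul_right 1 hdδ
      rwa [one_mul] at this) (by
      rwa [map_one, Set.disjoint_singleton_left])).congr (by rw [map_one]) rfl rfl
  constructor
  · have := h0.liftable_prism h.kernel h.inv_mem hcε (by rwa [map_zpow]) hne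
    rwa [map_zpow] at this
  · have := hP.liftable_prism_side h.kernel h.inv_mem hcε hdδ h1P (by rwa [map_zpow]) hne
    rwa [map_zpow, map_zpow] at this

/-- If `T` contains a step `u ≠ c` lying over the same element of `A` as `c`, then `2 × 2` squares
are flexible blocks, the two edges in the direction of `c` being lifted in different ways. -/
theorem hamDoubleRay_of_doubleEdge (h : GridSetup π p T c d) {u : G} (hu : u ∈ T)
    (huc : π u = π c) (hne : u ≠ c) (hdc : Commute d c) (hdu : Commute d u) :
    HamDoubleRay (stepRel T) := by
  have : Finite (⊥ : Subgroup A) := inferInstance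
  have hF := h.indep.isGridTransversal_of_finite ⊥
  rw [Subgroup.coe_bot] at hF
  refine h.hamDoubleRay_of_flexible hF fun ε δ hε hδ => ?_
  have hcε := zpow_mem_of_sign h.inv_mem h.mem_left hε
  have huε := zpow_mem_of_sign h.inv_mem hu hε
  have hdδ := zpow_mem_of_sign h.inv_mem h.mem_right hδ
  have hne' : u ^ ε ≠ c ^ ε := by
    rcases hε with rfl | rfl
    · simpa using hne
    · simpa using hne
  have hπ' : π (u ^ ε) = π (c ^ ε) := by rw [map_zpow, map_zpow, huc]
  have hdc' : Commute (d ^ δ) (c ^ ε) := (hdc.zpow_left δ).zpow_right ε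
  have hdu' : Commute (d ^ δ) (u ^ ε) := (hdu.zpow_left δ).zpow_right ε
  have hd1 : π d ^ δ ≠ 1 := fun h1 => zpow_ne_of_sign hδ (h.indep 0 δ (by simp [h1])).2
  have hc1 : π c ^ ε ≠ 1 := fun h1 => zpow_ne_of_sign hε (h.indep ε 0 (by simp [h1])).1
  constructor
  · have h0 : SectionPath π T ({1} ∪ {π d ^ δ}) 1 (d ^ δ) :=
      ((SectionPath.single (π := π) (T := T) 1).append (SectionPath.single (d ^ δ)) (by
        have := stepRel_mul_right 1 hdδ
        rwa [one_mul] at this) (by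
        rw [map_one, map_zpow, Set.disjoint_singleton]; exact hd1.symm)).congr
        (by rw [map_one, map_zpow]) rfl rfl
    have hset : ({1} ∪ {π d ^ δ} : Set A) = {1, π d ^ δ} * {1} :=
      (pair_mul_one _).symm
    have hdisj := hF.disjoint_pair_smul (zpow_ne_of_sign hε) δ
    rw [← hset] at hdisj ⊢
    have h1 := h0.prism h.inv_mem huε (by rwa [hπ', map_zpow])
    have hconj : d ^ δ * u ^ ε * (d ^ δ)⁻¹ * 1 = u ^ ε := by
      rw [hdu'.eq, mul_one, mul_inv_cancel_right]
    rw [hconj] at h1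
    refine (h1.liftable h.kernel (z := u ^ ε * (c ^ ε)⁻¹)
      (stepRel_mul_right _ (h.inv_mem _ hcε)) ?_ ?_).congr ?_ (by rw [hπ', map_zpow])
    · rw [map_mul, map_inv, hπ', mul_inv_cancel]
    · rwa [Ne, mul_inv_eq_one]
    · rw [hπ', map_zpow, pair_mul]
  · have hdisj := hF.symm.disjoint_pair_smul (zpow_ne_of_sign hδ) ε
    have hset : ({1, π c ^ ε} * {1} : Set A) = {1} ∪ {π c ^ ε} :=
      pair_mul_one _
    have := liftable_doubleEdge h.kernel h.inv_mem hcε huε hdδ hπ' hne'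
      (SectionPath.single (c ^ ε)) hdc' (by
        rw [map_zpow, Set.mem_singleton_iff]; exact hc1.symm) (by
        rw [map_zpow, map_zpow, ← hset]; exact hdisj)
    rw [map_zpow, map_zpow, ← hset, mul_left_comm] at this
    exact this

/-- If a step `b` of finite order commutes neither with `c` nor with `d`, then prisms over
`⟨b⟩` can be used in both directions. -/
theorem hamDoubleRay_of_finite_order (h : GridSetup π p T c d) {b : G} (hb : b ∈ T)
    (hfin : IsOfFinOrder (π b)) (hb1 : b ^ orderOf (π b) = 1) (hbc : b * c ≠ c * b)
    (hbd : b * d ≠ d * b) : HamDoubleRay (stepRel T) := by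
  obtain ⟨m, hm⟩ : ∃ m, orderOf (π b) = m + 1 :=
    ⟨_, (Nat.succ_pred_eq_of_pos (orderOf_pos_iff.2 hfin)).symm⟩
  have : Finite (Subgroup.zpowers (π b)) := finite_zpowers.2 hfin
  have hF := h.indep.isGridTransversal_of_finite (Subgroup.zpowers (π b))
  have hpow : b ^ m = b⁻¹ := by
    rw [hm, pow_succ] at hb1
    exact eq_inv_of_mul_eq_one_left hb1
  have hP := SectionPath.zpowers (π := π) hb hm
  rw [hpow] at hP
  have key : ∀ t ∈ T, b * t ≠ t * b → Disjoint (Subgroup.zpowers (π b) : Set A)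
      (π t • (Subgroup.zpowers (π b) : Set A)) →
      Liftable π T ({1, π t} * (Subgroup.zpowers (π b) : Set A)) (π t) := by
    intro t ht hbt hd
    refine hP.liftable_prism h.kernel h.inv_mem ht hd ?_
    intro h1
    exact hbt (Commute.inv_left_iff.1 h1)
  refine h.hamDoubleRay_of_liftable (Subgroup.zpowers (π b)) (fun ε hε => ?_) (fun δ hδ => ?_)
  · have := key (c ^ ε) (zpow_mem_of_sign h.inv_mem h.mem_left hε)
      (not_commute_zpow_of_sign hbc hε) (by
      rw [map_zpow]; exact hF.disjoint_smul (zpow_ne_of_sign hε))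
    rwa [map_zpow] at this
  · have := key (d ^ δ) (zpow_mem_of_sign h.inv_mem h.mem_right hδ)
      (not_commute_zpow_of_sign hbd hδ) (by
      rw [map_zpow]; exact hF.symm.disjoint_smul (zpow_ne_of_sign hδ))
    rwa [map_zpow] at this

end GridSetup

end Cases

/-! ### Two non-commuting steps generating a finite subgroup -/

section Finite

open scoped Pointwise

variable {G A : Type*} [Group G] [CommGroup A] {π : G →* A} {T : Set G} {p : ℕ}

theorem eq_zero_of_pow_eq_one_of_lt {a : A} {i : ℕ} (hi : i < orderOf a) (h : a ^ i = 1) :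
    i = 0 := by
  by_contra h0
  have := Nat.le_of_dvd (Nat.pos_of_ne_zero h0) (orderOf_dvd_of_pow_eq_one h)
  omega

theorem setOf_pow_eq_zpowers_sdiff {a : A} {m : ℕ} (hm : orderOf a = m + 2) :
    {x | ∃ i ≤ m, x = a * a ^ i} = {y | y ∈ Subgroup.zpowers a ∧ y ≠ 1} := by
  ext x
  have h := Set.ext_iff.1 (setOf_pow_eq_zpowers (a := a) (m := m + 1) hm) x
  rw [SetLike.mem_coe] at h
  rw [Set.mem_ofPred_eq, Set.mem_ofPred_eq, ← h]
  constructor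
  · rintro ⟨i, hi, rfl⟩
    refine ⟨⟨i + 1, by omega, by rw [pow_succ', one_mul]⟩, fun h1 => ?_⟩
    rw [← pow_succ'] at h1
    have := eq_zero_of_pow_eq_one_of_lt (by omega) h1
    omega
  · rintro ⟨⟨i, hi, rfl⟩, h1⟩
    rcases i with _ | i
    · simp at h1
    · exact ⟨i, by omega, by rw [pow_succ', one_mul]⟩

theorem singleton_union_zpowers_sdiff (a : A) :
    ({1} ∪ {y | y ∈ Subgroup.zpowers a ∧ y ≠ 1} : Set A) = Subgroup.zpowers a := by
  ext x
  simp only [Set.mem_union, Set.mem_singleton_iff, Set.mem_ofPred_eq, SetLike.mem_coe]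
  constructor
  · rintro (rfl | h)
    · exact Subgroup.one_mem _
    · exact h.1
  · intro h
    by_cases h1 : x = 1
    · exact Or.inl h1
    · exact Or.inr ⟨h, h1⟩

theorem SectionPath.zpowers_sdiff {t : G} (ht : t ∈ T) {m : ℕ} (hm : orderOf (π t) = m + 2) :
    SectionPath π T {y | y ∈ Subgroup.zpowers (π t) ∧ y ≠ 1} t (t * t ^ m) :=
  (SectionPath.powers (π := π) ht m
    (fun _ hi h => eq_zero_of_pow_eq_one_of_lt (by omega) h) t).congr
    (setOf_pow_eq_zpowers_sdiff hm) rfl rfl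

theorem row_unique {M : Subgroup A} {b : A} {i j : ℕ} (hi : i < orderOf (b : A ⧸ M))
    (hj : j < orderOf (b : A ⧸ M)) {y y' : A} (hy : y ∈ M) (hy' : y' ∈ M)
    (h : b ^ i * y = b ^ j * y') : i = j := by
  have h1 : b ^ ((i : ℤ) - j) = y' * y⁻¹ := by
    rw [zpow_sub, eq_mul_inv_iff_mul_eq, zpow_natCast, zpow_natCast, mul_right_comm, h,
      mul_right_comm, mul_inv_cancel, one_mul]
  have h2 := (zpow_mem_iff_orderOf_dvd M b _).1 (h1 ▸ M.mul_mem hy' (M.inv_mem hy))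
  have := Int.eq_zero_of_abs_lt_dvd h2 (by rw [abs_lt]; omega)
  omega

/-- The first `k + 1` rows of the grid with rows `b ^ j ⟨a⟩`, traversed one after the other. -/
theorem SectionPath.exists_rows {a b c : G} (ha : a ∈ T) (hb : b ∈ T) (hca : Commute c a)
    (hcb : Commute c b) {m : ℕ} (hm : orderOf (π a) = m + 1) (k : ℕ)
    (hk : k < orderOf (π b : A ⧸ Subgroup.zpowers (π a))) :
    ∃ w, Commute c w ∧ SectionPath π T
      {x | ∃ j ≤ k, ∃ y ∈ Subgroup.zpowers (π a), x = π b ^ j * y} 1 w := by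
  have h1 := SectionPath.zpowers (π := π) ha hm
  induction k with
  | zero =>
    refine ⟨a ^ m, hca.pow_right m, h1.congr ?_ rfl rfl⟩
    ext x
    simp
  | succ k ih =>
    obtain ⟨w, hw, hP⟩ := ih (by omega)
    have hmem : ∀ x, x ∈ π (a ^ m * b) •
        {x | ∃ j ≤ k, ∃ y ∈ Subgroup.zpowers (π a), x = π b ^ j * y} ↔
        ∃ j ≤ k, ∃ y ∈ Subgroup.zpowers (π a), x = π b ^ (j + 1) * y := by
      intro x
      rw [Set.mem_smul_set]
      constructor
      · rintro ⟨_, ⟨j, hj, y, hy, rfl⟩, rfl⟩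
        refine ⟨j, hj, π a ^ m * y,
          Subgroup.mul_mem _ (Subgroup.npow_mem_zpowers _ _) hy, ?_⟩
        rw [map_mul, map_pow, smul_eq_mul, pow_succ]
        ac_rfl
      · rintro ⟨j, hj, y, hy, rfl⟩
        refine ⟨_, ⟨j, hj, (π a ^ m)⁻¹ * y, Subgroup.mul_mem _
          (Subgroup.inv_mem _ (Subgroup.npow_mem_zpowers _ _)) hy, rfl⟩, ?_⟩
        rw [map_mul, map_pow, smul_eq_mul, pow_succ]
        calc _ = (π a ^ m * (π a ^ m)⁻¹) * (π b ^ j * π b * y) := by ac_rfl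
          _ = _ := by rw [mul_inv_cancel, one_mul]
    have h2 := h1.append (hP.translate (a ^ m * b)) (by
      rw [mul_one]; exact stepRel_mul_right _ hb) (by
      rw [Set.disjoint_left]
      intro x hx hx'
      obtain ⟨j, hj, y, hy, rfl⟩ := (hmem x).1 hx'
      have := row_unique (i := 0) (j := j + 1) (b := π b) (by omega) (by omega) hx hy
        (by rw [pow_zero, one_mul])
      omega)
    refine ⟨_, ((hca.pow_right m).mul_right hcb).mul_right hw, h2.congr ?_ rfl rfl⟩
    ext x
    rw [Set.mem_union, hmem]
    constructor
    · rintro (hx | ⟨j, hj, y, hy, rfl⟩)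
      · exact ⟨0, by omega, x, hx, by simp⟩
      · exact ⟨j + 1, by omega, y, hy, rfl⟩
    · rintro ⟨j, hj, y, hy, rfl⟩
      rcases j with _ | j
      · left; simpa using hy
      · exact Or.inr ⟨j, by omega, y, hy, rfl⟩

/-- Two non-commuting steps `a` and `b` such that `b` does not lie in `⟨a⟩` modulo the kernel. The
rows `b ^ j ⟨a⟩` form a grid, and the prism over its first row is merged along a square with the
prism over the remaining rows. -/
theorem liftable_central_grid (hπ : PrimeKernel π p) (hT : ∀ t ∈ T, t⁻¹ ∈ T) {a b c : G}
    (ha : a ∈ T) (hb : b ∈ T) (hc : c ∈ T) (hab : a * b ≠ b * a) (hca : Commute c a)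
    (hcb : Commute c b) {m : ℕ} (hm : orderOf (π a) = m + 2) {k : ℕ}
    (hk : orderOf (π b : A ⧸ Subgroup.zpowers (π a)) = k + 2)
    (hd : Disjoint (↑(Subgroup.zpowers (π a) ⊔ Subgroup.zpowers (π b)) : Set A)
      (π c • ↑(Subgroup.zpowers (π a) ⊔ Subgroup.zpowers (π b)))) :
    Liftable π T ({1, π c} * ↑(Subgroup.zpowers (π a) ⊔ Subgroup.zpowers (π b))) (π c) := by
  set Z := Subgroup.zpowers (π a)
  have hZi : Subgroup.zpowers (π a⁻¹) = Z := by rw [map_inv, Subgroup.zpowers_inv]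
  have hmi : orderOf (π a⁻¹) = m + 2 := by rw [map_inv, orderOf_inv, hm]
  have h₀ := SectionPath.zpowers_sdiff (π := π) (hT a ha) hmi
  have h₂ := h₀.translate b
  rw [hZi] at h₀ h₂
  obtain ⟨w₁, hw₁, h₁⟩ : ∃ w, Commute c w ∧ SectionPath π T
      {x | x = π b ∨ ∃ j < k, ∃ y ∈ Z, x = π b ^ (j + 2) * y} b w := by
    rcases k with _ | k
    · refine ⟨b, hcb, (SectionPath.single b).congr ?_ rfl rfl⟩
      ext x; simp
    · obtain ⟨w, hw, hP⟩ := SectionPath.exists_rows (π := π) ha hb hca hcb hm k (by omega)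
      have hmem : ∀ x, x ∈ π (b * b) • {x | ∃ j ≤ k, ∃ y ∈ Z, x = π b ^ j * y} ↔
          ∃ j < k + 1, ∃ y ∈ Z, x = π b ^ (j + 2) * y := by
        intro x
        rw [Set.mem_smul_set]
        constructor
        · rintro ⟨_, ⟨j, hj, y, hy, rfl⟩, rfl⟩
          refine ⟨j, by omega, y, hy, ?_⟩
          rw [map_mul, smul_eq_mul, pow_add, pow_two]
          ac_rfl
        · rintro ⟨j, hj, y, hy, rfl⟩
          refine ⟨_, ⟨j, by omega, y, hy, rfl⟩, ?_⟩
          rw [map_mul, smul_eq_mul, pow_add, pow_two]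
          ac_rfl
      have h2 := (SectionPath.single (π := π) (T := T) b).append (hP.translate (b * b))
        (by rw [mul_one]; exact stepRel_mul_right _ hb) (by
          rw [Set.disjoint_singleton_left, hmem]
          rintro ⟨j, hj, y, hy, he⟩
          have := row_unique (i := 1) (j := j + 2) (b := π b) (M := Z) (by omega) (by omega)
            Z.one_mem hy (by rw [pow_one, mul_one]; exact he)
          omega)
      refine ⟨_, (hcb.mul_right hcb).mul_right hw, h2.congr ?_ rfl rfl⟩
      ext x
      rw [Set.mem_union, hmem]
      rfl
  have hset : ({1} ∪ {y | y ∈ Z ∧ y ≠ 1} ∪ {x | x = π b ∨ ∃ j < k, ∃ y ∈ Z, x = π b ^ (j + 2) * y} ∪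
      π b • {y | y ∈ Z ∧ y ≠ 1} : Set A) = ↑(Z ⊔ Subgroup.zpowers (π b)) := by
    rw [singleton_union_zpowers_sdiff]
    ext x
    rw [SetLike.mem_coe, Subgroup.mem_sup]
    constructor
    · rintro ((hx | hx | ⟨j, hj, y, hy, rfl⟩) | ⟨y, hy, rfl⟩)
      · exact ⟨x, hx, 1, Subgroup.one_mem _, mul_one x⟩
      · exact ⟨1, Z.one_mem, π b, Subgroup.mem_zpowers _, by rw [one_mul, hx]⟩
      · exact ⟨y, hy, _, Subgroup.npow_mem_zpowers _ _, mul_comm _ _⟩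
      · exact ⟨y, hy.1, π b, Subgroup.mem_zpowers _, mul_comm _ _⟩
    · rintro ⟨y, hy, z, hz, rfl⟩
      obtain ⟨i, rfl⟩ := Subgroup.mem_zpowers_iff.1 hz
      have h1 := Int.emod_nonneg i (show ((k + 2 : ℕ) : ℤ) ≠ 0 by omega)
      have h2 := Int.emod_lt_of_pos i (show (0 : ℤ) < ((k + 2 : ℕ) : ℤ) by omega)
      obtain ⟨j, hj⟩ := Int.eq_ofNat_of_zero_le h1
      have h3 : π b ^ (i - j) ∈ Z := by
        rw [zpow_mem_iff_orderOf_dvd, hk, ← hj]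
        exact Int.dvd_self_sub_emod
      have h4 : y * π b ^ i = π b ^ j * (y * π b ^ (i - j)) := by
        rw [zpow_sub, zpow_natCast]
        calc _ = y * π b ^ i * (π b ^ j * (π b ^ j)⁻¹) := by rw [mul_inv_cancel, mul_one]
          _ = _ := by ac_rfl
      have h5 := Z.mul_mem hy h3
      rw [h4]
      rcases j with _ | _ | j
      · left; left; simpa using h5
      · by_cases h6 : y * π b ^ (i - ((0 + 1 : ℕ) : ℤ)) = 1
        · left; right; left
          rw [h6, zero_add, pow_one, mul_one]
        · right
          exact ⟨_, ⟨h5, h6⟩, by rw [zero_add, pow_one]; rfl⟩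
      · left; right; right
        exact ⟨j, by omega, _, h5, rfl⟩
  have hbt : b * a⁻¹ ≠ a⁻¹ * b := by
    intro h1
    exact hab (Commute.inv_right_iff.1 h1).symm
  have r1 : ∀ y ∈ Z, y ≠ π b := by
    rintro y hy rfl
    have := row_unique (i := 0) (j := 1) (b := π b) (M := Z) (by omega) (by omega) hy Z.one_mem
      (by simp)
    omega
  have r2 : ∀ y ∈ Z, ∀ j < k, ∀ z ∈ Z, y ≠ π b ^ (j + 2) * z := by
    rintro y hy j hj z hz h1
    have := row_unique (i := 0) (j := j + 2) (b := π b) (M := Z) (by omega) (by omega) hy hz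
      (by rw [← h1]; simp)
    omega
  have r3 : ∀ y ∈ Z, ∀ z ∈ Z, y ≠ π b * z := by
    rintro y hy z hz h1
    have := row_unique (i := 0) (j := 1) (b := π b) (M := Z) (by omega) (by omega) hy hz
      (by rw [pow_one, ← h1]; simp)
    omega
  have r4 : ∀ y ∈ Z, ∀ j < k, ∀ z ∈ Z, π b * y ≠ π b ^ (j + 2) * z := by
    rintro y hy j hj z hz h1
    have := row_unique (i := 1) (j := j + 2) (b := π b) (M := Z) (by omega) (by omega) hy hz
      (by rw [← h1]; simp)
    omega
  refine (liftable_merge hπ hT (hT a ha) hb hc hbt h₀ h₁ h₂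
    (hca.inv_right.mul_right (hca.inv_right.pow_right m)) hw₁
    (hcb.mul_right (hca.inv_right.mul_right (hca.inv_right.pow_right m)))
    (fun h1 => h1.2 rfl) ?_ ?_ ?_ ?_ ?_ ?_).congr (by rw [hset]) rfl
  · rintro (h1 | ⟨j, hj, y, hy, h1⟩)
    · exact r1 _ Z.one_mem h1
    · exact r2 _ Z.one_mem j hj y hy h1
  · rintro ⟨y, hy, h1⟩
    exact r3 _ Z.one_mem y hy.1 h1.symm
  · rw [Set.disjoint_left]
    rintro x hx (h1 | ⟨j, hj, y, hy, h1⟩)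
    · exact r1 _ hx.1 h1
    · exact r2 _ hx.1 j hj y hy h1
  · rw [Set.disjoint_left]
    rintro x hx ⟨y, hy, h1⟩
    exact r3 _ hx.1 y hy.1 h1.symm
  · rw [Set.disjoint_left]
    rintro x (h1 | ⟨j, hj, y, hy, h1⟩) ⟨z, hz, h2⟩
    · have h2 : π b * z = x := h2
      rw [h1] at h2
      exact hz.2 (mul_eq_left.1 h2)
    · exact r4 z hz.1 j hj y hy (h2.trans h1)
  · rw [hset]; exact hd

/-- Two different steps `a` and `b` over the same element of `A`, on a cycle `⟨a⟩`. -/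
theorem liftable_central_of_map_eq (hπ : PrimeKernel π p) (hT : ∀ t ∈ T, t⁻¹ ∈ T) {a b c : G}
    (ha : a ∈ T) (hb : b ∈ T) (hc : c ∈ T) (hab : a * b ≠ b * a) (hca : Commute c a)
    {m : ℕ} (hm : orderOf (π a) = m + 2) (hba : π b = π a)
    (hd : Disjoint (↑(Subgroup.zpowers (π a)) : Set A) (π c • ↑(Subgroup.zpowers (π a)))) :
    Liftable π T ({1, π c} * ↑(Subgroup.zpowers (π a))) (π c) := by
  rw [← singleton_union_zpowers_sdiff] at hd ⊢
  refine liftable_doubleEdge hπ hT ha hb hc hba ?_ (SectionPath.zpowers_sdiff ha hm)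
    (hca.mul_right (hca.pow_right m)) (fun h1 => h1.2 rfl) hd
  rintro rfl
  exact hab rfl

/-- Two non-commuting steps `a` and `b` with `b = a ^ (j + 2)` modulo the kernel. The path along the
edge `1, a⁻¹` is merged with the path through the remaining powers of `a`, which runs through the
edge `b, b a⁻¹`. -/
theorem liftable_central_cycle (hπ : PrimeKernel π p) (hT : ∀ t ∈ T, t⁻¹ ∈ T) {a b c : G}
    (ha : a ∈ T) (hb : b ∈ T) (hc : c ∈ T) (hab : a * b ≠ b * a) (hca : Commute c a)
    (hcb : Commute c b) {j n : ℕ} (hm : orderOf (π a) = j + n + 4) (hba : π b = π a ^ (j + 2))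
    (hd : Disjoint (↑(Subgroup.zpowers (π a)) : Set A) (π c • ↑(Subgroup.zpowers (π a)))) :
    Liftable π T ({1, π c} * ↑(Subgroup.zpowers (π a))) (π c) := by
  have hord : π a ^ (j + n + 4) = 1 := hm ▸ pow_orderOf_eq_one _
  have hinj : ∀ i i' : ℕ, i < j + n + 4 → i' < j + n + 4 → π a ^ i = π a ^ i' → i = i' :=
    fun i i' hi hi' h => pow_injOn_Iio_orderOf (by rwa [hm]) (by rwa [hm]) h
  have h₀ := (SectionPath.single (π := π) (T := T) a⁻¹).congr
    (X' := {x | x = π a ^ (j + n + 3)}) (by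
      have : (π a)⁻¹ = π a ^ (j + n + 3) := inv_eq_of_mul_eq_one_right (by rw [← pow_succ', hord])
      rw [map_inv, this]
      rfl) rfl rfl
  have h₁ := (SectionPath.powers (π := π) ha n
    (fun i hi h => eq_zero_of_pow_eq_one_of_lt (by omega) h) b).congr
    (X' := {x | ∃ i, j + 2 ≤ i ∧ i ≤ j + n + 2 ∧ x = π a ^ i}) (by
      ext x
      constructor
      · rintro ⟨i, hi, rfl⟩
        exact ⟨j + 2 + i, by omega, by omega, by rw [hba, ← pow_add]⟩
      · rintro ⟨i, h1, h2, rfl⟩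
        exact ⟨i - (j + 2), by omega, by rw [hba, ← pow_add]; congr 1; omega⟩) rfl rfl
  have hinv : ∀ i i', i' ≤ i → π a ^ i * (π a)⁻¹ ^ i' = π a ^ (i - i') := by
    intro i i' h
    rw [pow_sub _ h, inv_pow]
  have h₂ := (SectionPath.powers (π := π) (hT a ha) j
    (fun i hi h => eq_zero_of_pow_eq_one_of_lt (a := π a) (by omega) (by
      rwa [map_inv, inv_pow, inv_eq_one] at h)) (b * a⁻¹)).congr
    (X' := {x | ∃ i, 1 ≤ i ∧ i ≤ j + 1 ∧ x = π a ^ i}) (by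
      have e : ∀ i ≤ j, π (b * a⁻¹) * π a⁻¹ ^ i = π a ^ (j + 1 - i) := by
        intro i hi
        rw [map_mul, map_inv, mul_assoc, ← pow_succ', hba, hinv _ _ (by omega)]
        congr 1
        omega
      ext x
      constructor
      · rintro ⟨i, hi, rfl⟩
        exact ⟨j + 1 - i, by omega, by omega, e i hi⟩
      · rintro ⟨i, h1, h2, rfl⟩
        exact ⟨j + 1 - i, by omega, by rw [e _ (by omega)]; congr 1; omega⟩) rfl rfl
  have hset : ({1} ∪ {x | x = π a ^ (j + n + 3)} ∪
      {x | ∃ i, j + 2 ≤ i ∧ i ≤ j + n + 2 ∧ x = π a ^ i} ∪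
      {x | ∃ i, 1 ≤ i ∧ i ≤ j + 1 ∧ x = π a ^ i} : Set A) = ↑(Subgroup.zpowers (π a)) := by
    rw [← setOf_pow_eq_zpowers (m := j + n + 3) hm]
    ext x
    simp only [one_mul]
    constructor
    · rintro (((hx | hx) | ⟨i, h1, h2, hx⟩) | ⟨i, h1, h2, hx⟩)
      · exact ⟨0, by omega, hx.trans (pow_zero _).symm⟩
      · exact ⟨_, le_rfl, hx⟩
      · exact ⟨i, by omega, hx⟩
      · exact ⟨i, by omega, hx⟩
    · rintro ⟨i, hi, hx⟩
      rcases (by omega : i = 0 ∨ (1 ≤ i ∧ i ≤ j + 1) ∨ (j + 2 ≤ i ∧ i ≤ j + n + 2) ∨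
        i = j + n + 3) with rfl | h1 | h1 | rfl
      · exact Or.inl (Or.inl (Or.inl (hx.trans (pow_zero _))))
      · exact Or.inr ⟨i, h1.1, h1.2, hx⟩
      · exact Or.inl (Or.inr ⟨i, h1.1, h1.2, hx⟩)
      · exact Or.inl (Or.inl (Or.inr hx))
  have hbt : b * a⁻¹ ≠ a⁻¹ * b := by
    intro h1
    exact hab (Commute.inv_right_iff.1 h1).symm
  refine (liftable_merge hπ hT (hT a ha) hb hc hbt h₀ h₁ h₂ hca.inv_right
    (hcb.mul_right (hca.pow_right n)) ((hcb.mul_right hca.inv_right).mul_right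
      (hca.inv_right.pow_right j)) ?_ ?_ ?_ ?_ ?_ ?_ (by rwa [hset])).congr (by rw [hset]) rfl
  · intro h1
    have := hinj 0 _ (by omega) (by omega) ((pow_zero _).trans h1)
    omega
  · rintro ⟨i, h2, h3, h1⟩
    have := hinj 0 _ (by omega) (by omega) ((pow_zero _).trans h1)
    omega
  · rintro ⟨i, h2, h3, h1⟩
    have := hinj 0 _ (by omega) (by omega) ((pow_zero _).trans h1)
    omega
  all_goals rw [Set.disjoint_left]
  · rintro x rfl ⟨i, h2, h3, h1⟩
    have := hinj _ _ (by omega) (by omega) h1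
    omega
  · rintro x rfl ⟨i, h2, h3, h1⟩
    have := hinj _ _ (by omega) (by omega) h1
    omega
  · rintro x ⟨i', h2', h3', rfl⟩ ⟨i, h2, h3, h1⟩
    have := hinj _ _ (by omega) (by omega) h1
    omega

/-- For non-commuting steps `a` and `b` of finite order in `A`, and a step `c` commuting with both,
the preimage of `{1, c} × ⟨a, b⟩` has a Hamiltonian path. -/
theorem liftable_central (hπ : PrimeKernel π p) (hT : ∀ t ∈ T, t⁻¹ ∈ T) {a b c : G}
    (ha : a ∈ T) (hb : b ∈ T) (hc : c ∈ T) (hab : a * b ≠ b * a) (hca : Commute c a)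
    (hcb : Commute c b) (hfa : IsOfFinOrder (π a)) (hfb : IsOfFinOrder (π b)) (ha1 : π a ≠ 1)
    (hb1 : π b ≠ 1)
    (hd : Disjoint (↑(Subgroup.zpowers (π a) ⊔ Subgroup.zpowers (π b)) : Set A)
      (π c • ↑(Subgroup.zpowers (π a) ⊔ Subgroup.zpowers (π b)))) :
    Liftable π T ({1, π c} * ↑(Subgroup.zpowers (π a) ⊔ Subgroup.zpowers (π b))) (π c) := by
  have h1 : orderOf (π a) ≠ 1 := fun h => ha1 (orderOf_eq_one_iff.1 h)
  have h2 := orderOf_pos_iff.2 hfa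
  obtain ⟨m, hm⟩ : ∃ m, orderOf (π a) = m + 2 := ⟨orderOf (π a) - 2, by omega⟩
  by_cases hmem : π b ∈ Subgroup.zpowers (π a)
  · rw [sup_eq_left.2 ((Subgroup.zpowers_le).2 hmem)] at hd ⊢
    obtain ⟨k, hk, hk'⟩ : ∃ k ≤ m + 1, π b = 1 * π a ^ k := by
      have := hmem
      rwa [← SetLike.mem_coe, ← setOf_pow_eq_zpowers (m := m + 1) hm] at this
    rw [one_mul] at hk'
    have hk0 : k ≠ 0 := by
      rintro rfl
      exact hb1 (hk'.trans (pow_zero _))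
    by_cases hk1 : k = 1
    · exact liftable_central_of_map_eq hπ hT ha hb hc hab hca hm (by rw [hk', hk1, pow_one]) hd
    by_cases hkm : k = m + 1
    · have e : Subgroup.zpowers (π a) = Subgroup.zpowers (π a⁻¹) := by
        rw [map_inv, Subgroup.zpowers_inv]
      rw [e] at hd ⊢
      refine liftable_central_of_map_eq hπ hT (hT a ha) hb hc ?_ hca.inv_right
        (by rw [map_inv, orderOf_inv, hm]) ?_ hd
      · intro h
        exact hab (Commute.inv_left_iff.1 h)
      · rw [hk', hkm, map_inv, eq_comm]
        exact inv_eq_of_mul_eq_one_right (by rw [← pow_succ', ← hm, pow_orderOf_eq_one])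
    · obtain ⟨j, rfl⟩ : ∃ j, k = j + 2 := ⟨k - 2, by omega⟩
      exact liftable_central_cycle hπ hT ha hb hc hab hca hcb (n := m - j - 2) (by omega) hk' hd
  · have hq : IsOfFinOrder (π b : A ⧸ Subgroup.zpowers (π a)) :=
      (QuotientGroup.mk' (Subgroup.zpowers (π a))).isOfFinOrder hfb
    have h3 := orderOf_pos_iff.2 hq
    have h4 : orderOf (π b : A ⧸ Subgroup.zpowers (π a)) ≠ 1 := by
      rwa [Ne, orderOf_eq_one_iff, QuotientGroup.eq_one_iff]
    exact liftable_central_grid hπ hT ha hb hc hab hca hcb hm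
      (k := orderOf (π b : A ⧸ Subgroup.zpowers (π a)) - 2) (by omega) hd

variable {c d : G}

/-- Two non-commuting steps of finite order in `A` that commute with the two independent steps. -/
theorem GridSetup.hamDoubleRay_of_finite_orders (h : GridSetup π p T c d) {a b : G} (ha : a ∈ T)
    (hb : b ∈ T) (hab : a * b ≠ b * a) (hca : Commute c a) (hcb : Commute c b) (hda : Commute d a)
    (hdb : Commute d b) (hfa : IsOfFinOrder (π a)) (hfb : IsOfFinOrder (π b)) (ha1 : π a ≠ 1)
    (hb1 : π b ≠ 1) : HamDoubleRay (stepRel T) := by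
  have : Finite (Subgroup.zpowers (π a)) := finite_zpowers.2 hfa
  have : Finite (Subgroup.zpowers (π b)) := finite_zpowers.2 hfb
  have : Finite ↑(Subgroup.zpowers (π a) ⊔ Subgroup.zpowers (π b)) := by
    have : ((Subgroup.zpowers (π a) ⊔ Subgroup.zpowers (π b) : Subgroup A) : Set A).Finite := by
      rw [Subgroup.mul_normal]
      exact Set.Finite.mul (Set.toFinite _) (Set.toFinite _)
    exact this.to_subtype
  have hF := h.indep.isGridTransversal_of_finite (Subgroup.zpowers (π a) ⊔ Subgroup.zpowers (π b))
  refine h.hamDoubleRay_of_liftable (Subgroup.zpowers (π a) ⊔ Subgroup.zpowers (π b))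
    (fun ε hε => ?_) (fun δ hδ => ?_)
  · have := liftable_central h.kernel h.inv_mem ha hb (zpow_mem_of_sign h.inv_mem h.mem_left hε) hab
      (hca.zpow_left ε) (hcb.zpow_left ε) hfa hfb ha1 hb1 (by
      rw [map_zpow]; exact hF.disjoint_smul (zpow_ne_of_sign hε))
    rwa [map_zpow] at this
  · have := liftable_central h.kernel h.inv_mem ha hb (zpow_mem_of_sign h.inv_mem h.mem_right hδ)
      hab (hda.zpow_left δ) (hdb.zpow_left δ) hfa hfb ha1 hb1 (by
      rw [map_zpow]; exact hF.symm.disjoint_smul (zpow_ne_of_sign hδ))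
    rwa [map_zpow] at this

end Finite

/-! ### Cayley graphs with two independent steps -/

section Combine

variable {G A : Type*} [Group G] [CommGroup A] {π : G →* A} {T : Set G} {p : ℕ} {c d : G}

theorem Indep.eq_zero_left {c d : A} (h : Indep c d) {i : ℤ} (hi : c ^ i = 1) : i = 0 :=
  (h i 0 (by rw [hi, zpow_zero, one_mul])).1

theorem Indep.not_isOfFinOrder_left {c d : A} (h : Indep c d) : ¬ IsOfFinOrder c := by
  rw [isOfFinOrder_iff_zpow_eq_one]
  rintro ⟨i, hi, h1⟩
  exact hi (h.eq_zero_left h1)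

theorem exists_zpow_eq_of_not_indep {x y : A} (hx : ¬ IsOfFinOrder x) (h : ¬ Indep x y) :
    ∃ i j : ℤ, j ≠ 0 ∧ x ^ i = y ^ j := by
  unfold Indep at h
  push Not at h
  obtain ⟨i, j, h1, h2⟩ := h
  refine ⟨i, -j, fun hj => ?_, ?_⟩
  · have hj : j = 0 := by omega
    subst hj
    rw [zpow_zero, mul_one] at h1
    exact hx (isOfFinOrder_iff_zpow_eq_one.2 ⟨i, fun hi => h2 hi rfl, h1⟩)
  · rw [zpow_neg]
    exact eq_inv_of_mul_eq_one_left h1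

theorem Indep.of_not_isOfFinOrder {c d x : A} (h : Indep c d) (hx : ¬ IsOfFinOrder x) :
    Indep x c ∨ Indep x d := by
  by_contra! h1
  obtain ⟨i, j, hj, hij⟩ := exists_zpow_eq_of_not_indep hx h1.1
  obtain ⟨k, l, hl, hkl⟩ := exists_zpow_eq_of_not_indep hx h1.2
  have h2 := h (j * k) (-(l * i)) (by
    rw [zpow_mul, zpow_neg, zpow_mul, ← hij, ← hkl, zpow_comm, mul_inv_cancel])
  have hk : k = 0 := by
    rcases mul_eq_zero.1 h2.1 with h3 | h3
    · exact absurd h3 hj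
    · exact h3
  rw [hk, zpow_zero] at hkl
  exact hl (h.symm.eq_zero_left hkl.symm)

/-- Modulo the kernel, `y` is a power of the independent step `c`, with which it does not commute.
-/
theorem GridSetup.hamDoubleRay_of_map_eq_zpow (h : GridSetup π p T c d) {y : G} (hy : y ∈ T)
    (hyc : y * c ≠ c * y) (hdc : Commute d c) (hdy : Commute d y) {e : ℤ} (he0 : e ≠ 0)
    (he : π y = π c ^ e) : HamDoubleRay (stepRel T) := by
  -- for `e = ±1` two steps lie over the same element; otherwise `c` has finite order greater
  -- than `1` modulo `⟨y, d⟩`, and `y` and `c` exchange their roles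
  by_cases h1 : e = 1
  · exact h.hamDoubleRay_of_doubleEdge hy (by rw [he, h1, zpow_one]) (by rintro rfl; exact hyc rfl)
      hdc hdy
  by_cases h2 : e = -1
  · refine h.hamDoubleRay_of_doubleEdge (h.inv_mem y hy)
      (by rw [map_inv, he, h2, zpow_neg_one, inv_inv]) ?_ hdc hdy.inv_right
    rintro rfl
    exact hyc (by simp)
  have h' : GridSetup π p T y d := ⟨h.kernel, h.inv_mem, h.gen, hy, h.mem_right, fun i j hij => by
    rw [he, ← zpow_mul] at hij
    have := h.indep _ _ hij
    exact ⟨(mul_eq_zero.1 this.1).resolve_left he0, this.2⟩⟩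
  refine h'.hamDoubleRay_of_commute_right h.mem_left hyc.symm hdc ?_
  set M := Subgroup.zpowers (π y) ⊔ Subgroup.zpowers (π d)
  have hpos : 0 < orderOf (π c : A ⧸ M) := by
    rw [orderOf_pos_iff, isOfFinOrder_iff_zpow_eq_one]
    refine ⟨e, he0, ?_⟩
    rw [← QuotientGroup.mk_zpow, QuotientGroup.eq_one_iff, ← he]
    exact Subgroup.mem_sup_left (Subgroup.mem_zpowers _)
  have hne : orderOf (π c : A ⧸ M) ≠ 1 := by
    rw [Ne, orderOf_eq_one_iff, QuotientGroup.eq_one_iff]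
    intro hmem
    obtain ⟨i, j, hij⟩ := mem_zpowers_sup.1 hmem
    have := h.indep (e * i - 1) j (by
      rw [zpow_sub, zpow_mul, ← he, zpow_one, mul_right_comm, hij, mul_inv_cancel])
    have h3 : e * i = 1 := by omega
    rcases Int.eq_one_or_neg_one_of_mul_eq_one h3 with h4 | h4
    · exact h1 h4
    · exact h2 h4
  omega

/-- If the independent step `c` does not commute with some step `y`, although independent steps
commute, then a power of `y` lies in `⟨c⟩`. If `y` commutes with `d`, a flexible block is obtained
from the powers of `y` modulo `⟨c, d⟩`; otherwise `y` has finite order in `A`. -/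
theorem GridSetup.hamDoubleRay_of_dependent (h : GridSetup π p T c d)
    (hcomm : ∀ u ∈ T, ∀ v ∈ T, Indep (π u) (π v) → Commute u v)
    (hpow : ∀ u ∈ T, IsOfFinOrder (π u) → u ^ orderOf (π u) = 1) {y : G} (hy : y ∈ T)
    (hyc : y * c ≠ c * y) : HamDoubleRay (stepRel T) := by
  have hdc : Commute d c := hcomm _ h.mem_right _ h.mem_left h.indep.symm
  have hny : ¬ Indep (π c) (π y) := fun h1 => hyc (hcomm _ h.mem_left _ hy h1).symm
  obtain ⟨i, j, hj, hij⟩ := exists_zpow_eq_of_not_indep h.indep.not_isOfFinOrder_left hny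
  by_cases hdy : Commute d y
  · by_cases hn : 2 ≤ orderOf (π y : A ⧸ (Subgroup.zpowers (π c) ⊔ Subgroup.zpowers (π d)))
    · exact h.hamDoubleRay_of_commute_right hy hyc hdy hn
    set M := Subgroup.zpowers (π c) ⊔ Subgroup.zpowers (π d)
    have hpos : 0 < orderOf (π y : A ⧸ M) := by
      rw [orderOf_pos_iff, isOfFinOrder_iff_zpow_eq_one]
      refine ⟨j, hj, ?_⟩
      rw [← QuotientGroup.mk_zpow, QuotientGroup.eq_one_iff, ← hij]
      exact Subgroup.mem_sup_left (Subgroup.zpow_mem_zpowers _ _)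
    have hmem : π y ∈ M := by
      rw [← QuotientGroup.eq_one_iff, ← orderOf_eq_one_iff]
      omega
    obtain ⟨e, f, hef⟩ := mem_zpowers_sup.1 hmem
    have h1 := h.indep (e * j - i) (f * j) (by
      rw [zpow_sub, zpow_mul, zpow_mul, mul_right_comm, ← mul_zpow, ← hef, hij, mul_inv_cancel])
    have hf : f = 0 := (mul_eq_zero.1 h1.2).resolve_right hj
    rw [hf, zpow_zero, mul_one] at hef
    refine h.hamDoubleRay_of_map_eq_zpow hy hyc hdc hdy (e := e) ?_ hef
    rintro rfl
    rw [zpow_zero] at hef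
    have h2 := hpow y hy (by rw [hef]; exact IsOfFinOrder.one)
    rw [hef, orderOf_one, pow_one] at h2
    rw [h2] at hyc
    simp at hyc
  · refine h.hamDoubleRay_of_finite_order hy ?_ ?_ hyc (fun h1 => hdy h1.symm)
    all_goals
      have hfin : IsOfFinOrder (π y) := by
        obtain ⟨k, l, hl, hkl⟩ := exists_zpow_eq_of_not_indep h.indep.symm.not_isOfFinOrder_left
          (fun h1 => hdy (hcomm _ h.mem_right _ hy h1))
        have h1 := h.indep (i * l) (-(k * j)) (by
          rw [zpow_mul, zpow_neg, zpow_mul, hij, hkl, zpow_comm, mul_inv_cancel])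
        have hi : i = 0 := (mul_eq_zero.1 h1.1).resolve_right hl
        rw [hi, zpow_zero] at hij
        exact isOfFinOrder_iff_zpow_eq_one.2 ⟨j, hj, hij.symm⟩
    · exact hfin
    · exact hpow y hy hfin

/-- If `T` contains two independent steps and two steps that do not commute, then the Cayley graph
has a Hamiltonian double ray. -/
theorem GridSetup.hamDoubleRay (h : GridSetup π p T c d) {a b : G} (ha : a ∈ T) (hb : b ∈ T)
    (hab : a * b ≠ b * a) : HamDoubleRay (stepRel T) := by
  by_cases hcomm : ∀ u ∈ T, ∀ v ∈ T, Indep (π u) (π v) → Commute u v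
  swap
  · push Not at hcomm
    obtain ⟨u, hu, v, hv, hi, hne⟩ := hcomm
    exact GridSetup.hamDoubleRay_of_not_commute (p := p) (c := u) (d := v)
      ⟨h.kernel, h.inv_mem, h.gen, hu, hv, hi⟩ hne
  by_cases hpow : ∀ u ∈ T, IsOfFinOrder (π u) → u ^ orderOf (π u) = 1
  swap
  · push Not at hpow
    obtain ⟨u, hu, hfin, hne⟩ := hpow
    exact h.hamDoubleRay_of_pow_ne_one hu hfin hne
  have key : ∀ x ∈ T, ∀ y ∈ T, y * x ≠ x * y → ¬ IsOfFinOrder (π x) →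
      HamDoubleRay (stepRel T) := by
    intro x hx y hy hyx hinf
    rcases h.indep.of_not_isOfFinOrder hinf with h1 | h1
    · exact GridSetup.hamDoubleRay_of_dependent (p := p) (d := c)
        ⟨h.kernel, h.inv_mem, h.gen, hx, h.mem_left, h1⟩ hcomm hpow hy hyx
    · exact GridSetup.hamDoubleRay_of_dependent (p := p) (d := d)
        ⟨h.kernel, h.inv_mem, h.gen, hx, h.mem_right, h1⟩ hcomm hpow hy hyx
  have hne : ∀ x ∈ T, IsOfFinOrder (π x) → x ≠ 1 → π x ≠ 1 := by
    intro x hx hfin hx1 h1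
    have := hpow x hx hfin
    rw [h1, orderOf_one, pow_one] at this
    exact hx1 this
  by_cases hfa : IsOfFinOrder (π a)
  swap
  · exact key a ha b hb hab.symm hfa
  by_cases hfb : IsOfFinOrder (π b)
  swap
  · exact key b hb a ha hab hfb
  have hcx : ∀ x ∈ T, ¬ Commute c x → HamDoubleRay (stepRel T) := fun x hx h1 =>
    key c h.mem_left x hx (fun h2 => h1 h2.symm) h.indep.not_isOfFinOrder_left
  have hdx : ∀ x ∈ T, ¬ Commute d x → HamDoubleRay (stepRel T) := fun x hx h1 =>
    key d h.mem_right x hx (fun h2 => h1 h2.symm) h.indep.symm.not_isOfFinOrder_left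
  by_cases hca : Commute c a
  swap
  · exact hcx a ha hca
  by_cases hcb : Commute c b
  swap
  · exact hcx b hb hcb
  by_cases hda : Commute d a
  swap
  · exact hdx a ha hda
  by_cases hdb : Commute d b
  swap
  · exact hdx b hb hdb
  refine h.hamDoubleRay_of_finite_orders ha hb hab hca hcb hda hdb hfa hfb (hne a ha hfa ?_)
    (hne b hb hfb ?_)
  · rintro rfl
    simp at hab
  · rintro rfl
    simp at hab

end Combine

/-! ### Ends of locally finite graphs -/

section Ends

open CategoryTheory

namespace SimpleGraph

variable {V : Type*} {X : SimpleGraph V}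

/-- In a locally finite connected graph, every infinite component of the complement of a finite
vertex set contains an end. -/
theorem exists_end_of_infinite [X.LocallyFinite] (hX : X.Preconnected) {K : Finset V}
    (C : X.ComponentCompl (K : Set V)) (hC : C.supp.Infinite) :
    ∃ ω : X.end, ω.1 (Opposite.op K) = C := by
  have : Infinite V := Set.infinite_univ_iff.1 (hC.mono (Set.subset_univ _))
  have : Fact X.Preconnected := ⟨hX⟩
  set F := X.componentComplFunctor
  have hfin : ∀ j, Finite (F.obj j) := fun j => X.componentCompl_finite j.unop
  have hne : ∀ j, Nonempty (F.obj j) := fun j => X.componentCompl_nonempty_of_infinite j.unop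
  have hML : F.IsMittagLeffler :=
    F.isMittagLeffler_of_exists_finite_range fun j => ⟨j, 𝟙 j, Set.toFinite _⟩
  have hne' : ∀ j, Nonempty (F.toEventualRanges.obj j) := F.toEventualRanges_nonempty hML
  obtain ⟨s, hs⟩ := F.toEventualRanges.eval_section_surjective_of_surjective
    (F.surjective_toEventualRanges hML) (Opposite.op K)
    ⟨C, (X.infinite_iff_in_eventualRange (K := Opposite.op K) C).1 hC⟩
  exact ⟨F.toEventualRangesSectionsEquiv s, congrArg Subtype.val hs⟩

theorem infinite_of_end (ω : X.end) (K : Finset V) : (ω.1 (Opposite.op K)).supp.Infinite := by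
  refine (ComponentCompl.infinite_iff_in_all_ranges (K := K) _).2 fun L h => ?_
  exact ⟨ω.1 (Opposite.op L), ω.2 (opHomOfLE h)⟩

theorem IsOneEnded.infinite (h : X.IsOneEnded) : Infinite V := by
  obtain ⟨ω, hω, -⟩ := h
  exact Set.infinite_univ_iff.1 ((infinite_of_end ⟨ω, hω⟩ ∅).mono (Set.subset_univ _))

theorem IsOneEnded.eq_of_infinite [X.LocallyFinite] (h : X.IsOneEnded) (hX : X.Preconnected)
    {K : Finset V} (C D : X.ComponentCompl (K : Set V)) (hC : C.supp.Infinite)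
    (hD : D.supp.Infinite) : C = D := by
  obtain ⟨ω, rfl⟩ := exists_end_of_infinite hX C hC
  obtain ⟨η, rfl⟩ := exists_end_of_infinite hX D hD
  have : ω = η := Subtype.ext (h.unique ω.2 η.2)
  rw [this]

/-- A one-ended graph has no infinite vertex set with infinite complement such that the deletion
of a finite set of vertices destroys all edges between the two. -/
theorem IsOneEnded.not_separated [X.LocallyFinite] (h : X.IsOneEnded) (hX : X.Preconnected)
    {K : Finset V} {P : V → Prop}
    (hP : ∀ u v, u ∉ K → v ∉ K → X.Adj u v → P u → P v)
    (h1 : {v | v ∉ K ∧ P v}.Infinite) (h2 : {v | v ∉ K ∧ ¬ P v}.Infinite) : False := by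
  have : Fact X.Preconnected := ⟨hX⟩
  have hfin : Finite (X.ComponentCompl (K : Set V)) := X.componentCompl_finite K
  have key : ∀ Q : V → Prop, {v | v ∉ K ∧ Q v}.Infinite →
      ∃ C : X.ComponentCompl (K : Set V), {v | v ∈ C.supp ∧ Q v}.Infinite := by
    intro Q hQ
    by_contra! hall
    refine hQ ((Set.finite_iUnion fun C => hall C).subset fun v hv => ?_)
    exact Set.mem_iUnion.2 ⟨X.componentComplMk (by simpa using hv.1), ⟨_, rfl⟩, hv.2⟩
  -- the property `P` is constant on components
  have const : ∀ C : X.ComponentCompl (K : Set V), ∀ u v, u ∈ C.supp → v ∈ C.supp → P u → P v := by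
    rintro C u v ⟨hu, rfl⟩ ⟨hv, hv'⟩ hPu
    obtain ⟨w⟩ := ConnectedComponent.exact hv'.symm
    suffices ∀ (x y : ↥((K : Set V)ᶜ)), (X.induce (K : Set V)ᶜ).Walk x y → P x → P y from
      this _ _ w hPu
    intro x y w
    induction w with
    | nil => exact id
    | @cons x z _ hadj _ ih => exact fun hx => ih (hP x z x.2 z.2 hadj hx)
  obtain ⟨C, hC⟩ := key P h1
  obtain ⟨D, hD⟩ := key (fun v => ¬ P v) h2
  have hCD := h.eq_of_infinite hX C D (hC.mono fun v hv => hv.1) (hD.mono fun v hv => hv.1)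
  obtain ⟨u, hu, hPu⟩ := hC.nonempty
  obtain ⟨v, hv, hPv⟩ := hD.nonempty
  exact hPv (const D u v (hCD ▸ hu) hv hPu)

end SimpleGraph

end Ends

/-! ### Independent steps in one-ended Cayley graphs -/

section TwoEnded

variable {G A : Type*} [Group G] [CommGroup A] {π : G →* A}

theorem isTorsion_of_closure_eq_top {B : Type*} [CommGroup B] {s : Set B}
    (hs : Subgroup.closure s = ⊤) (h : ∀ x ∈ s, IsOfFinOrder x) : IsMulTorsion B := by
  have h1 : Subgroup.closure s ≤ CommGroup.torsion B := (Subgroup.closure_le _).2 h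
  intro x
  exact h1 (hs ▸ Subgroup.mem_top x)

theorem finite_of_closure_eq_top {B : Type*} [CommGroup B] {s : Set B} (hfin : s.Finite)
    (hs : Subgroup.closure s = ⊤) (h : ∀ x ∈ s, IsOfFinOrder x) : Finite B := by
  have : Group.FG B := Group.fg_iff.2 ⟨s, hs, hfin⟩
  exact CommGroup.finite_of_fg_isMulTorsion B (isTorsion_of_closure_eq_top hs h)

theorem finite_preimage_of_finite_ker [Finite π.ker] {s : Set A} (hs : s.Finite) :
    (π ⁻¹' s).Finite := by
  refine hs.preimage' fun a _ => ?_
  rcases (π ⁻¹' {a}).eq_empty_or_nonempty with h | ⟨g, hg⟩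
  · rw [h]; exact Set.finite_empty
  · refine (((π.ker : Set G).toFinite).image (g * ·)).subset fun x hx => ⟨g⁻¹ * x, ?_, by simp⟩
    have hg : π g = a := hg
    have hx : π x = a := hx
    simp [MonoidHom.mem_ker, hg, hx]

/-- A height function of an abelian group that contains `⟨c⟩ ≅ ℤ` as a subgroup of finite index `e`:
the height of `x` is the exponent `n` with `x ^ e = c ^ n`. -/
theorem exists_height {c : A} (hc : ¬ IsOfFinOrder c) [Finite (A ⧸ Subgroup.zpowers c)] :
    ∃ h : A → ℤ, (∀ x y, h (x * y) = h x + h y) ∧ (∀ n : ℤ, h (c ^ n) = h c * n) ∧ 0 < h c ∧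
      ∀ B : ℤ, {x | |h x| ≤ B}.Finite := by
  set e := Nat.card (A ⧸ Subgroup.zpowers c)
  have hepos : 0 < e := Nat.card_pos
  have hinj : Function.Injective fun n : ℤ => c ^ n :=
    injective_zpow_iff_not_isOfFinOrder.2 hc
  have hex : ∀ x : A, ∃ n : ℤ, c ^ n = x ^ e := by
    intro x
    rw [← Subgroup.mem_zpowers_iff, ← QuotientGroup.eq_one_iff, QuotientGroup.mk_pow]
    exact pow_card_eq_one'
  choose h hh using hex
  have hadd : ∀ x y, h (x * y) = h x + h y := fun x y => hinj (by
    simp only [zpow_add, hh, mul_pow])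
  have hcn : ∀ n : ℤ, h (c ^ n) = e * n := fun n => hinj (by
    simp only [hh]
    rw [← zpow_natCast, ← zpow_mul, mul_comm])
  have hce : h c = e := by simpa using hcn 1
  refine ⟨h, hadd, fun n => by rw [hcn, hce], by rw [hce]; exact_mod_cast hepos, fun B => ?_⟩
  refine Set.Finite.of_injOn (f := fun x => (h x, (x : A ⧸ Subgroup.zpowers c)))
    (t := Set.Icc (-B) B ×ˢ Set.univ) ?_ ?_ ((Set.finite_Icc _ _).prod Set.finite_univ)
  · intro x hx
    exact ⟨abs_le.1 hx, Set.mem_univ _⟩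
  · intro x _ y _ hxy
    obtain ⟨h1, h2⟩ := Prod.ext_iff.1 hxy
    obtain ⟨n, hn⟩ := Subgroup.mem_zpowers_iff.1 (QuotientGroup.eq.1 h2)
    have h3 : y = x * c ^ n := by rw [hn, mul_inv_cancel_left]
    have h4 : h y = h x + e * n := by rw [h3, hadd, hcn]
    have h5 : (e : ℤ) * n = 0 := by
      dsimp only at h1
      omega
    have h6 : n = 0 := by
      rcases mul_eq_zero.1 h5 with h6 | h6
      · omega
      · exact h6
    rw [h3, h6, zpow_zero, mul_one]

/-- If the steps of a Cayley graph are pairwise dependent modulo a finite kernel, then the group is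
finite or virtually cyclic, so that the graph is not one-ended. In the latter case, the elements of
large positive and of large negative height lie in different components after the deletion of the
finitely many elements of small height. -/
theorem exists_indep_of_isOneEnded [Finite π.ker] {T : Set G}
    (hT : T.Finite) (hgen : Subgroup.closure (π '' T) = ⊤) {X : SimpleGraph G} [X.LocallyFinite]
    (hX : X.Preconnected) (hadj : ∀ u v, X.Adj u v → u⁻¹ * v ∈ T) (hend : X.IsOneEnded) :
    ∃ c ∈ T, ∃ d ∈ T, Indep (π c) (π d) := by
  by_contra! hdep
  by_cases hall : ∀ x ∈ T, IsOfFinOrder (π x)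
  · have : Finite A := finite_of_closure_eq_top (hT.image π) hgen (by
      rintro _ ⟨x, hx, rfl⟩
      exact hall x hx)
    have h1 := finite_preimage_of_finite_ker (π := π) (Set.finite_univ (α := A))
    rw [Set.preimage_univ] at h1
    have := hend.infinite
    exact Set.infinite_univ h1
  push Not at hall
  obtain ⟨c, hcT, hc⟩ := hall
  have : Finite (A ⧸ Subgroup.zpowers (π c)) := by
    refine finite_of_closure_eq_top (s := QuotientGroup.mk' _ '' (π '' T)) ((hT.image π).image _)
      ?_ ?_
    · rw [← MonoidHom.map_closure, hgen, ← MonoidHom.range_eq_map,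
        MonoidHom.range_eq_top.2 (QuotientGroup.mk'_surjective _)]
    · rintro _ ⟨_, ⟨x, hx, rfl⟩, rfl⟩
      obtain ⟨i, j, hj, hij⟩ := exists_zpow_eq_of_not_indep hc (hdep c hcT x hx)
      refine isOfFinOrder_iff_zpow_eq_one.2 ⟨j, hj, ?_⟩
      rw [← map_zpow, QuotientGroup.mk'_apply, QuotientGroup.eq_one_iff, ← hij]
      exact Subgroup.zpow_mem_zpowers _ _
  obtain ⟨h, hadd, hpow, hpos, hfib⟩ := exists_height hc
  obtain ⟨B, hB⟩ := (hT.image fun t => |h (π t)|).bddAbove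
  have hB' : ∀ t ∈ T, |h (π t)| ≤ B := fun t ht => hB ⟨t, ht, rfl⟩
  have hB0 : 0 ≤ B := (abs_nonneg _).trans (hB' c hcT)
  have hK : {g : G | |h (π g)| ≤ B}.Finite := finite_preimage_of_finite_ker (hfib B)
  have hinf : ∀ Q : ℤ → Prop, (∃ f : ℕ → ℤ, Function.Injective f ∧ ∀ n, B < |h (π c) * f n| ∧
      Q (h (π c) * f n)) → {g | g ∉ hK.toFinset ∧ Q (h (π g))}.Infinite := by
    rintro Q ⟨f, hf, hfQ⟩
    refine Set.infinite_of_injective_forall_mem (f := fun n => c ^ f n) ?_ fun n => ?_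
    · intro m n hmn
      refine hf (injective_zpow_iff_not_isOfFinOrder.2 hc ?_)
      simpa using congrArg π hmn
    · rw [Set.mem_ofPred_eq, Set.Finite.mem_toFinset, Set.mem_ofPred_eq, map_zpow, hpow, not_le]
      exact hfQ n
  refine hend.not_separated hX (K := hK.toFinset) (P := fun g => 0 < h (π g)) ?_ ?_ ?_
  · intro u v hu hv huv hPu
    rw [Set.Finite.mem_toFinset, Set.mem_ofPred_eq, not_le] at hu
    have h1 := hadd (π u) (π (u⁻¹ * v))
    rw [← map_mul, mul_inv_cancel_left] at h1
    have h2 := abs_le.1 (hB' _ (hadj u v huv))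
    rw [abs_of_pos hPu] at hu
    show 0 < h (π v)
    omega
  · refine hinf (fun n => 0 < n) ⟨fun n => B + 1 + n, fun m n hmn => ?_, fun n => ?_⟩
    · dsimp only at hmn
      omega
    · have : 0 < h (π c) * (B + 1 + n) := by positivity
      refine ⟨?_, this⟩
      rw [abs_of_pos this]
      nlinarith
  · refine hinf (fun n => ¬ 0 < n) ⟨fun n => -(B + 1 + n), fun m n hmn => ?_, fun n => ?_⟩
    · dsimp only at hmn
      omega
    · have : 0 < h (π c) * (B + 1 + n) := by positivity
      rw [mul_neg, abs_neg, abs_of_pos this]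
      exact ⟨by nlinarith, by omega⟩

end TwoEnded

/-! ### The circle formed by a spanning double ray and the end -/

section Circle

open Set Topology

namespace SimpleGraph

variable {V : Type*} {X : SimpleGraph V}

namespace Realization

theorem exists_pos (x : X.Realization) : ∃ a, 0 < x.1 a := by
  classical
  obtain ⟨x, u, v, -, s, t, hs, ht, hst, rfl⟩ := x
  simp only [Pi.add_apply, Pi.smul_apply, smul_eq_mul, Pi.single_apply]
  rcases hs.lt_or_eq with h | h
  · refine ⟨u, ?_⟩
    rw [if_pos rfl]
    split_ifs <;> linarith
  · refine ⟨v, ?_⟩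
    rw [if_pos rfl, ← h]
    linarith

theorem eq_or_adj_of_pos (x : X.Realization) {a b : V} (ha : 0 < x.1 a) (hb : 0 < x.1 b) :
    a = b ∨ X.Adj a b := by
  classical
  obtain ⟨u, v, huv, s, t, -, -, -, hx⟩ := x.2
  have key : ∀ w, 0 < (s • Pi.single u 1 + t • Pi.single v 1 : V → ℝ) w → w = u ∨ w = v := by
    intro w hw
    by_contra! h
    simp [h.1, h.2] at hw
  rw [← hx] at ha hb
  rcases key a (by convert! ha) with rfl | rfl <;> rcases key b (by convert! hb) with rfl | rfl
  · exact Or.inl rfl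
  · exact huv
  · exact huv.imp Eq.symm fun h => h.symm
  · exact Or.inl rfl

theorem continuous_coord (a : V) : Continuous fun x : X.Realization => x.1 a :=
  (continuous_apply a).comp continuous_subtype_val

instance : T2Space X.Realization := inferInstanceAs (T2Space (Subtype _))

end Realization

namespace Freudenthal

theorem isOpen_point_image {O : Set X.Realization} (hO : IsOpen O) :
    IsOpen (Freudenthal.point '' O) :=
  TopologicalSpace.isOpen_generateFrom_of_mem (Or.inl ⟨O, hO, rfl⟩)

theorem isOpen_endNhd (K : Finset V) (ω : X.end) : IsOpen (endNhd X K ω) :=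
  TopologicalSpace.isOpen_generateFrom_of_mem (Or.inr ⟨K, ω, rfl⟩)

/-- A point `x` of the `1`-complex with positive coordinate at `a` is separated from an end by
deleting `a` and its neighbours. -/
theorem exists_disjoint_endNhd [X.LocallyFinite] (x : X.Realization) (ω : X.end) :
    ∃ (O : Set X.Realization) (K : Finset V), IsOpen O ∧ x ∈ O ∧
      Disjoint (Freudenthal.point '' O) (endNhd X K ω) := by
  classical
  obtain ⟨a, ha⟩ := x.exists_pos
  refine ⟨{y | 0 < y.1 a}, insert a (X.neighborFinset a),
    isOpen_lt continuous_const (Realization.continuous_coord a), ha, ?_⟩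
  rw [Set.disjoint_left]
  rintro _ ⟨y, hy, rfl⟩ ⟨v, ⟨hv, -⟩, hyv⟩
  refine hv ?_
  rcases y.eq_or_adj_of_pos hy hyv with rfl | h
  · simp
  · simp [h]

/-- With at most one end, the Freudenthal compactification is Hausdorff. -/
theorem t2Space_of_subsingleton [X.LocallyFinite] [Subsingleton X.end] : T2Space X.Freudenthal := by
  refine ⟨fun z w hzw => ?_⟩
  rcases z with x | ω <;> rcases w with y | η
  · obtain ⟨U, W, hU, hW, hx, hy, hd⟩ := t2_separation (fun h : x = y => hzw (by rw [h]))
    refine ⟨_, _, isOpen_point_image hU, isOpen_point_image hW, ⟨x, hx, rfl⟩, ⟨y, hy, rfl⟩, ?_⟩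
    exact (Set.disjoint_image_iff fun _ _ h => by injection h).2 hd
  · obtain ⟨O, K, hO, hx, hd⟩ := exists_disjoint_endNhd x η
    exact ⟨_, _, isOpen_point_image hO, isOpen_endNhd K η, ⟨x, hx, rfl⟩, rfl, hd⟩
  · obtain ⟨O, K, hO, hx, hd⟩ := exists_disjoint_endNhd y ω
    exact ⟨_, _, isOpen_endNhd K ω, isOpen_point_image hO, rfl, ⟨y, hx, rfl⟩, hd.symm⟩
  · exact absurd (by rw [Subsingleton.elim ω η]) hzw

end Freudenthal

/-- The tent function of height `1` and width `2` centred at `n`. -/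
noncomputable def tent (n : ℤ) (t : ℝ) : ℝ := max 0 (1 - |t - n|)

theorem continuous_tent (n : ℤ) : Continuous (tent n) := by
  unfold tent
  fun_prop

/-- The values of the tent functions are the barycentric coordinates of `t` in `[⌊t⌋, ⌊t⌋ + 1]`. -/
theorem tent_eq (m : ℤ) (t : ℝ) : tent m t =
    (1 - Int.fract t) * (if m = ⌊t⌋ then 1 else 0) +
      Int.fract t * (if m = ⌊t⌋ + 1 then 1 else 0) := by
  have h0 := Int.fract_nonneg t
  have h1 := Int.fract_lt_one t
  have ht := Int.floor_add_fract t
  unfold tent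
  rcases lt_trichotomy m ⌊t⌋ with h | rfl | h
  · have h2 : (m : ℝ) + 1 ≤ ⌊t⌋ := by exact_mod_cast h
    rw [if_neg (by omega), if_neg (by omega), max_eq_left]
    · ring
    · rw [abs_of_nonneg (by linarith)]
      linarith
  · rw [if_pos rfl, if_neg (by omega), abs_of_nonneg (by linarith), max_eq_right (by linarith)]
    linarith
  · rcases (Int.add_one_le_iff.2 h).eq_or_lt with rfl | h
    · push_cast
      rw [if_neg (by omega), if_pos rfl, abs_of_nonpos (by linarith), max_eq_right (by linarith)]
      linarith
    · have h2 : (⌊t⌋ : ℝ) + 1 + 1 ≤ m := by exact_mod_cast h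
      rw [if_neg (by omega), if_neg (by omega), max_eq_left]
      · ring
      · rw [abs_of_nonpos (by linarith)]
        linarith

theorem eq_of_tent_eq {t t' : ℝ} (h : ∀ n, tent n t = tent n t') : t' = t := by
  have h0 := Int.fract_nonneg t
  have h1 := Int.fract_lt_one t
  have ht := Int.floor_add_fract t
  have e1 := h ⌊t⌋
  have e2 := h (⌊t⌋ + 1)
  rw [tent_eq, if_pos rfl, if_neg (by omega), mul_one, mul_zero, add_zero, tent] at e1
  rw [tent_eq, if_neg (by omega), if_pos rfl, mul_one, mul_zero, zero_add, tent] at e2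
  push_cast at e2
  rcases max_choice 0 (1 - |t' - ⌊t⌋|) with h2 | h2
  · linarith
  rw [h2] at e1
  rcases abs_choice (t' - ⌊t⌋) with h3 | h3
  · linarith
  rcases max_choice 0 (1 - |t' - (⌊t⌋ + 1)|) with h4 | h4
  · linarith
  rw [h4] at e2
  rcases abs_choice (t' - (⌊t⌋ + 1)) with h5 | h5 <;> linarith

/-- The parametrization of a double ray `φ` by the real line, `φ n` being reached at time `n`. -/
noncomputable def rayPoint (φ : ℤ ≃ V) (hφ : ∀ n, X.Adj (φ n) (φ (n + 1))) (t : ℝ) :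
    X.Realization :=
  ⟨fun v => tent (φ.symm v) t, φ ⌊t⌋, φ (⌊t⌋ + 1), Or.inr (hφ _), 1 - Int.fract t, Int.fract t,
    by linarith [Int.fract_lt_one t], Int.fract_nonneg t, by ring, by
      classical
      funext v
      rw [tent_eq]
      simp only [Pi.add_apply, Pi.smul_apply, smul_eq_mul, Pi.single_apply, Equiv.symm_apply_eq]⟩

variable {φ : ℤ ≃ V} {hφ : ∀ n, X.Adj (φ n) (φ (n + 1))}

theorem continuous_rayPoint : Continuous (rayPoint φ hφ) :=
  Continuous.subtype_mk (continuous_pi fun _ => continuous_tent _) _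

theorem rayPoint_injective : Function.Injective (rayPoint φ hφ) := by
  intro t t' h
  refine (eq_of_tent_eq fun n => ?_).symm
  have := congrFun (congrArg Subtype.val h) (φ n)
  simpa [rayPoint] using this

theorem rayPoint_intCast (n : ℤ) : rayPoint φ hφ n = Realization.ofVertex X (φ n) := by
  classical
  refine Subtype.ext (funext fun v => ?_)
  simp only [rayPoint, Realization.ofVertex, tent_eq, Int.fract_intCast, Int.floor_intCast,
    Pi.single_apply, Equiv.symm_apply_eq]
  simp

theorem mem_component_of_tail (hφ : ∀ n, X.Adj (φ n) (φ (n + 1))) {K : Finset V}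
    {C : X.ComponentCompl (K : Set V)} {N : ℤ} (hK : ∀ n, N ≤ n → φ n ∉ K) (hN : φ N ∈ C)
    (n : ℤ) (hn : N ≤ n) : φ n ∈ C := by
  induction n, hn using Int.leInduction with
  | base => exact hN
  | succ n hn ih => exact ComponentCompl.mem_of_adj _ _ ih (hK _ (by omega)) (hφ n)

/-- The positive tail of a spanning double ray in a one-ended graph converges to the end. -/
theorem exists_forall_mem_end [X.LocallyFinite] (hX : X.Preconnected) (ω : X.end)
    (hω : ∀ η : X.end, η = ω) (φ : ℤ ≃ V) (hφ : ∀ n, X.Adj (φ n) (φ (n + 1))) (K : Finset V) :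
    ∃ N : ℤ, ∀ n, N ≤ n → φ n ∈ (ω.1 (Opposite.op K)).supp := by
  obtain ⟨N, hN⟩ := (K.finite_toSet.image φ.symm).bddAbove
  have hK : ∀ n, N + 1 ≤ n → φ n ∉ K := by
    intro n hn h
    have := hN ⟨φ n, h, φ.symm_apply_apply n⟩
    omega
  set C := X.componentComplMk (K := (K : Set V)) (v := φ (N + 1)) (hK _ le_rfl)
  have hmem : ∀ n, N + 1 ≤ n → φ n ∈ C.supp := mem_component_of_tail hφ hK ⟨hK _ le_rfl, rfl⟩
  obtain ⟨η, hη⟩ := exists_end_of_infinite hX C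
    (((Set.Ici_infinite (N + 1)).image φ.injective.injOn).mono (by
      rintro _ ⟨n, hn, rfl⟩
      exact hmem n hn))
  rw [hω η] at hη
  exact ⟨N + 1, fun n hn => by rw [hη]; exact hmem n hn⟩

/-- Both tails of a spanning double ray in a one-ended graph converge to the end. -/
theorem exists_forall_abs_mem_end [X.LocallyFinite] (hX : X.Preconnected) (ω : X.end)
    (hω : ∀ η : X.end, η = ω) (φ : ℤ ≃ V) (hφ : ∀ n, X.Adj (φ n) (φ (n + 1))) (K : Finset V) :
    ∃ N : ℤ, ∀ n, N ≤ |n| → φ n ∈ (ω.1 (Opposite.op K)).supp := by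
  obtain ⟨N₁, h₁⟩ := exists_forall_mem_end hX ω hω φ hφ K
  obtain ⟨N₂, h₂⟩ := exists_forall_mem_end hX ω hω ((Equiv.neg ℤ).trans φ) (fun n => by
    have := (hφ (-(n + 1))).symm
    rwa [show -(n + 1) + 1 = -n by ring] at this) K
  refine ⟨max N₁ N₂, fun n hn => ?_⟩
  rcases abs_choice n with h | h
  · exact h₁ n (by omega)
  · have := h₂ (-n) (by omega)
    simpa using this

theorem nonempty_circle_homeomorph_onePoint : Nonempty (Circle ≃ₜ OnePoint ℝ) := by
  have h1 : ‖(1 : ℂ)‖ = 1 := norm_one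
  have : Fact (Module.finrank ℝ ℂ = 1 + 1) := ⟨Complex.finrank_real_complex⟩
  have hV : Module.finrank ℝ ℝ = Module.finrank ℝ (Submodule.span ℝ {(1 : ℂ)})ᗮ := by
    rw [Submodule.finrank_orthogonal_span_singleton (n := 1) one_ne_zero, Module.finrank_self]
  obtain ⟨e⟩ := FiniteDimensional.nonempty_continuousLinearEquiv_of_finrank_eq hV
  have e' := e.toHomeomorph.onePointCongr.trans (onePointHyperplaneHomeoUnitSphere h1)
  exact ⟨e'.symm⟩

/-- In a locally finite connected graph with one end, a spanning double ray becomes a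
circle when the end is added to it. -/
theorem IsOneEnded.exists_isHamiltonianCircle [X.LocallyFinite] (hX : X.Preconnected)
    (hend : X.IsOneEnded) (φ : ℤ ≃ V) (hφ : ∀ n, X.Adj (φ n) (φ (n + 1))) :
    ∃ C : Set X.Freudenthal, X.IsHamiltonianCircle C := by
  obtain ⟨ω, hω⟩ : ∃ ω : X.end, ∀ η : X.end, η = ω := by
    obtain ⟨ω, hω, h⟩ := hend
    exact ⟨⟨ω, hω⟩, fun η => Subtype.ext (h _ η.2)⟩
  have : Subsingleton X.end := ⟨fun a b => (hω a).trans (hω b).symm⟩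
  have : T2Space X.Freudenthal := Freudenthal.t2Space_of_subsingleton
  let f : OnePoint ℝ → X.Freudenthal := fun t =>
    t.elim (Freudenthal.atEnd ω) fun t => Freudenthal.point (rayPoint φ hφ t)
  have hcont : Continuous f := by
    refine continuous_generateFrom_iff.2 ?_
    rintro _ (⟨O, hO, rfl⟩ | ⟨K, η, rfl⟩)
    · have : f ⁻¹' (Freudenthal.point '' O) = (↑) '' (rayPoint φ hφ ⁻¹' O) := by
        ext t
        induction t using OnePoint.rec <;> simp [f]
      rw [this, OnePoint.isOpen_image_coe]
      exact hO.preimage continuous_rayPoint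
    · rw [hω η, OnePoint.isOpen_iff_of_mem (by simp [f, Freudenthal.endNhd])]
      set U : Set ℝ := (↑) ⁻¹' (f ⁻¹' Freudenthal.endNhd X K ω) with hU
      have hU' : U = ⋃ v ∈ (ω.1 (Opposite.op K)).supp, {t | 0 < tent (φ.symm v) t} := by
        ext t
        simp [hU, f, Freudenthal.endNhd, rayPoint]
      have hopen : IsOpen U := by
        rw [hU']
        exact isOpen_biUnion fun v _ => isOpen_lt continuous_const (continuous_tent _)
      -- outside a bounded interval, the vertex `φ ⌊t⌋` lies in the component of the end
      have hcl : IsClosed Uᶜ := hopen.isClosed_compl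
      refine ⟨hcl, ?_⟩
      obtain ⟨N, hN⟩ := exists_forall_abs_mem_end hX ω hω φ hφ K
      refine (isCompact_Icc (a := -(|(N : ℝ)| + 1)) (b := |(N : ℝ)| + 1)).of_isClosed_subset hcl ?_
      intro t ht
      by_contra hlarge
      refine ht ?_
      rw [hU', Set.mem_iUnion₂]
      refine ⟨φ ⌊t⌋, hN _ ?_, ?_⟩
      · have h1 := Int.floor_le t
        have h2 := Int.lt_floor_add_one t
        have h3 : (N : ℝ) ≤ |(⌊t⌋ : ℝ)| := by
          refine (le_abs_self (N : ℝ)).trans (le_abs.2 ?_)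
          by_contra! h4
          exact hlarge ⟨by linarith, by linarith⟩
        exact_mod_cast h3
      · rw [Set.mem_ofPred_eq, Equiv.symm_apply_apply, tent_eq, if_pos rfl, if_neg (by omega)]
        linarith [Int.fract_lt_one t]
  have hinj : Function.Injective f := by
    intro s t h
    induction s using OnePoint.rec <;> induction t using OnePoint.rec
    · rfl
    · simp [f] at h
    · simp [f] at h
    · simp only [f, OnePoint.elim_some, Freudenthal.point.injEq] at h
      rw [rayPoint_injective h]
  obtain ⟨e⟩ := nonempty_circle_homeomorph_onePoint
  refine ⟨range f, ⟨e.trans (hcont.isClosedEmbedding hinj).isEmbedding.toHomeomorph⟩, fun v => ?_⟩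
  refine ⟨((φ.symm v : ℤ) : ℝ), ?_⟩
  simp only [f, OnePoint.elim_some, rayPoint_intCast, Equiv.apply_symm_apply]

end SimpleGraph

end Circle

/-! ### Cayley graphs of groups with commutator subgroup of prime order -/

section Cayley

variable {G : Type*} [Group G]

theorem SimpleGraph.mulCayley_adj_iff_mem {S : Set G} {u v : G} :
    (SimpleGraph.mulCayley S).Adj u v ↔ u ≠ v ∧ u⁻¹ * v ∈ S ∪ S⁻¹ := by
  rw [SimpleGraph.mulCayley_adj', and_congr_right_iff]
  intro _
  constructor
  · rintro ⟨g, hg, rfl | rfl⟩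
    · exact Or.inl (by rwa [inv_mul_cancel_left])
    · exact Or.inr (by simpa using hg)
  · rintro (h | h)
    · exact ⟨_, h, Or.inl (mul_inv_cancel_left _ _)⟩
    · exact ⟨_, h, Or.inr (by simp)⟩

theorem SimpleGraph.preconnected_mulCayley {S : Set G} (hS : Subgroup.closure S = ⊤) :
    (SimpleGraph.mulCayley S).Preconnected := by
  have key : ∀ g h : G, (SimpleGraph.mulCayley S).Reachable h (h * g) := by
    intro g
    have hg : g ∈ Subgroup.closure S := hS ▸ Subgroup.mem_top g
    induction hg using Subgroup.closure_induction with
    | mem t ht =>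
      intro h
      by_cases h1 : h = h * t
      · rw [← h1]
      · refine (mulCayley_adj_iff_mem.2 ⟨h1, Or.inl ?_⟩).reachable
        rwa [inv_mul_cancel_left]
    | one => intro h; rw [mul_one]
    | mul a b _ _ iha ihb => intro h; rw [← mul_assoc]; exact (iha h).trans (ihb _)
    | inv a _ iha =>
      intro h
      have := iha (h * a⁻¹)
      rw [inv_mul_cancel_right] at this
      exact this.symm
  intro u v
  have := key (u⁻¹ * v) u
  rwa [mul_inv_cancel_left] at this

theorem exists_mul_ne_of_commutator_ne_bot {T : Set G} (hT : Subgroup.closure T = ⊤)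
    (h : commutator G ≠ ⊥) : ∃ a ∈ T, ∃ b ∈ T, a * b ≠ b * a := by
  by_contra! hall
  have h1 : Subgroup.closure T ≤ Subgroup.centralizer T :=
    (Subgroup.closure_le _).2 fun x hx y hy => hall y hy x hx
  have h2 : Subgroup.closure T ≤ Subgroup.centralizer Set.univ :=
    (Subgroup.closure_le _).2 fun x hx y _ => (h1 (hT ▸ Subgroup.mem_top y) x hx).symm
  refine h ?_
  rw [eq_bot_iff, commutator_def, Subgroup.commutator_le]
  intro x _ y _
  rw [Subgroup.mem_bot, commutatorElement_eq_one_iff_mul_comm]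
  exact (h2 (hT ▸ Subgroup.mem_top x) y (Set.mem_univ y)).symm

end Cayley

theorem mainTheorem4 {G : Type*} [Group G] (S : Set G) (hSfin : S.Finite)
    (hSgen : Subgroup.closure S = ⊤) {p : ℕ} (hp : p.Prime)
    (hG : Nonempty (commutator G ≃* Multiplicative (ZMod p)))
    (hend : (SimpleGraph.mulCayley S).IsOneEnded) :
    ∃ C : Set (SimpleGraph.mulCayley S).Freudenthal,
      (SimpleGraph.mulCayley S).IsHamiltonianCircle C := by
  set X := SimpleGraph.mulCayley S
  set T : Set G := S ∪ S⁻¹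
  set π : G →* Abelianization G := Abelianization.of with hπdef
  have hTfin : T.Finite := hSfin.union hSfin.inv
  have hTinv : ∀ t ∈ T, t⁻¹ ∈ T := by
    rintro t (ht | ht)
    · exact Or.inr (by simpa using ht)
    · exact Or.inl ht
  have hTgen : Subgroup.closure T = ⊤ :=
    top_le_iff.1 (hSgen.symm.le.trans (Subgroup.closure_mono Set.subset_union_left))
  have hadj : ∀ u v, X.Adj u v ↔ u ≠ v ∧ u⁻¹ * v ∈ T :=
    fun _ _ => SimpleGraph.mulCayley_adj_iff_mem
  have hconn : X.Preconnected := SimpleGraph.preconnected_mulCayley hSgen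
  have : X.LocallyFinite := fun v => by
    refine Set.Finite.fintype ((hTfin.image (v * ·)).subset fun w hw => ?_)
    exact ⟨v⁻¹ * w, ((hadj v w).1 hw).2, mul_inv_cancel_left _ _⟩
  obtain ⟨e⟩ := hG
  have hker : PrimeKernel π p := ⟨hp, QuotientGroup.mk'_surjective _, by
    rw [hπdef, Abelianization.ker_of, Nat.card_congr e.toEquiv]
    exact Nat.card_zmod p⟩
  have hkfin : Finite π.ker := Nat.finite_of_card_ne_zero (hker.card ▸ hp.ne_zero)
  have hπgen : Subgroup.closure (π '' T) = ⊤ := by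
    rw [← MonoidHom.map_closure, hTgen, ← MonoidHom.range_eq_map,
      MonoidHom.range_eq_top.2 hker.surj]
  obtain ⟨c, hc, d, hd, hcd⟩ := exists_indep_of_isOneEnded hTfin hπgen hconn
    (fun u v h => ((hadj u v).1 h).2) hend
  have hsetup : GridSetup π p T c d :=
    ⟨hker, hTinv, ⟨(hTfin.image π).toFinset, by simp, by simpa using hπgen⟩, hc, hd, hcd⟩
  obtain ⟨a, ha, b, hb, hab⟩ := exists_mul_ne_of_commutator_ne_bot hTgen (fun hbot => by
    have h1 := hker.card
    rw [hπdef, Abelianization.ker_of, hbot, Subgroup.card_bot] at h1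
    exact hp.one_lt.ne h1)
  obtain ⟨φ, hφ, hstep⟩ := hsetup.hamDoubleRay ha hb hab
  exact hend.exists_isHamiltonianCircle hconn (Equiv.ofBijective φ hφ) fun n =>
    (hadj _ _).2 ⟨fun h => by have := hφ.1 h; omega, hstep n⟩
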